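/- A network is a finite connected undirected simple graph $G=(V,E)$ with $|V|\ge 2$ and a length function $\ell:E\to\mathbb{R}$ with $\ell(e)\ge 1$ for every edge $e$. The length of a path is the sum of the lengths of its edges, $\mathrm{dist}(s,t)$ is the length of a shortest $s$–$t$ path, and the diameter is $D=\max_{s,t}\mathrm{dist}(s,t)$ (so $D\ge 1$). For $r>0$, an $r$-witness of a shortest path $P$ (which may consist of one vertex) is a shortest path $P'$ with $\ell(P')>r$ that equals $P$ or arises from $P$ by adding one vertex at one end or one vertex at each of the two ends. For a vertex $v$ let $S_r(v)$ be the set of all shortest paths $P$ that have an $r$-witness $P'$ with $\min_{w\in P'}\mathrm{dist}(v,w)\le 2r$. The highway dimension (HD) of the network is the smallest integer $h$ such that for all $r>0$ and $v\in V$ there is a set $H\subseteq V$ with $|H|\le h$ that contains a vertex of every path in $S_r(v)$. A hub labeling assigns to each $v\in V$ a label $L(v)$, a set of vertices ("hubs") stored together with their distances from $v$, such that for all $s,t\in V$ some vertex on a shortest $s$–$t$ path belongs to $L(s)\cap L(t)$; $|L(v)|$ is the number of hubs. It is a hierarchical hub labeling (HHL) if there is a bijection $\pi:V\to\{1,\dots,|V|\}$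 such that $u\in L(v)$ implies $\pi(u)\le\pi(v)$. Theorem. There are an absolute constant $C$, an algorithm $A$ and a polynomial $T$ such that the following holds. (1) Every network with HD $h$ and diameter $D$ has an HHL with $|L(v)|\le C\,h\,(1+\log_2 D)$ for all $v\in V$. (2) For every network with rational edge lengths (numerators and denominators given in binary) in which shortest paths are unique, i.e. any two vertices are joined by exactly one shortest path, $A$ outputs, within $T(\text{bit length of the input})$ steps of a random access machine with logarithmic cost, an HHL (hubs and their distances) with $|L(v)|\le C\,h\log_2 h\,(1+\log_2 D)$ for all $v\in V$, where $h$ is the HD and $D$ is the diameter. -/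

import Mathlib

noncomputable section

/-! ## Networks, shortest paths and hub labelings -/

/-- An undirected graph with real edge lengths. Only the values of `len` on edges matter. -/
structure Network (V : Type*) where
  graph : SimpleGraph V
  len : Sym2 V → ℝ

namespace Network

variable {V : Type*} (N : Network V)

/-- The length `ℓ(P)` of a walk. -/
def length {s t : V} (p : N.graph.Walk s t) : ℝ := (p.edges.map N.len).sum

/-- `p` is a shortest path between its end vertices. -/
def IsShortest {s t : V} (p : N.graph.Walk s t) : Prop :=
  ∀ q : N.graph.Walk s t, N.length p ≤ N.length q

/-- The distance between two vertices. -/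
def dist (s t : V) : ℝ := ⨅ p : N.graph.Walk s t, N.length p

/-- The diameter: the largest distance between two vertices. -/
def diameter : ℝ := ⨆ x : V × V, N.dist x.1 x.2

/-- Any two vertices are joined by at most one shortest path. -/
def UniqueShortestPaths : Prop :=
  ∀ (s t : V) (p q : N.graph.Walk s t), N.IsShortest p → N.IsShortest q → p = q

/-- `P'` is an `r`-witness for `P`: a shortest path of length greater than `r` that arises from `P`
by adding at most one vertex at each end. (In a simple graph a walk is determined by its sequence
of vertices `support`.) -/
def IsWitness (r : ℝ) {s t s' t' : V} (P' : N.graph.Walk s' t') (P : N.graph.Walk s t) : Prop :=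
  N.IsShortest P' ∧ r < N.length P' ∧
    (P'.support = P.support ∨
      (∃ a, P'.support = a :: P.support) ∨
      (∃ b, P'.support = P.support ++ [b]) ∨
      (∃ a b, P'.support = a :: (P.support ++ [b])))

/-- The shortest path `P` is `(r, d)`-close to `v`: it has an `r`-witness `P'` such that
`dist(v, P') = min_{w ∈ P'} dist(v, w)` is at most `d`. -/
def IsClose (r d : ℝ) (v : V) {s t : V} (P : N.graph.Walk s t) : Prop :=
  N.IsShortest P ∧ ∃ (s' t' : V) (P' : N.graph.Walk s' t'),
    N.IsWitness r P' P ∧ ∃ w ∈ P'.support, N.dist v w ≤ d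

/-- `H` is a hitting set for `S_r(v)`, the set of all shortest paths `(r, 2r)`-close to `v`. -/
def HitsNeighborhood (H : Finset V) (r : ℝ) (v : V) : Prop :=
  ∀ (s t : V) (P : N.graph.Walk s t), N.IsClose r (2 * r) v P → ∃ x ∈ P.support, x ∈ H

/-- The highway dimension: the smallest `h` such that for all `r > 0` and all `v` some set of at
most `h` vertices hits `S_r(v)`. -/
def highwayDimension : ℕ :=
  sInf {h : ℕ | ∀ r : ℝ, 0 < r → ∀ v : V, ∃ H : Finset V, H.card ≤ h ∧ N.HitsNeighborhood H r v}

/-- `L`, given by the set of hubs of each vertex (their distances are then determined), is a hub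
labeling (cover property): for all `s`, `t` (also for `s = t`) some vertex on a
shortest `s`-`t` path belongs to both labels. -/
def IsHubLabeling (L : V → Finset V) : Prop :=
  ∀ s t : V, ∃ p : N.graph.Walk s t, N.IsShortest p ∧ ∃ x ∈ p.support, x ∈ L s ∧ x ∈ L t

/-- A hierarchical hub labeling: for some order `π` of the vertices (smaller means more
important) the label of `v` only holds vertices that are at least as important as `v`. -/
def IsHHL [Fintype V] (L : V → Finset V) : Prop :=
  N.IsHubLabeling L ∧
    ∃ π : V ≃ Fin (Fintype.card V), ∀ u v : V, u ∈ L v → π u ≤ π v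

end Network

/-! ## A random access machine with logarithmic cost

Structured programs over natural-number variables and arrays, both indexed by `ℕ`. Evaluating any
expression node costs one plus the number of bits of its value, so addresses and operands are
charged by their bit length, and every command costs one more unit. -/

namespace RAM

inductive BinOp
  | add | sub | mul | div | mod | lt | eq

/-- Subtraction is truncated at zero, division rounds down, comparisons return `0` or `1`. -/
def BinOp.apply : BinOp → ℕ → ℕ → ℕ
  | .add, a, b => a + b
  | .sub, a, b => a - b
  | .mul, a, b => a * b
  | .div, a, b => a / b
  | .mod, a, b => a % b
  | .lt, a, b => if a < b then 1 else 0
  | .eq, a, b => if a = b then 1 else 0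

inductive Exp
  | const (k : ℕ)
  | var (x : ℕ)
  | load (a : ℕ) (i : Exp)
  | bin (op : BinOp) (e f : Exp)

/-- The contents of the memory: variables `var x` and arrays with cells `arr a i`. -/
structure Store where
  var : ℕ → ℕ
  arr : ℕ → ℕ → ℕ

def Exp.value (s : Store) : Exp → ℕ
  | .const k => k
  | .var x => s.var x
  | .load a i => s.arr a (i.value s)
  | .bin op e f => op.apply (e.value s) (f.value s)

def Exp.cost (s : Store) : Exp → ℕ
  | .const k => 1 + k.size
  | .var x => 1 + (s.var x).size
  | .load a i => i.cost s + (1 + (s.arr a (i.value s)).size)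
  | .bin op e f => e.cost s + f.cost s + (1 + (op.apply (e.value s) (f.value s)).size)

def Store.setVar (s : Store) (x k : ℕ) : Store :=
  { s with var := fun y => if y = x then k else s.var y }

def Store.setArr (s : Store) (a i k : ℕ) : Store :=
  { s with arr := fun b j => if b = a ∧ j = i then k else s.arr b j }

inductive Cmd
  | skip
  | assign (x : ℕ) (e : Exp)
  | store (a : ℕ) (i e : Exp)
  | seq (c d : Cmd)
  | cond (b : Exp) (c d : Cmd)
  | loop (b : Exp) (c : Cmd)

/-- `Exec c s t s'`: started in the store `s`, the command `c` halts after time `t` in the store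
`s'`. The guards of `cond` (if-then-else) and `loop` (while) count as true when nonzero. -/
inductive Exec : Cmd → Store → ℕ → Store → Prop
  | skip (s : Store) : Exec .skip s 1 s
  | assign (s : Store) (x : ℕ) (e : Exp) :
      Exec (.assign x e) s (1 + e.cost s) (s.setVar x (e.value s))
  | store (s : Store) (a : ℕ) (i e : Exp) :
      Exec (.store a i e) s (1 + i.cost s + e.cost s) (s.setArr a (i.value s) (e.value s))
  | seq {c d : Cmd} {s s' s'' : Store} {t t' : ℕ} :
      Exec c s t s' → Exec d s' t' s'' → Exec (.seq c d) s (1 + t + t') s''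
  | cond_true {b : Exp} {c d : Cmd} {s s' : Store} {t : ℕ} :
      b.value s ≠ 0 → Exec c s t s' → Exec (.cond b c d) s (1 + b.cost s + t) s'
  | cond_false {b : Exp} {c d : Cmd} {s s' : Store} {t : ℕ} :
      b.value s = 0 → Exec d s t s' → Exec (.cond b c d) s (1 + b.cost s + t) s'
  | loop_true {b : Exp} {c : Cmd} {s s' s'' : Store} {t t' : ℕ} :
      b.value s ≠ 0 → Exec c s t s' → Exec (.loop b c) s' t' s'' →
        Exec (.loop b c) s (1 + b.cost s + t + t') s''
  | loop_false {b : Exp} {c : Cmd} {s : Store} :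
      b.value s = 0 → Exec (.loop b c) s (1 + b.cost s) s

/-- The memory at the start: the input is in array `0`, everything else is zero. -/
def start (w : List ℕ) : Store where
  var _ := 0
  arr a i := if a = 0 then w.getD i 0 else 0

/-- The bit length of an input. -/
def inputSize (w : List ℕ) : ℕ := (w.map fun k => 1 + k.size).sum

end RAM

/-! ## Networks as inputs of algorithms -/

/-- A network on the vertices `0, …, n - 1` with rational edge lengths. -/
structure RationalNetwork (n : ℕ) where
  graph : SimpleGraph (Fin n)
  len : Sym2 (Fin n) → ℚ

namespace RationalNetwork

variable {n : ℕ} (N : RationalNetwork n)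

def toNetwork : Network (Fin n) where
  graph := N.graph
  len e := (N.len e : ℝ)

open Classical in
/-- The entry of the length matrix at `(i, j)`, which is `0` if `i` and `j` are not adjacent. -/
def entry (i j : Fin n) : ℚ := if N.graph.Adj i j then N.len s(i, j) else 0

/-- The input that describes `N`: the number `n`, the numerators of the entries of the length
matrix row by row, and their denominators row by row. -/
def encode : List ℕ :=
  n :: (List.ofFn (fun k : Fin (n * n) => (N.entry k.divNat k.modNat).num.natAbs) ++
    List.ofFn (fun k : Fin (n * n) => (N.entry k.divNat k.modNat).den))

/-- The store `s` holds the hub labeling `L` with its distances. Row `v`, column `u` of three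
`n × n` matrices: the cell of array `1` is nonzero if and only if `u` is a hub of `v`, and then
the cells of arrays `2` and `3` are numerator and denominator of `dist(v, u)`. -/
def Holds (s : RAM.Store) (L : Fin n → Finset (Fin n)) : Prop :=
  ∀ v u : Fin n,
    (u ∈ L v ↔ s.arr 1 (v.val * n + u.val) ≠ 0) ∧
    (u ∈ L v → s.arr 3 (v.val * n + u.val) ≠ 0 ∧
      N.toNetwork.dist v u =
        (s.arr 2 (v.val * n + u.val) : ℝ) / (s.arr 3 (v.val * n + u.val) : ℝ))

end RationalNetwork

end

/-!
Both labelings come from hitting sets `C i` at growing scales `r i`, where `C i` meets every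
shortest path longer than `r i`. A vertex is the more important the larger the last `i` with
`u ∈ C i` is, and the hubs of `v` are the vertices `u` that are most important on a shortest
`v`-`u` path (`Network.canonicalLabel`). The most important vertex of a shortest path is then a
hub of both of its ends, so this is a hierarchical hub labeling (`Network.isHHL_canonicalLabel`).
If `r i < dist(v, u) ≤ r (i + 1)` for a hub `u` of `v`, the path meets `C i`, hence `u` lies in
some `C j` with `j ≥ i`, not much farther than `r j` from `v`. So labels are small if the `C j`
are locally sparse (`Network.card_canonicalLabel_le`), the number of scales being logarithmic in
the diameter.

A minimum hitting set is locally sparse, because its part near `v` could be replaced by the at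
most `h` vertices provided by the highway dimension (`Network.exists_sparse_hitting_set`). This
proves existence.

For an algorithm, minimum hitting sets are replaced by the result of a local search: starting with
all vertices, the part of the hitting set in a ball around `v` is replaced by a greedy hitting set
for the shortest paths near `v` as long as that makes the hitting set smaller. A greedy hitting
set for a family `F` has at most `1 + h * log |F|` vertices (`GreedyState`), so it has to be
avoided that the size of `F` depends on the number of vertices. To this end, the paths at scale
`r` are represented by pairs of vertices of the hitting set at scale `r / 16`
(`IsGeodesicMetric.exists_mem_localFamily`). That set is sparse, and a ball of radius `2 * R` is
covered by `h + 1` balls of radius `R` (`IsGeodesicMetric.exists_cover`), so there are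
polynomially many pairs in `h` near `v`. Hence the sparsity `64 * h * log₂ h` carries over from
scale to scale (`one_add_mul_log_le`). As shortest paths are unique, a path is determined by its
ends, and "`x` lies on the path from `a` to `b`" can be tested by comparing distances
(`Network.mem_support_iff_between`); all of this takes place in the finite metric space of the
network (`IsGeodesicMetric`).

The algorithm is a program of a small language (`RAM.Stm`) that only has loops with counters
bounded by two parameters, and whose stored values are cut off at a third one. Such programs run
in polynomial time by construction (`RAM.Stm.exec_compile`), so that it remains to compute the
parameters from the input (`RAM.exec_setup`) and to determine what the program computes
(`RAM.run_labeling`); distances are multiplied by a common denominator to make them integers.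
-/

noncomputable section

namespace Network

variable {V : Type*} {N : Network V}

/-! ### Shortest walks and the distance -/

@[simp] theorem length_nil (s : V) : N.length (SimpleGraph.Walk.nil : N.graph.Walk s s) = 0 := by
  simp [length]

@[simp] theorem length_cons {s t u : V} (h : N.graph.Adj s t) (p : N.graph.Walk t u) :
    N.length (SimpleGraph.Walk.cons h p) = N.len s(s, t) + N.length p := by
  simp [length]

@[simp] theorem length_append {s t u : V} (p : N.graph.Walk s t) (q : N.graph.Walk t u) :
    N.length (p.append q) = N.length p + N.length q := by
  simp [length]

@[simp] theorem length_reverse {s t : V} (p : N.graph.Walk s t) :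
    N.length p.reverse = N.length p := by
  simp [length]

/-- All edges have length at least one. -/
def LenGeOne (N : Network V) : Prop := ∀ e ∈ N.graph.edgeSet, 1 ≤ N.len e

theorem length_nonneg (hl : N.LenGeOne) {s t : V} (p : N.graph.Walk s t) : 0 ≤ N.length p := by
  apply List.sum_nonneg
  intro x hx
  obtain ⟨e, he, rfl⟩ := List.mem_map.1 hx
  linarith [hl e (p.edges_subset_edgeSet he)]

theorem one_le_length (hl : N.LenGeOne) {s t : V} (hst : s ≠ t) (p : N.graph.Walk s t) :
    1 ≤ N.length p := by
  cases p with
  | nil => exact absurd rfl hst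
  | cons h p =>
    rw [length_cons]
    linarith [hl _ ((SimpleGraph.mem_edgeSet _).2 h), length_nonneg hl p]

theorem bddBelow_length (hl : N.LenGeOne) (s t : V) :
    BddBelow (Set.range fun p : N.graph.Walk s t => N.length p) :=
  ⟨0, by rintro _ ⟨p, rfl⟩; exact length_nonneg hl p⟩

theorem dist_le_length (hl : N.LenGeOne) {s t : V} (p : N.graph.Walk s t) :
    N.dist s t ≤ N.length p :=
  ciInf_le (bddBelow_length hl s t) p

theorem exists_path_length_le (hl : N.LenGeOne) {s t : V} (p : N.graph.Walk s t) :
    ∃ q : N.graph.Walk s t, q.IsPath ∧ N.length q ≤ N.length p := by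
  classical
  refine ⟨p.bypass, p.bypass_isPath, ?_⟩
  have hs : (p.bypass.edges.map N.len).Sublist (p.edges.map N.len) :=
    (p.darts_bypass_sublist_darts.map _).map _
  apply hs.sum_le_sum
  intro x hx
  obtain ⟨e, he, rfl⟩ := List.mem_map.1 hx
  linarith [hl e (p.edges_subset_edgeSet he)]

theorem exists_isShortest [Finite V] (hc : N.graph.Connected) (hl : N.LenGeOne) (s t : V) :
    ∃ p : N.graph.Walk s t, N.IsShortest p := by
  classical
  obtain ⟨p₀⟩ := hc.preconnected s t
  have := Fintype.ofFinite V
  have hfin : {q : N.graph.Walk s t | q.IsPath}.Finite := by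
    apply Set.Finite.subset
      (Set.Finite.biUnion (Set.finite_lt_nat (Fintype.card V)) fun n _ =>
        (Set.toFinite {q : N.graph.Walk s t | q.length = n}))
    intro q hq
    simp only [Set.mem_iUnion]
    exact ⟨q.length, hq.length_lt, rfl⟩
  obtain ⟨q₀, hq₀, _⟩ := exists_path_length_le hl p₀
  obtain ⟨p, _, hp⟩ := Set.exists_min_image _ N.length hfin ⟨q₀, hq₀⟩
  refine ⟨p, fun q => ?_⟩
  obtain ⟨q', hq', hle⟩ := exists_path_length_le hl q
  exact (hp q' hq').trans hle

theorem IsShortest.length_eq (hl : N.LenGeOne) {s t : V} {p : N.graph.Walk s t}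
    (hp : N.IsShortest p) : N.length p = N.dist s t :=
  have : Nonempty (N.graph.Walk s t) := ⟨p⟩
  le_antisymm (le_ciInf hp) (dist_le_length hl p)

theorem isShortest_iff (hl : N.LenGeOne) {s t : V} {p : N.graph.Walk s t} :
    N.IsShortest p ↔ N.length p ≤ N.dist s t :=
  ⟨fun h => (h.length_eq hl).le, fun h q => h.trans (dist_le_length hl q)⟩

theorem isShortest_nil (hl : N.LenGeOne) (s : V) :
    N.IsShortest (SimpleGraph.Walk.nil : N.graph.Walk s s) := fun q => by
  simpa using length_nonneg hl q

theorem dist_self (hl : N.LenGeOne) (s : V) : N.dist s s = 0 := by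
  rw [← (isShortest_nil hl s).length_eq hl, length_nil]

theorem IsShortest.reverse {s t : V} {p : N.graph.Walk s t} (hp : N.IsShortest p) :
    N.IsShortest p.reverse := fun q => by
  simpa using hp q.reverse

theorem isShortest_append (hl : N.LenGeOne) {s x t : V} {p : N.graph.Walk s x}
    {q : N.graph.Walk x t} (hp : N.IsShortest p) (hq : N.IsShortest q)
    (h : N.dist s x + N.dist x t = N.dist s t) :
    N.IsShortest (p.append q) := by
  rw [isShortest_iff hl, length_append, hp.length_eq hl, hq.length_eq hl, h]

theorem dist_le_diameter [Finite V] (s t : V) : N.dist s t ≤ N.diameter :=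
  le_ciSup (f := fun x : V × V => N.dist x.1 x.2) (Set.finite_range _).bddAbove (s, t)

section Finite

variable [Finite V] (hc : N.graph.Connected) (hl : N.LenGeOne)
include hc hl

theorem dist_comm (s t : V) : N.dist s t = N.dist t s := by
  obtain ⟨p, hp⟩ := exists_isShortest hc hl s t
  rw [← hp.length_eq hl, ← hp.reverse.length_eq hl, length_reverse]

theorem dist_triangle (s t u : V) : N.dist s u ≤ N.dist s t + N.dist t u := by
  obtain ⟨p, hp⟩ := exists_isShortest hc hl s t
  obtain ⟨q, hq⟩ := exists_isShortest hc hl t u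
  rw [← hp.length_eq hl, ← hq.length_eq hl, ← length_append]
  exact dist_le_length hl _

theorem one_le_dist {s t : V} (hst : s ≠ t) : 1 ≤ N.dist s t := by
  obtain ⟨p, hp⟩ := exists_isShortest hc hl s t
  rw [← hp.length_eq hl]
  exact one_le_length hl hst p

theorem dist_nonneg (s t : V) : 0 ≤ N.dist s t := by
  obtain ⟨p, hp⟩ := exists_isShortest hc hl s t
  rw [← hp.length_eq hl]
  exact length_nonneg hl p

theorem IsShortest.of_append {s x t : V} {p : N.graph.Walk s x} {q : N.graph.Walk x t}
    (h : N.IsShortest (p.append q)) :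
    N.IsShortest p ∧ N.IsShortest q ∧ N.dist s x + N.dist x t = N.dist s t := by
  have h1 := h.length_eq hl
  rw [length_append] at h1
  have h2 := dist_le_length hl p
  have h3 := dist_le_length hl q
  have h4 := dist_triangle hc hl s x t
  exact ⟨(isShortest_iff hl).2 (by linarith), (isShortest_iff hl).2 (by linarith), by linarith⟩

theorem dist_add_dist_of_mem_support {s x t : V} {p : N.graph.Walk s t} (hp : N.IsShortest p)
    (hx : x ∈ p.support) : N.dist s x + N.dist x t = N.dist s t := by
  obtain ⟨q, r, rfl⟩ := (SimpleGraph.Walk.mem_support_iff_exists_append).1 hx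
  exact (hp.of_append hc hl).2.2

theorem one_le_diameter [Nontrivial V] : 1 ≤ N.diameter := by
  obtain ⟨s, t, hst⟩ := exists_pair_ne V
  exact (one_le_dist hc hl hst).trans (dist_le_diameter s t)

end Finite

/-! ### Hierarchical labelings from locally sparse hitting sets -/

/-- The label of `v` for an importance `key`: all vertices `u` such that on some shortest
`v`-`u` path no vertex is more important than `u`. -/
def canonicalLabel [Fintype V] (N : Network V) (key : V → ℕ) (v : V) : Finset V :=
  open Classical in
  Finset.univ.filter fun u =>
    ∃ p : N.graph.Walk v u, N.IsShortest p ∧ ∀ x ∈ p.support, key x ≤ key u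

theorem mem_canonicalLabel [Fintype V] {key : V → ℕ} {v u : V} :
    u ∈ N.canonicalLabel key v ↔
      ∃ p : N.graph.Walk v u, N.IsShortest p ∧ ∀ x ∈ p.support, key x ≤ key u := by
  simp [canonicalLabel]

/-- The most important vertex of a shortest path belongs to the labels of both ends. -/
theorem isHHL_canonicalLabel [Fintype V] (hc : N.graph.Connected) (hl : N.LenGeOne)
    {key : V → ℕ} (hkey : Function.Injective key) : N.IsHHL (N.canonicalLabel key) := by
  classical
  refine ⟨fun s t => ?_, ?_⟩
  · obtain ⟨p, hp⟩ := exists_isShortest hc hl s t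
    obtain ⟨x, hx, hmax⟩ := Finset.exists_max_image p.support.toFinset key
      ⟨s, by simp⟩
    simp only [List.mem_toFinset] at hx hmax
    refine ⟨p, hp, x, hx, ?_, ?_⟩ <;> rw [mem_canonicalLabel]
    · obtain ⟨q, r, rfl⟩ := (SimpleGraph.Walk.mem_support_iff_exists_append).1 hx
      refine ⟨q, (hp.of_append hc hl).1, fun y hy => hmax y ?_⟩
      simp [SimpleGraph.Walk.mem_support_append_iff, hy]
    · obtain ⟨q, r, rfl⟩ := (SimpleGraph.Walk.mem_support_iff_exists_append).1 hx
      refine ⟨r.reverse, (hp.of_append hc hl).2.1.reverse, fun y hy => hmax y ?_⟩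
      rw [SimpleGraph.Walk.support_reverse, List.mem_reverse] at hy
      simp [SimpleGraph.Walk.mem_support_append_iff, hy]
  · let f : V → ℕᵒᵈ := fun v => OrderDual.toDual (key v)
    have hf : Function.Injective f := fun a b h => hkey (OrderDual.toDual.injective h)
    let _ : LinearOrder V := LinearOrder.lift' f hf
    refine ⟨(Fintype.orderIsoFinOfCardEq V rfl).symm.toEquiv, fun u v huv => ?_⟩
    obtain ⟨p, _, hp⟩ := mem_canonicalLabel.1 huv
    have h1 : u ≤ v := (show f u ≤ f v from OrderDual.toDual_le_toDual.2 (hp v (by simp)))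
    exact (Fintype.orderIsoFinOfCardEq V rfl).symm.monotone h1

/-- If `C i` hits the shortest paths longer than `r i`, and `key` respects the last level of a
vertex, every hub `u ≠ v` of `v` lies in some `C j`
within distance `α * r j` of `v`: with `r i < dist v u ≤ r (i + 1)`, the shortest path meets
`C i`, and as `u` is the most important vertex on it, `u` lies in some `C j` with `j ≥ i`. -/
theorem card_canonicalLabel_le [Fintype V] (hc : N.graph.Connected) (hl : N.LenGeOne)
    {key : V → ℕ} {r : ℕ → ℝ} {C : ℕ → Finset V} {M M' : ℕ} {k α : ℝ} (hα : 0 ≤ α)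
    (hr0 : r 0 < 1) (hr : ∀ i, r (i + 1) ≤ α * r i) (hmono : Monotone r)
    (hM : N.diameter ≤ r M)
    (hit : ∀ i < M, ∀ s t (p : N.graph.Walk s t), N.IsShortest p → r i < N.length p →
      ∃ x ∈ p.support, x ∈ C i)
    (sparse : ∀ i v, (((C i).filter fun u => N.dist v u ≤ α * r i).card : ℝ) ≤ k)
    (empty : ∀ i, M' ≤ i → C i = ∅)
    (level : ∀ i x u, x ∈ C i → key x ≤ key u → ∃ j ≥ i, u ∈ C j) (v : V) :
    ((N.canonicalLabel key v).card : ℝ) ≤ 1 + M' * k := by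
  classical
  have hsub : N.canonicalLabel key v ⊆ insert v ((Finset.range M').biUnion fun j =>
      (C j).filter fun u => N.dist v u ≤ α * r j) := by
    intro u hu
    obtain ⟨p, hp, hmax⟩ := mem_canonicalLabel.1 hu
    rcases eq_or_ne u v with rfl | huv
    · simp
    have hd1 := one_le_dist hc hl huv.symm
    have hex : ∃ i, N.dist v u ≤ r i := ⟨M, (dist_le_diameter v u).trans hM⟩
    have hi := Nat.find_spec hex
    have hiM : Nat.find hex ≤ M := Nat.find_min' hex ((dist_le_diameter v u).trans hM)
    have hne : Nat.find hex ≠ 0 := by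
      intro h0
      rw [h0] at hi
      linarith
    obtain ⟨i, hi'⟩ := Nat.exists_eq_succ_of_ne_zero hne
    have hlow : r i < N.dist v u := not_le.1 (Nat.find_min hex (by omega))
    rw [hi'] at hi
    obtain ⟨x, hx, hxC⟩ := hit i (by omega) v u p hp (by rwa [hp.length_eq hl])
    obtain ⟨j, hj, hjC⟩ := level i x u hxC (hmax x hx)
    refine Finset.mem_insert_of_mem (Finset.mem_biUnion.2 ⟨j, ?_, ?_⟩)
    · by_contra hcon
      rw [Finset.mem_range, not_lt] at hcon
      rw [empty j hcon] at hjC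
      simp at hjC
    · refine Finset.mem_filter.2 ⟨hjC, hi.trans ((hr i).trans ?_)⟩
      exact mul_le_mul_of_nonneg_left (hmono hj) hα
  have h1 := (Finset.card_le_card hsub).trans (Finset.card_insert_le _ _)
  have h2 : ((((Finset.range M').biUnion fun j =>
      (C j).filter fun u => N.dist v u ≤ α * r j).card : ℕ) : ℝ) ≤ M' * k := by
    calc _ ≤ ((∑ j ∈ Finset.range M', ((C j).filter fun u => N.dist v u ≤ α * r j).card : ℕ) : ℝ) :=
          by exact_mod_cast Finset.card_biUnion_le
      _ ≤ ∑ j ∈ Finset.range M', k := by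
          rw [Nat.cast_sum]
          exact Finset.sum_le_sum fun j _ => sparse j v
      _ = _ := by simp
  have h3 : ((N.canonicalLabel key v).card : ℝ) ≤
      ((((Finset.range M').biUnion fun j =>
      (C j).filter fun u => N.dist v u ≤ α * r j).card : ℕ) : ℝ) + 1 := by exact_mod_cast h1
  linarith

/-! ### Highway dimension -/

theorem exists_hitsNeighborhood [Fintype V] (N : Network V) {r : ℝ} (hr : 0 < r) (v : V) :
    ∃ H : Finset V, H.card ≤ N.highwayDimension ∧ N.HitsNeighborhood H r v := by
  have hne : {h : ℕ | ∀ r : ℝ, 0 < r → ∀ v : V, ∃ H : Finset V,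
      H.card ≤ h ∧ N.HitsNeighborhood H r v}.Nonempty :=
    ⟨Fintype.card V, fun r _ v => ⟨Finset.univ, le_rfl, fun s t P _ => ⟨s, by simp, by simp⟩⟩⟩
  exact Nat.sInf_mem hne r hr v

/-- Both ends of an edge that is a shortest path form one-vertex paths of `S_r(v)` for small `r`. -/
theorem two_le_highwayDimension [Fintype V] [Nontrivial V] (hc : N.graph.Connected)
    (hl : N.LenGeOne) : 2 ≤ N.highwayDimension := by
  classical
  obtain ⟨s, t, hst⟩ := exists_pair_ne V
  obtain ⟨p, hp⟩ := exists_isShortest hc hl s t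
  cases p with
  | nil => exact absurd rfl hst
  | @cons _ u _ hadj q =>
    have hsu : N.IsShortest (SimpleGraph.Walk.cons hadj SimpleGraph.Walk.nil) := by
      have : SimpleGraph.Walk.cons hadj q =
        (SimpleGraph.Walk.cons hadj SimpleGraph.Walk.nil).append q := by simp
      rw [this] at hp
      exact (hp.of_append hc hl).1
    have hlen : (1 / 2 : ℝ) < N.length (SimpleGraph.Walk.cons hadj SimpleGraph.Walk.nil) := by
      linarith [one_le_length hl hadj.ne (SimpleGraph.Walk.cons hadj SimpleGraph.Walk.nil)]
    obtain ⟨H, hcard, hH⟩ := exists_hitsNeighborhood N (r := 1 / 2) (by norm_num) s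
    have hs : s ∈ H := by
      obtain ⟨x, hx, hxH⟩ := hH s s SimpleGraph.Walk.nil ⟨isShortest_nil hl s, s, u, _,
        ⟨hsu, hlen, Or.inr (Or.inr (Or.inl ⟨u, by simp⟩))⟩, s, by simp, by
          rw [dist_self hl]; norm_num⟩
      simp at hx
      rwa [hx] at hxH
    have hu : u ∈ H := by
      obtain ⟨x, hx, hxH⟩ := hH u u SimpleGraph.Walk.nil ⟨isShortest_nil hl u, s, u, _,
        ⟨hsu, hlen, Or.inr (Or.inl ⟨s, by simp⟩)⟩, s, by simp, by
          rw [dist_self hl]; norm_num⟩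
      simp at hx
      rwa [hx] at hxH
    have : ({s, u} : Finset V) ⊆ H := by
      intro x hx
      simp at hx
      rcases hx with rfl | rfl <;> assumption
    have h2 := Finset.card_le_card this
    rw [Finset.card_pair hadj.ne] at h2
    omega

/-- A minimum hitting set of the shortest paths longer than `r` is locally sparse: its part in a
ball of radius `2 * r` could be replaced by a hitting set of `S_r(v)`. -/
theorem exists_sparse_hitting_set [Fintype V] (N : Network V) {r : ℝ} (hr : 0 < r) :
    ∃ C : Finset V,
      (∀ s t (p : N.graph.Walk s t), N.IsShortest p → r < N.length p → ∃ x ∈ p.support, x ∈ C) ∧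
      (∀ v, (C.filter fun u => N.dist v u ≤ 2 * r).card ≤ N.highwayDimension) ∧
      ((∀ s t (p : N.graph.Walk s t), N.IsShortest p → N.length p ≤ r) → C = ∅) := by
  classical
  let hits : Finset V → Prop := fun C =>
    ∀ s t (p : N.graph.Walk s t), N.IsShortest p → r < N.length p → ∃ x ∈ p.support, x ∈ C
  obtain ⟨C, hC, hmin⟩ := Set.exists_min_image {C | hits C} Finset.card (Set.toFinite _)
    ⟨Finset.univ, fun s t p _ _ => ⟨s, by simp, by simp⟩⟩
  refine ⟨C, hC, fun v => ?_, fun h => ?_⟩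
  · obtain ⟨H, hcard, hH⟩ := exists_hitsNeighborhood N hr v
    have hnew : hits ((C.filter fun u => ¬ N.dist v u ≤ 2 * r) ∪ H) := by
      intro s t p hp hlen
      obtain ⟨x, hx, hxC⟩ := hC s t p hp hlen
      by_cases hd : N.dist v x ≤ 2 * r
      · obtain ⟨y, hy, hyH⟩ := hH s t p ⟨hp, s, t, p, ⟨hp, hlen, Or.inl rfl⟩, x, hx, hd⟩
        exact ⟨y, hy, Finset.mem_union_right _ hyH⟩
      · exact ⟨x, hx, Finset.mem_union_left _ (Finset.mem_filter.2 ⟨hxC, hd⟩)⟩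
    have h1 := (hmin _ hnew).trans (Finset.card_union_le _ _)
    have h2 := Finset.card_filter_add_card_filter_not (s := C) (fun u => N.dist v u ≤ 2 * r)
    omega
  · have h1 := hmin ∅ (fun s t p hp hlen => absurd (h s t p hp) (not_le.2 hlen))
    simpa using h1

/-- Minimum hitting sets at the scales `2 ^ (i - 1)` give small labels. -/
theorem exists_isHHL_card_le [Fintype V] [Nontrivial V] (hc : N.graph.Connected)
    (hl : N.LenGeOne) : ∃ L : V → Finset V, N.IsHHL L ∧ ∀ v : V,
      ((L v).card : ℝ) ≤ 4 * (N.highwayDimension * (1 + Real.logb 2 N.diameter)) := by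
  classical
  let r : ℕ → ℝ := fun i => 2 ^ i / 2
  have hrpos : ∀ i, 0 < r i := fun i => by positivity
  choose C hhit hsparse hempty using fun i => exists_sparse_hitting_set N (hrpos i)
  have hD := one_le_diameter hc hl
  have hlog : 0 ≤ Real.logb 2 N.diameter := Real.logb_nonneg (by norm_num) hD
  set M := ⌈Real.logb 2 N.diameter⌉₊ + 1 with hMdef
  have hM : N.diameter ≤ r M := by
    have h1 : N.diameter = (2 : ℝ) ^ (Real.logb 2 N.diameter) := by
      rw [Real.rpow_logb] <;> linarith
    have h2 : (2 : ℝ) ^ (Real.logb 2 N.diameter) ≤ (2 : ℝ) ^ ((M - 1 : ℕ) : ℝ) :=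
      Real.rpow_le_rpow_of_exponent_le (by norm_num) (by simpa [hMdef] using Nat.le_ceil _)
    have h3 : r M = (2 : ℝ) ^ ((M - 1 : ℕ) : ℝ) := by
      rw [Real.rpow_natCast]
      simp only [r, hMdef, pow_succ, Nat.add_sub_cancel]
      ring
    rw [h3]
    linarith
  have hmono : Monotone r := fun i j hij => by
    simp only [r]
    have := pow_le_pow_right₀ (by norm_num : (1 : ℝ) ≤ 2) hij
    linarith
  have hCempty : ∀ i, M ≤ i → C i = ∅ := fun i hi => hempty i fun s t p hp => by
    rw [hp.length_eq hl]
    exact ((dist_le_diameter s t).trans hM).trans (hmono hi)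
  -- The level of a vertex is one more than the last `i` with `u ∈ C i`; the key refines the level.
  let lev : V → ℕ := fun u => (Finset.range M).sup fun i => if u ∈ C i then i + 1 else 0
  let e := Fintype.equivFin V
  let key : V → ℕ := fun u => lev u * Fintype.card V + e u
  have hdiv : ∀ u, key u / Fintype.card V = lev u := fun u => by
    simp only [key]
    rw [mul_comm, Nat.mul_add_div Fintype.card_pos, Nat.div_eq_of_lt (e u).2, add_zero]
  have hmod : ∀ u, key u % Fintype.card V = e u := fun u => by
    simp only [key]
    rw [Nat.mul_add_mod', Nat.mod_eq_of_lt (e u).2]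
  have hkey : Function.Injective key := fun u w h => by
    apply e.injective
    apply Fin.ext
    rw [← hmod, ← hmod, h]
  have hlevel : ∀ i x u, x ∈ C i → key x ≤ key u → ∃ j ≥ i, u ∈ C j := by
    intro i x u hx hle
    have hiM : i < M := by
      by_contra hcon
      rw [hCempty i (not_lt.1 hcon)] at hx
      simp at hx
    have h1 : i + 1 ≤ lev x := by
      have := Finset.le_sup (f := fun i => if x ∈ C i then i + 1 else 0) (Finset.mem_range.2 hiM)
      simp only [if_pos hx] at this
      exact this
    have h2 : lev x ≤ lev u := by
      rw [← hdiv, ← hdiv]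
      exact Nat.div_le_div_right hle
    have h3 : i < lev u := by omega
    obtain ⟨j, _, hj⟩ := Finset.lt_sup_iff.1 h3
    by_cases hju : u ∈ C j
    · rw [if_pos hju] at hj
      exact ⟨j, by omega, hju⟩
    · rw [if_neg hju] at hj
      omega
  refine ⟨N.canonicalLabel key, isHHL_canonicalLabel hc hl hkey, fun v => ?_⟩
  have hbound := card_canonicalLabel_le hc hl (key := key) (r := r) (C := C) (M := M) (M' := M)
    (k := N.highwayDimension) (α := 2) (by norm_num) (by simp [r]; norm_num)
    (fun i => by simp only [r, pow_succ]; linarith) hmono hM (fun i _ => hhit i)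
    (fun i v => by exact_mod_cast hsparse i v) hCempty hlevel v
  have hh : (2 : ℝ) ≤ N.highwayDimension := by exact_mod_cast two_le_highwayDimension hc hl
  have hMle : (M : ℝ) ≤ Real.logb 2 N.diameter + 2 := by
    have := (Nat.ceil_lt_add_one hlog).le
    rw [hMdef]
    push_cast
    linarith
  nlinarith

end Network

/-! ### Geodesics in a finite metric -/

/-- The metric facts about shortest paths used below, for a distance `d` and the relation `T a b`
"`a = b`, or `ab` is an edge of length `d a b`". Vertices on geodesics are linearly ordered, which
expresses that shortest paths are unique. -/
structure IsGeodesicMetric {V : Type*} (d : V → V → ℝ) (T : V → V → Prop) : Prop where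
  self (a : V) : d a a = 0
  symm (a b : V) : d a b = d b a
  triangle (a b c : V) : d a c ≤ d a b + d b c
  pos {a b : V} : a ≠ b → 0 < d a b
  step_self (a : V) : T a a
  step_symm {a b : V} : T a b → T b a
  next {a b : V} : a ≠ b → ∃ a', a' ≠ a ∧ T a a' ∧ d a a' + d a' b = d a b
  linear {a b x y : V} : d a x + d x b = d a b → d a y + d y b = d a b → d a x ≤ d a y →
    d a x + d x y = d a y

/-- `x` lies on a geodesic from `a` to `b`. -/
def Between {V : Type*} (d : V → V → ℝ) (a x b : V) : Prop := d a x + d x b = d a b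

/-- The geodesic from `a` to `b` has an `r`-witness with ends `a'` and `b'`. -/
def Significant {V : Type*} (d : V → V → ℝ) (T : V → V → Prop) (r : ℝ) (a' a b b' : V) : Prop :=
  T a' a ∧ T b b' ∧ d a' b' = d a' a + d a b + d b b' ∧ r < d a' b'

/-- `C` meets every geodesic that has an `r`-witness. -/
def HitsSignificant {V : Type*} (d : V → V → ℝ) (T : V → V → Prop) (r : ℝ) (C : Finset V) : Prop :=
  ∀ a' a b b', Significant d T r a' a b b' → ∃ x ∈ C, Between d a x b

/-- The highway dimension is at most `h`, in terms of the metric. -/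
def LocallyHit {V : Type*} (d : V → V → ℝ) (T : V → V → Prop) (h : ℕ) : Prop :=
  ∀ ρ : ℝ, 0 < ρ → ∀ v : V, ∃ H : Finset V, H.card ≤ h ∧ ∀ a' a b b',
    Significant d T ρ a' a b b' → ∀ w, Between d a' w b' → d v w ≤ 2 * ρ →
      ∃ x ∈ H, Between d a x b

open Classical in
/-- The part of `C` in the closed ball of radius `ρ` around `v`. -/
def ballPart {V : Type*} (d : V → V → ℝ) (C : Finset V) (v : V) (ρ : ℝ) : Finset V :=
  C.filter fun u => d v u ≤ ρ

open Classical in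
/-- The geodesics near `v`, given by their ends, to be hit at scale `r` if the set `C` hits at scale
`r / 16`: those with both ends in `C` that have a `7 / 8 * r`-witness passing near `v`. Passing to
ends in `C` costs at most `r / 16` at each end of a witness, so `7 / 8 = 1 - 2 / 16` remains, and a
geodesic through a vertex within `3 / 2 * r` of `v` keeps a witness passing within
`7 / 4 * r = 2 * (7 / 8 * r)` of `v`, as needed for a hitting set of `h` vertices. -/
def localFamily {V : Type*} [Fintype V] (d : V → V → ℝ) (T : V → V → Prop) (r : ℝ)
    (C : Finset V) (v : V) : Finset (V × V) :=
  Finset.univ.filter fun p => p.1 ∈ C ∧ p.2 ∈ C ∧ d v p.1 ≤ 5 / 2 * r ∧ d v p.2 ≤ 5 / 2 * r ∧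
    ∃ a' b' w, Significant d T (7 / 8 * r) a' p.1 p.2 b' ∧ Between d a' w b' ∧ d v w ≤ 7 / 4 * r

namespace IsGeodesicMetric

variable {V : Type*} {d : V → V → ℝ} {T : V → V → Prop} (hg : IsGeodesicMetric d T)
include hg

theorem nonneg (a b : V) : 0 ≤ d a b := by
  by_cases hab : a = b
  · rw [hab, hg.self]
  · exact (hg.pos hab).le

/-- Distances along a geodesic are differences of distances from its start. -/
theorem dist_eq_abs {s t x y : V} (hx : Between d s x t) (hy : Between d s y t) :
    d x y = |d s x - d s y| := by
  rcases le_total (d s x) (d s y) with h | h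
  · have := hg.linear hx hy h
    rw [abs_of_nonpos (by linarith)]
    linarith
  · have := hg.linear hy hx h
    rw [abs_of_nonneg (by linarith), hg.symm]
    linarith

theorem between_symm {a x b : V} (h : Between d a x b) : Between d b x a := by
  unfold Between at *
  rw [hg.symm b x, hg.symm x a, hg.symm b a]
  linarith

theorem between_left (a b : V) : Between d a a b := by simp [Between, hg.self]

theorem between_right (a b : V) : Between d a b b := by simp [Between, hg.self]

theorem significant_symm {r : ℝ} {a' a b b' : V} (h : Significant d T r a' a b b') :
    Significant d T r b' b a a' := by
  obtain ⟨h1, h2, h3, h4⟩ := h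
  refine ⟨hg.step_symm h2, hg.step_symm h1, ?_, by rwa [hg.symm]⟩
  rw [hg.symm b' a', hg.symm b' b, hg.symm b a, hg.symm a a']
  linarith

/-- A part of a geodesic lies on every geodesic containing it. -/
theorem between_trans {p q a b x : V} (ha : Between d p a q) (hb : Between d p b q)
    (hab : d p a ≤ d p b) (hx : Between d a x b) : Between d p x q := by
  unfold Between at *
  have h1 := hg.linear ha hb hab
  have h2 := hg.triangle p a x
  have h3 := hg.triangle x b q
  have h4 := hg.triangle p x q
  linarith

/-- A ball of radius `2 * R` is covered by `h + 1` balls of radius `R`: following the geodesic from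
`u` to `v`, the longest start of length at most `R` has an `R`-witness. -/
theorem exists_cover [Finite V] {h : ℕ} (hd : LocallyHit d T h) {R : ℝ} (hR : 0 < R) (v : V) :
    ∃ S : Finset V, S.card ≤ h + 1 ∧ ∀ u, d v u ≤ 2 * R → ∃ x ∈ S, d x u ≤ R := by
  classical
  obtain ⟨H, hcard, hH⟩ := hd R hR v
  refine ⟨insert v H, (Finset.card_insert_le _ _).trans (by omega), fun u hu => ?_⟩
  by_cases hvu : d v u ≤ R
  · exact ⟨v, by simp, hvu⟩
  rw [not_le] at hvu
  obtain ⟨b, ⟨hb, hbR⟩, hmax⟩ := Set.exists_max_image {b | Between d u b v ∧ d u b ≤ R} (d u)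
    (Set.toFinite _) ⟨u, hg.between_left u v, by rw [hg.self]; exact hR.le⟩
  have hbv : b ≠ v := by
    rintro rfl
    rw [hg.symm] at hvu
    linarith
  obtain ⟨b', hne, hT, hb'⟩ := hg.next hbv
  have hpos := hg.pos hne.symm
  have h1 := hg.triangle u b b'
  have h2 := hg.triangle u b' v
  unfold Between at hb
  have hub' : d u b' = d u b + d b b' := by linarith
  have hgt : R < d u b' := by
    by_contra hcon
    have := hmax b' ⟨by unfold Between; linarith, not_lt.1 hcon⟩
    linarith
  obtain ⟨x, hx, hxb⟩ := hH u u b b' ⟨hg.step_self u, hT, by rw [hg.self]; linarith, hgt⟩ u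
    (hg.between_left _ _) hu
  refine ⟨x, Finset.mem_insert_of_mem hx, ?_⟩
  unfold Between at hxb
  have := hg.nonneg x b
  rw [hg.symm]
  linarith

theorem exists_cover_pow [Finite V] {h : ℕ} (hd : LocallyHit d T h) {R : ℝ} (hR : 0 < R) (v : V)
    (m : ℕ) : ∃ S : Finset V, S.card ≤ (h + 1) ^ m ∧
      ∀ u, d v u ≤ 2 ^ m * R → ∃ x ∈ S, d x u ≤ R := by
  classical
  induction m generalizing R with
  | zero => exact ⟨{v}, by simp, fun u hu => ⟨v, by simp, by simpa using hu⟩⟩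
  | succ m ih =>
    obtain ⟨S, hS, hcov⟩ := ih (R := 2 * R) (by linarith)
    choose f hf hfc using fun x => hg.exists_cover hd hR x
    refine ⟨S.biUnion f, ?_, fun u hu => ?_⟩
    · calc (S.biUnion f).card ≤ ∑ x ∈ S, (f x).card := Finset.card_biUnion_le
        _ ≤ ∑ x ∈ S, (h + 1) := Finset.sum_le_sum fun x _ => hf x
        _ = S.card * (h + 1) := by simp
        _ ≤ (h + 1) ^ (m + 1) := by rw [pow_succ]; exact Nat.mul_le_mul_right _ hS
    · obtain ⟨x, hx, hxu⟩ := hcov u (by rw [pow_succ] at hu; linarith)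
      obtain ⟨y, hy, hyu⟩ := hfc x u hxu
      exact ⟨y, Finset.mem_biUnion.2 ⟨x, hx, hy⟩, hyu⟩

/-- Large balls contain few vertices of a locally sparse set. -/
theorem card_ballPart_le [Finite V] {h : ℕ} (hd : LocallyHit d T h) {R k : ℝ} (hR : 0 < R)
    {C : Finset V} (hC : ∀ v, ((ballPart d C v R).card : ℝ) ≤ k) (v : V) (m : ℕ) :
    ((ballPart d C v (2 ^ m * R)).card : ℝ) ≤ (h + 1) ^ m * k := by
  classical
  have hk : 0 ≤ k := (Nat.cast_nonneg _).trans (hC v)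
  obtain ⟨S, hS, hcov⟩ := hg.exists_cover_pow hd hR v m
  have hsub : ballPart d C v (2 ^ m * R) ⊆ S.biUnion fun x => ballPart d C x R := by
    intro u hu
    simp only [ballPart, Finset.mem_filter] at hu
    obtain ⟨x, hx, hxu⟩ := hcov u hu.2
    simp only [ballPart, Finset.mem_biUnion, Finset.mem_filter]
    exact ⟨x, hx, hu.1, hxu⟩
  calc ((ballPart d C v (2 ^ m * R)).card : ℝ)
      ≤ ((∑ x ∈ S, (ballPart d C x R).card : ℕ) : ℝ) := by
        exact_mod_cast (Finset.card_le_card hsub).trans Finset.card_biUnion_le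
    _ ≤ ∑ x ∈ S, k := by
        rw [Nat.cast_sum]
        exact Finset.sum_le_sum fun x _ => hC x
    _ = S.card * k := by simp
    _ ≤ (h + 1) ^ m * k := mul_le_mul_of_nonneg_right (by exact_mod_cast hS) hk

/-- The local family has size polynomial in the highway dimension and the sparsity. -/
theorem card_localFamily_le [Fintype V] {h : ℕ} (hd : LocallyHit d T h) {r k : ℝ} (hr : 0 < r)
    {C : Finset V} (hC : ∀ v, ((ballPart d C v (3 / 2 * (r / 16))).card : ℝ) ≤ k) (v : V) :
    ((localFamily d T r C v).card : ℝ) ≤ ((h + 1) ^ 5 * k) ^ 2 := by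
  classical
  have h1 := hg.card_ballPart_le hd (by positivity) hC v 5
  set B := ballPart d C v (2 ^ 5 * (3 / 2 * (r / 16))) with hB
  have hsub : localFamily d T r C v ⊆ B ×ˢ B := by
    intro p hp
    simp only [localFamily, Finset.mem_filter] at hp
    obtain ⟨-, h1, h2, h3, h4, -⟩ := hp
    simp only [hB, ballPart, Finset.mem_product, Finset.mem_filter]
    exact ⟨⟨h1, by linarith⟩, h2, by linarith⟩
  calc ((localFamily d T r C v).card : ℝ) ≤ (B.card * B.card : ℕ) := by
        exact_mod_cast (Finset.card_le_card hsub).trans (Finset.card_product _ _).le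
    _ = (B.card : ℝ) ^ 2 := by push_cast; ring
    _ ≤ _ := pow_le_pow_left₀ (Nat.cast_nonneg _) h1 2

/-- If `C` hits at scale `ρ`, the predecessor `a'` of the first vertex `a` of `C` on a significant
geodesic is at most `ρ` away from the end `p'` of the witness, as the part from `p'` to `a'`
witnesses a geodesic that avoids `C`. -/
theorem exists_first [Finite V] {ρ : ℝ} (hρ : 0 ≤ ρ) {C : Finset V} (hC : HitsSignificant d T ρ C)
    {p' p q q' : V} (hs : Significant d T ρ p' p q q') :
    ∃ a ∈ C, Between d p a q ∧ (∀ x ∈ C, Between d p x q → d p a ≤ d p x) ∧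
      ∃ a', T a' a ∧ d p' a' + d a' a = d p' p + d p a ∧ d p' a' ≤ ρ := by
  obtain ⟨a, ⟨ha, hpa⟩, hmin⟩ := Set.exists_min_image {a | a ∈ C ∧ Between d p a q} (d p)
    (Set.toFinite _) (by obtain ⟨x, hx, hb⟩ := hC _ _ _ _ hs; exact ⟨x, hx, hb⟩)
  refine ⟨a, ha, hpa, fun x hx hb => hmin x ⟨hx, hb⟩, ?_⟩
  obtain ⟨hT1, hT2, hlen, hlong⟩ := hs
  by_cases hap : a = p
  · subst hap
    refine ⟨p', hT1, by rw [hg.self, hg.self]; ring, ?_⟩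
    rwa [hg.self]
  · obtain ⟨a', hne, hT, hb⟩ := hg.next hap
    have hpos := hg.pos hne
    have h1 := hg.triangle p' p a'
    have h2 := hg.triangle p' a' q'
    have h3 := hg.triangle a' a q'
    have h4 := hg.triangle a q q'
    unfold Between at hpa
    rw [hg.symm a a', hg.symm a' p, hg.symm a p] at hb
    refine ⟨a', hg.step_symm hT, by linarith, ?_⟩
    by_contra hcon
    rw [not_le] at hcon
    obtain ⟨x, hx, hxb⟩ := hC p' p a' a' ⟨hT1, hg.step_self _, by rw [hg.self]; linarith, hcon⟩
    have h5 := hg.triangle a' a q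
    have h6 := hg.triangle p a' q
    have h7 : Between d p x q := hg.between_trans (hg.between_left p q)
      (show Between d p a' q by unfold Between; linarith) (by rw [hg.self]; exact hg.nonneg _ _) hxb
    have h8 := hmin x ⟨hx, h7⟩
    unfold Between at hxb
    have h9 := hg.nonneg x a'
    linarith

/-- Every `r`-significant geodesic through a vertex `w` near `v` contains a member of the local
family of `v`: a minimal significant part of it containing `w` has both ends within `r` of `w`, and
cutting it to the stretch between its first and last vertices of `C` shortens the witness by at most
`r / 16` at each end. -/
theorem exists_mem_localFamily [Fintype V] {r : ℝ} (hr : 0 < r) {C : Finset V}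
    (hC : HitsSignificant d T (r / 16) C) {v w p' p q q' : V} (hs : Significant d T r p' p q q')
    (hw : Between d p w q) (hvw : d v w ≤ 3 / 2 * r) :
    ∃ c ∈ localFamily d T r C v, ∀ x, Between d c.1 x c.2 → Between d p x q := by
  classical
  -- The minimal significant part; its measure counts both the witness and the geodesic.
  obtain ⟨⟨y', y, z, z'⟩, ⟨hs1, hw1, hsub⟩, hmin⟩ := Set.exists_min_image
    {c : V × V × V × V | Significant d T r c.1 c.2.1 c.2.2.1 c.2.2.2 ∧
      Between d c.2.1 w c.2.2.1 ∧ ∀ x, Between d c.2.1 x c.2.2.1 → Between d p x q}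
    (fun c => d c.1 c.2.2.2 + d c.2.1 c.2.2.1) (Set.toFinite _)
    ⟨(p', p, q, q'), hs, hw, fun x hx => hx⟩
  simp only at hs1 hw1 hsub
  -- Otherwise the part without its first vertex would be smaller and still significant.
  have left : d y w ≤ r := by
    by_contra hcon
    rw [not_le] at hcon
    have hyw : y ≠ w := by
      rintro rfl
      rw [hg.self] at hcon
      linarith
    obtain ⟨y₁, hne, hT, hb⟩ := hg.next hyw
    have hpos := hg.pos hne
    rw [hg.symm] at hpos
    obtain ⟨hT1, hT2, hlen, hlong⟩ := hs1
    unfold Between at hw1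
    have h1 := hg.triangle y y₁ z
    have h2 := hg.triangle y₁ w z
    have h3 := hg.triangle y' y z'
    have h4 := hg.triangle y z z'
    have h5 := hg.triangle y₁ z z'
    have h6 := hg.triangle y y₁ z'
    have h7 := hg.nonneg w z
    have h8 := hg.nonneg z z'
    have h9 := hg.nonneg y' y
    have := hmin (y, y₁, z, z') ⟨⟨hT, hT2, by simp only; linarith, by simp only; linarith⟩,
      by simp only; unfold Between; linarith, fun x hx => hsub x (by
        simp only at hx
        unfold Between at hx ⊢
        have h10 := hg.triangle y y₁ x
        have h11 := hg.triangle y x z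
        linarith)⟩
    simp only at this
    linarith
  have right : d w z ≤ r := by
    by_contra hcon
    rw [not_le] at hcon
    have hyw : z ≠ w := by
      rintro rfl
      rw [hg.self] at hcon
      linarith
    obtain ⟨z₁, hne, hT, hb⟩ := hg.next hyw
    have hpos := hg.pos hne
    obtain ⟨hT1, hT2, hlen, hlong⟩ := hs1
    unfold Between at hw1
    rw [hg.symm z z₁, hg.symm z₁ w, hg.symm z w] at hb
    have h1 := hg.triangle y z₁ z
    have h2 := hg.triangle y w z₁
    have h3 := hg.triangle y' z z'
    have h4 := hg.triangle y' y z
    have h5 := hg.triangle y' y z₁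
    have h6 := hg.triangle y' z₁ z
    have h7 := hg.nonneg y w
    have h8 := hg.nonneg z z'
    have h9 := hg.nonneg y' y
    have := hmin (y', y, z₁, z) ⟨⟨hT1, hg.step_symm hT, by simp only; linarith,
      by simp only; linarith⟩,
      by simp only; unfold Between; linarith, fun x hx => hsub x (by
        simp only at hx
        unfold Between at hx ⊢
        have h10 := hg.triangle x z₁ z
        have h11 := hg.triangle y x z
        linarith)⟩
    simp only at this
    linarith
  have hs2 : Significant d T (r / 16) y' y z z' := ⟨hs1.1, hs1.2.1, hs1.2.2.1, by
    linarith [hs1.2.2.2]⟩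
  obtain ⟨a, ha, hya, hamin, a', hTa, haa, hale⟩ := hg.exists_first (by positivity) hC hs2
  obtain ⟨b, hb, hyb, hbmin, b', hTb, hbb, hble⟩ :=
    hg.exists_first (by positivity) hC (hg.significant_symm hs2)
  have hyb := hg.between_symm hyb
  have hbmin := hbmin a ha (hg.between_symm hya)
  rw [hg.symm z b, hg.symm z a] at hbmin
  rw [hg.symm z' b', hg.symm b' b, hg.symm z' z, hg.symm z b] at hbb
  rw [hg.symm z' b'] at hble
  have hab := hamin b hb hyb
  have hlinab := hg.linear hya hyb hab
  obtain ⟨hT1, hT2, hlen, hlong⟩ := hs1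
  have hya' := hya
  have hyb' := hyb
  have hw' := hw1
  unfold Between at hya' hyb' hw'
  have hlen' : d a' b' = d a' a + d a b + d b b' := by
    have h1 := hg.triangle y' a' z'
    have h2 := hg.triangle a' b' z'
    have h3 := hg.triangle a' a b'
    have h4 := hg.triangle a b b'
    linarith
  have htot : d y' a' + d a' b' + d b' z' = d y' z' := by linarith
  have hdist : ∀ c, Between d y c z → d v c ≤ 5 / 2 * r := by
    intro c hc
    have h1 := hg.dist_eq_abs hc hw1
    have h2 := hg.triangle v w c
    unfold Between at hc
    rw [hg.symm c w] at h1
    have h3 : |d y c - d y w| ≤ r := by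
      rw [abs_le]
      have := hg.nonneg y c
      have := hg.nonneg c z
      constructor <;> linarith
    linarith
  -- The nearest vertex to `w` on the shortened witness is at most `r / 16` away from `w`.
  have hclose : ∃ u, Between d a' u b' ∧ d v u ≤ 7 / 4 * r := by
    have t1 := hg.triangle y' a' z'
    have t2 := hg.triangle a' b' z'
    have t3 := hg.triangle y' b' z'
    have t4 := hg.triangle y' a' b'
    have hYa : Between d y' a' z' := by unfold Between; linarith
    have hYb : Between d y' b' z' := by unfold Between; linarith
    have hYw : Between d y' w z' := by
      have h1 := hg.triangle y' w z'
      have h2 := hg.triangle y' y w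
      have h3 := hg.triangle w z z'
      unfold Between
      linarith
    have hYb' := hYb
    have hYw' := hYw
    have hYa' := hYa
    unfold Between at hYb' hYw' hYa'
    have n1 := hg.nonneg y' w
    have n2 := hg.nonneg w z'
    rcases le_total (d y' w) (d y' a') with h | h
    · refine ⟨a', hg.between_left _ _, ?_⟩
      have h1 := hg.linear hYw hYa h
      have h2 := hg.triangle v w a'
      linarith
    rcases le_total (d y' b') (d y' w) with h' | h'
    · refine ⟨b', hg.between_right _ _, ?_⟩
      have h1 := hg.linear hYb hYw h'
      have h2 := hg.triangle v w b'
      have h3 := hg.symm b' w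
      linarith
    · refine ⟨w, ?_, by linarith⟩
      have h1 := hg.linear hYa hYw h
      have h2 := hg.linear hYw hYb h'
      unfold Between
      linarith
  obtain ⟨u, hu, hvu⟩ := hclose
  refine ⟨(a, b), ?_, fun x hx => hsub x (hg.between_trans hya hyb hab hx)⟩
  simp only [localFamily, Finset.mem_filter, Finset.mem_univ, true_and]
  exact ⟨ha, hb, hdist a hya, hdist b hyb, a', b', u,
    ⟨hTa, hg.step_symm hTb, hlen', by linarith⟩, hu, hvu⟩

/-- Replacing the part of a hitting set in a ball by a hitting set of the local family. -/
theorem hitsSignificant_replace [Fintype V] [DecidableEq V] {r : ℝ} (hr : 0 < r)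
    {C₀ C C₁ H : Finset V} (hC₀ : HitsSignificant d T (r / 16) C₀) (hC : HitsSignificant d T r C)
    {v : V} (hH : ∀ c ∈ localFamily d T r C₀ v, ∃ x ∈ H, Between d c.1 x c.2)
    (hH₁ : H ⊆ C₁) (hC₁ : ∀ x ∈ C, ¬ d v x ≤ 3 / 2 * r → x ∈ C₁) :
    HitsSignificant d T r C₁ := by
  intro a' a b b' hs
  obtain ⟨w, hw, hwb⟩ := hC a' a b b' hs
  by_cases hvw : d v w ≤ 3 / 2 * r
  · obtain ⟨c, hc, hcsub⟩ := hg.exists_mem_localFamily hr hC₀ hs hwb hvw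
    obtain ⟨x, hx, hxb⟩ := hH c hc
    exact ⟨x, hH₁ hx, hcsub x hxb⟩
  · exact ⟨w, hC₁ w hw hvw, hwb⟩

theorem hitsSignificant_univ [Fintype V] (r : ℝ) : HitsSignificant d T r Finset.univ :=
  fun _ a b _ _ => ⟨a, Finset.mem_univ a, hg.between_left a b⟩

omit hg in
/-- The local family can be hit by `h` vertices. -/
theorem exists_hits_localFamily [Fintype V] {h : ℕ} (hd : LocallyHit d T h) {r : ℝ} (hr : 0 < r)
    (C : Finset V) (v : V) :
    ∃ H : Finset V, H.card ≤ h ∧ ∀ c ∈ localFamily d T r C v, ∃ x ∈ H, Between d c.1 x c.2 := by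
  obtain ⟨H, hcard, hH⟩ := hd (7 / 8 * r) (by positivity) v
  refine ⟨H, hcard, fun c hc => ?_⟩
  simp only [localFamily, Finset.mem_filter] at hc
  obtain ⟨-, -, -, -, -, a', b', w, hs, hw, hvw⟩ := hc
  exact hH a' c.1 c.2 b' hs w hw (by linarith)

omit hg in
/-- At scales beyond the diameter there is nothing to hit. -/
theorem localFamily_eq_empty [Fintype V] {r D : ℝ} (hD : ∀ a b, d a b ≤ D) (hr : D ≤ 7 / 8 * r)
    (C : Finset V) (v : V) : localFamily d T r C v = ∅ := by
  refine Finset.eq_empty_of_forall_notMem fun c hc => ?_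
  simp only [localFamily, Finset.mem_filter] at hc
  obtain ⟨-, -, -, -, -, a', b', w, hs, -⟩ := hc
  linarith [hD a' b', hs.2.2.2]

end IsGeodesicMetric

/-! ### Greedy hitting sets -/

/-- The state of the greedy algorithm for hitting the members of `F`, where `on x p` means that `x`
hits `p`: `alive` are the members not yet hit, `H` the vertices chosen so far, and `t` bounds the
number of choices; each choice hits at least the fraction `1 / h` of `alive`. The bound
`card_le_log` for the greedy hitting set is part of the state, since it holds at every time. -/
structure GreedyState {V P : Type*} (on : V → P → Prop) (h : ℕ) (F alive : Finset P)
    (H : Finset V) (t : ℕ) : Prop where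
  subset : alive ⊆ F
  hit : ∀ p ∈ F, p ∉ alive → ∃ x ∈ H, on x p
  card_le : H.card ≤ t
  alive_le : (alive.card : ℝ) ≤ (1 - 1 / h) ^ t * F.card
  card_le_log : (H.card : ℝ) ≤ 1 + h * Real.log F.card
  eq_empty : F = ∅ → H = ∅

namespace GreedyState

variable {V P : Type*} {on : V → P → Prop} {h : ℕ} {F alive : Finset P} {H : Finset V} {t : ℕ}

theorem init (on : V → P → Prop) (h : ℕ) (F : Finset P) : GreedyState on h F F ∅ 0 where
  subset := subset_rfl
  hit p hp hp' := absurd hp hp'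
  card_le := by simp
  alive_le := by simp
  card_le_log := by
    have : 0 ≤ Real.log (F.card : ℝ) := Real.log_natCast_nonneg _
    simp only [Finset.card_empty, Nat.cast_zero]
    positivity
  eq_empty _ := rfl

open Classical in
/-- Choosing a vertex `x` that hits the most members. -/
theorem step (hs : GreedyState on h F alive H t) (hne : alive.Nonempty)
    (hopt : ∃ O : Finset V, O.card ≤ h ∧ ∀ p ∈ F, ∃ x ∈ O, on x p) {x : V}
    (hx : ∀ y, (alive.filter (on y)).card ≤ (alive.filter (on x)).card) :
    GreedyState on h F (alive.filter fun p => ¬ on x p) (insert x H) (t + 1) := by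
  obtain ⟨O, hO, hhit⟩ := hopt
  have hsum : alive.card ≤ h * (alive.filter (on x)).card := by
    have hsub : alive ⊆ O.biUnion fun y => alive.filter (on y) := by
      intro p hp
      obtain ⟨y, hy, hyp⟩ := hhit p (hs.subset hp)
      exact Finset.mem_biUnion.2 ⟨y, hy, Finset.mem_filter.2 ⟨hp, hyp⟩⟩
    calc alive.card ≤ ∑ y ∈ O, (alive.filter (on y)).card :=
          (Finset.card_le_card hsub).trans Finset.card_biUnion_le
      _ ≤ ∑ y ∈ O, (alive.filter (on x)).card := Finset.sum_le_sum fun y _ => hx y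
      _ = O.card * (alive.filter (on x)).card := by simp
      _ ≤ _ := Nat.mul_le_mul_right _ hO
  have hpos : 0 < alive.card := hne.card_pos
  have hh : 0 < h := by
    rcases Nat.eq_zero_or_pos h with rfl | h0
    · omega
    · exact h0
  have hh' : (1 : ℝ) ≤ h := by exact_mod_cast hh
  have hfrac : 0 ≤ 1 - 1 / (h : ℝ) := by
    rw [sub_nonneg, div_le_one (by linarith)]
    exact hh'
  have hFpos : (0 : ℝ) < F.card := by
    exact_mod_cast hpos.trans_le (Finset.card_le_card hs.subset)
  have hone : (1 : ℝ) ≤ alive.card := by exact_mod_cast hpos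
  -- `t` choices leave a member only if `t ≤ h * log |F|`, since `1 - 1 / h ≤ exp (-1 / h)`.
  have ht : (t : ℝ) ≤ h * Real.log F.card := by
    have h1 : (1 - 1 / (h : ℝ)) ^ t ≤ Real.exp (-(t / h)) := by
      calc (1 - 1 / (h : ℝ)) ^ t ≤ (Real.exp (-(1 / h))) ^ t :=
            pow_le_pow_left₀ hfrac (by linarith [Real.add_one_le_exp (-(1 / (h : ℝ)))]) t
        _ = Real.exp (-(t / h)) := by
            rw [← Real.exp_nat_mul]
            congr 1
            ring
    have h2 : (1 : ℝ) ≤ Real.exp (-(t / h)) * F.card :=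
      hone.trans (hs.alive_le.trans (mul_le_mul_of_nonneg_right h1 hFpos.le))
    have h3 := Real.log_le_log one_pos h2
    rw [Real.log_one, Real.log_mul (Real.exp_pos _).ne' hFpos.ne', Real.log_exp] at h3
    have h4 : (t : ℝ) / h ≤ Real.log F.card := by linarith
    rw [div_le_iff₀ (by linarith)] at h4
    linarith
  refine ⟨(Finset.filter_subset _ _).trans hs.subset, fun p hp hp' => ?_, ?_, ?_, ?_, ?_⟩
  · by_cases hpa : p ∈ alive
    · exact ⟨x, Finset.mem_insert_self _ _, by
        by_contra hcon
        exact hp' (Finset.mem_filter.2 ⟨hpa, hcon⟩)⟩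
    · obtain ⟨y, hy, hyp⟩ := hs.hit p hp hpa
      exact ⟨y, Finset.mem_insert_of_mem hy, hyp⟩
  · exact (Finset.card_insert_le _ _).trans (Nat.succ_le_succ hs.card_le)
  · have h1 := Finset.card_filter_add_card_filter_not (s := alive) (on x)
    have h2 : ((alive.filter (on x)).card : ℝ) + (alive.filter fun p => ¬ on x p).card =
      alive.card := by exact_mod_cast h1
    have h3 : (alive.card : ℝ) ≤ h * (alive.filter (on x)).card := by exact_mod_cast hsum
    have h4 : (alive.card : ℝ) / h ≤ (alive.filter (on x)).card := by
      rw [div_le_iff₀ (by linarith)]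
      linarith
    calc ((alive.filter fun p => ¬ on x p).card : ℝ) ≤ (1 - 1 / h) * alive.card := by
          rw [sub_mul, one_mul, one_div, inv_mul_eq_div]
          linarith
      _ ≤ (1 - 1 / h) * ((1 - 1 / h) ^ t * F.card) :=
          mul_le_mul_of_nonneg_left hs.alive_le hfrac
      _ = _ := by ring
  · have h1 : ((insert x H).card : ℝ) ≤ H.card + 1 := by exact_mod_cast Finset.card_insert_le _ _
    have h2 : (H.card : ℝ) ≤ t := by exact_mod_cast hs.card_le
    linarith
  · rintro rfl
    simp at hFpos

end GreedyState

/-- The sparsity `64 * h * log₂ h` reproduces itself from one scale to the next: the local family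
has size polynomial in `h`, so its logarithm is `O(log h)`, with a constant below `64`. -/
theorem one_add_mul_log_le {h : ℕ} (hh : 2 ≤ h) {F : ℕ}
    (hF : (F : ℝ) ≤ ((h + 1) ^ 5 * (64 * (h * Real.logb 2 h))) ^ 2) :
    1 + h * Real.log F ≤ 64 * (h * Real.logb 2 h) := by
  have hh' : (2 : ℝ) ≤ h := by exact_mod_cast hh
  set l := Real.logb 2 h with hl
  have hl1 : 1 ≤ l := by
    rw [hl, Real.le_logb_iff_rpow_le (by norm_num) (by linarith)]
    simpa using hh'
  have hlog2 : 0 < Real.log 2 := Real.log_pos (by norm_num)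
  have hlog2' : Real.log 2 ≤ 1 := by
    have := Real.log_le_sub_one_of_pos (show (0 : ℝ) < 2 by norm_num)
    linarith
  have hlogh : Real.log h = l * Real.log 2 := by
    rw [hl, Real.logb, div_mul_cancel₀ _ hlog2.ne']
  have hlogh' : Real.log h ≤ l := by
    rw [hlogh]
    nlinarith
  have hlogh1 : Real.log (h + 1) ≤ 2 * l := by
    have h1 : (h : ℝ) + 1 ≤ h ^ 2 := by nlinarith
    have h2 := Real.log_le_log (by linarith) h1
    rw [Real.log_pow] at h2
    push_cast at h2
    linarith
  have hlogl : Real.log l ≤ l := by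
    have := Real.log_le_sub_one_of_pos (show 0 < l by linarith)
    linarith
  have hlog64 : Real.log 64 ≤ 6 * l := by
    have h1 : Real.log 64 = 6 * Real.log 2 := by
      rw [show (64 : ℝ) = 2 ^ 6 by norm_num, Real.log_pow]
      norm_num
    nlinarith
  have hmain : Real.log F ≤ 36 * l := by
    rcases Nat.eq_zero_or_pos F with rfl | hF0
    · simp
      linarith
    have h1 := Real.log_le_log (by exact_mod_cast hF0) hF
    rw [Real.log_pow, Real.log_mul (by positivity) (by positivity), Real.log_pow,
      Real.log_mul (by norm_num) (by positivity),
      Real.log_mul (by positivity) (by positivity)] at h1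
    push_cast at h1
    linarith
  nlinarith

/-- Each replacement in the local search shrinks the hitting set. -/
theorem card_replace_lt {V : Type*} [DecidableEq V] {C B H : Finset V} (hB : B ⊆ C)
    (hlt : H.card < B.card) : ((C \ B) ∪ H).card < C.card := by
  have h1 := Finset.card_union_le (C \ B) H
  have h2 := Finset.card_sdiff_of_subset hB
  have h3 := Finset.card_le_card hB
  omega

/-! ### Networks with unique shortest paths -/

namespace Network

variable {V : Type*} {N : Network V}

/-- `a = b`, or `ab` is an edge that is a shortest path. -/
def Tight (N : Network V) (a b : V) : Prop :=
  a = b ∨ (N.graph.Adj a b ∧ N.len s(a, b) = N.dist a b)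

theorem exists_cons_isShortest (hl : N.LenGeOne) {a' a b : V} {p : N.graph.Walk a b}
    (hp : N.IsShortest p) (hT : N.Tight a' a) (h : N.dist a' b = N.dist a' a + N.dist a b) :
    ∃ q : N.graph.Walk a' b, N.IsShortest q ∧
      (q.support = p.support ∨ q.support = a' :: p.support) := by
  rcases hT with rfl | ⟨hadj, hlen⟩
  · exact ⟨p, hp, Or.inl rfl⟩
  · refine ⟨SimpleGraph.Walk.cons hadj p, ?_, Or.inr (by simp)⟩
    rw [isShortest_iff hl, length_cons, hp.length_eq hl, hlen, h]

section

variable [Finite V] (hc : N.graph.Connected) (hl : N.LenGeOne) (hu : N.UniqueShortestPaths)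
include hc hl

theorem exists_mem_support_of_between {a x b : V} (h : Between N.dist a x b) :
    ∃ p : N.graph.Walk a b, N.IsShortest p ∧ x ∈ p.support := by
  obtain ⟨p, hp⟩ := exists_isShortest hc hl a x
  obtain ⟨q, hq⟩ := exists_isShortest hc hl x b
  exact ⟨p.append q, isShortest_append hl hp hq h, by
    simp [SimpleGraph.Walk.mem_support_append_iff]⟩

include hu

theorem mem_support_iff_between {a x b : V} {p : N.graph.Walk a b} (hp : N.IsShortest p) :
    x ∈ p.support ↔ Between N.dist a x b := by
  refine ⟨dist_add_dist_of_mem_support hc hl hp, fun h => ?_⟩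
  obtain ⟨q, hq, hx⟩ := exists_mem_support_of_between hc hl h
  rwa [hu a b p q hp hq]

theorem isGeodesicMetric : IsGeodesicMetric N.dist N.Tight where
  self := dist_self hl
  symm := dist_comm hc hl
  triangle := dist_triangle hc hl
  pos h := one_pos.trans_le (one_le_dist hc hl h)
  step_self a := Or.inl rfl
  step_symm {a b} h := by
    rcases h with rfl | ⟨h, h'⟩
    · exact Or.inl rfl
    · exact Or.inr ⟨h.symm, by rw [Sym2.eq_swap, h', dist_comm hc hl]⟩
  next {a b} hab := by
    obtain ⟨p, hp⟩ := exists_isShortest hc hl a b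
    cases p with
    | nil => exact absurd rfl hab
    | @cons _ a' _ h q =>
      have h1 : SimpleGraph.Walk.cons h q =
        (SimpleGraph.Walk.cons h SimpleGraph.Walk.nil).append q := by simp
      rw [h1] at hp
      obtain ⟨h2, h3, h4⟩ := hp.of_append hc hl
      refine ⟨a', h.ne', Or.inr ⟨h, ?_⟩, h4⟩
      rw [← h2.length_eq hl]
      simp
  linear {a b x y} hx hy hxy := by
    obtain ⟨p, hp⟩ := exists_isShortest hc hl a b
    have hxp := (mem_support_iff_between hc hl hu hp).2 hx
    have hyp := (mem_support_iff_between hc hl hu hp).2 hy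
    obtain ⟨q, r, rfl⟩ := (SimpleGraph.Walk.mem_support_iff_exists_append).1 hxp
    obtain ⟨h1, h2, h3⟩ := hp.of_append hc hl
    rcases (SimpleGraph.Walk.mem_support_append_iff q r).1 hyp with h | h
    · have h4 := dist_add_dist_of_mem_support hc hl h1 h
      have h5 := dist_nonneg hc hl x y
      rw [dist_comm hc hl y x] at h4
      linarith
    · have h4 := dist_add_dist_of_mem_support hc hl h2 h
      linarith

omit hu in
/-- The end points and lengths recorded in `Significant` determine an `r`-witness. -/
theorem exists_isWitness {r : ℝ} {a' a b b' : V} {p : N.graph.Walk a b} (hp : N.IsShortest p)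
    (hs : Significant N.dist N.Tight r a' a b b') :
    ∃ q : N.graph.Walk a' b', N.IsWitness r q p := by
  obtain ⟨hTa, hTb, hlen, hlong⟩ := hs
  have h1 := dist_triangle hc hl a' a b'
  have h2 := dist_triangle hc hl a b b'
  have h3 := dist_triangle hc hl a' b b'
  have h4 := dist_triangle hc hl a' a b
  have hTb' : N.Tight b' b := by
    rcases hTb with rfl | ⟨h, h'⟩
    · exact Or.inl rfl
    · exact Or.inr ⟨h.symm, by rw [Sym2.eq_swap, h', dist_comm hc hl]⟩
  obtain ⟨q, hq, hqs⟩ := exists_cons_isShortest hl hp.reverse hTb' (by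
    rw [dist_comm hc hl b' a, dist_comm hc hl b' b, dist_comm hc hl b a]
    linarith)
  obtain ⟨q', hq', hqs'⟩ := exists_cons_isShortest hl hq.reverse hTa (by linarith)
  refine ⟨q', hq', by rwa [hq'.length_eq hl], ?_⟩
  have hrev : q.reverse.support = p.support ∨ q.reverse.support = p.support ++ [b'] := by
    rw [SimpleGraph.Walk.support_reverse]
    rcases hqs with h | h <;> rw [h] <;> simp [SimpleGraph.Walk.support_reverse]
  rcases hqs' with h | h <;> rcases hrev with h' | h' <;> rw [h, h']
  · exact Or.inl rfl
  · exact Or.inr (Or.inr (Or.inl ⟨b', rfl⟩))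
  · exact Or.inr (Or.inl ⟨a', rfl⟩)
  · exact Or.inr (Or.inr (Or.inr ⟨a', b', rfl⟩))

omit [Finite V] in
theorem locallyHit [Fintype V] : LocallyHit N.dist N.Tight N.highwayDimension := by
  intro ρ hρ v
  obtain ⟨H, hcard, hH⟩ := exists_hitsNeighborhood N hρ v
  refine ⟨H, hcard, fun a' a b b' hs w hw hvw => ?_⟩
  obtain ⟨p, hp⟩ := exists_isShortest hc hl a b
  obtain ⟨q, hq⟩ := exists_isWitness hc hl hp hs
  obtain ⟨x, hx, hxH⟩ := hH a b p ⟨hp, a', b', q, hq, w,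
    (mem_support_iff_between hc hl hu hq.1).2 hw, hvw⟩
  exact ⟨x, hxH, dist_add_dist_of_mem_support hc hl hp hx⟩

theorem exists_mem_support_of_hitsSignificant {r : ℝ} {C : Finset V}
    (hC : HitsSignificant N.dist N.Tight r C) {s t : V} {p : N.graph.Walk s t}
    (hp : N.IsShortest p) (hlen : r < N.length p) : ∃ x ∈ p.support, x ∈ C := by
  obtain ⟨x, hx, hb⟩ := hC s s t t ⟨Or.inl rfl, Or.inl rfl, by simp [dist_self hl], by
    rwa [← hp.length_eq hl]⟩
  exact ⟨x, (mem_support_iff_between hc hl hu hp).2 hb, hx⟩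

omit [Finite V] in
theorem mem_canonicalLabel_iff_between [Fintype V] {key : V → ℕ} {v u : V} :
    u ∈ N.canonicalLabel key v ↔ ∀ x, Between N.dist v x u → key x ≤ key u := by
  rw [mem_canonicalLabel]
  constructor
  · rintro ⟨p, hp, hmax⟩ x hx
    exact hmax x ((mem_support_iff_between hc hl hu hp).2 hx)
  · intro h
    obtain ⟨p, hp⟩ := exists_isShortest hc hl v u
    exact ⟨p, hp, fun x hx => h x (dist_add_dist_of_mem_support hc hl hp hx)⟩

end

/-! ### The bound for the sets of the algorithm -/

/-- The scales `2 / 64, 3 / 64, 4 / 64, 6 / 64, 8 / 64, …`, multiplied by `64`. The ratio of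
consecutive scales is at most `3 / 2`, and eight steps multiply the scale by `16`. -/
def scale (i : ℕ) : ℕ := (2 + i % 2) * 2 ^ (i / 2)

theorem scale_add_two (i : ℕ) : scale (i + 2) = 2 * scale i := by
  unfold scale
  rw [show (i + 2) / 2 = i / 2 + 1 by omega, show (i + 2) % 2 = i % 2 by omega, pow_succ]
  ring

theorem scale_add_eight (i : ℕ) : scale (i + 8) = 16 * scale i := by
  have h1 := scale_add_two i
  have h2 := scale_add_two (i + 2)
  have h3 := scale_add_two (i + 2 + 2)
  have h4 := scale_add_two (i + 2 + 2 + 2)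
  have h5 : scale (i + 8) = scale (i + 2 + 2 + 2 + 2) := rfl
  omega

theorem scale_pos (i : ℕ) : 0 < scale i := by
  unfold scale
  positivity

theorem scale_succ (i : ℕ) : scale i ≤ scale (i + 1) ∧ 2 * scale (i + 1) ≤ 3 * scale i := by
  unfold scale
  rcases Nat.even_or_odd' i with ⟨m, rfl | rfl⟩
  · rw [show (2 * m + 1) / 2 = m by omega, show 2 * m / 2 = m by omega,
      show (2 * m + 1) % 2 = 1 by omega, show 2 * m % 2 = 0 by omega]
    have := Nat.two_pow_pos m
    constructor <;> omega
  · rw [show (2 * m + 1 + 1) / 2 = m + 1 by omega, show (2 * m + 1) / 2 = m by omega,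
      show (2 * m + 1 + 1) % 2 = 0 by omega, show (2 * m + 1) % 2 = 1 by omega, pow_succ]
    have := Nat.two_pow_pos m
    constructor <;> omega

theorem scale_mono : Monotone scale := monotone_nat_of_le_succ fun i => (scale_succ i).1

theorem two_pow_le_scale (i : ℕ) : 2 * 2 ^ (i / 2) ≤ scale i :=
  Nat.mul_le_mul_right _ (by omega)

theorem scale_le (i : ℕ) : scale i ≤ 3 * 2 ^ (i / 2) :=
  Nat.mul_le_mul_right _ (by omega)

/-- The radius `scale i / 64`. -/
def radius (i : ℕ) : ℝ := scale i / 64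

theorem radius_pos (i : ℕ) : 0 < radius i := by
  have := scale_pos i
  unfold radius
  positivity

theorem radius_add_eight (i : ℕ) : radius (i + 8) / 16 = radius i := by
  unfold radius
  rw [scale_add_eight]
  push_cast
  ring

/-- The properties of the sets `C i`, for `i < J + 8`, computed by the algorithm. At the first eight
scales, which are below the smallest distance, they contain all vertices. Every other one hits its
scale if the one eight scales below does, and it has at most as many vertices in the ball around
`v` as some set `H v` found by the greedy algorithm for the local family of `v`. -/
structure LevelSets {V : Type*} [Fintype V] (N : Network V) (J : ℕ) (C : ℕ → Finset V) :
    Prop where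
  low : ∀ i < 8, C i = Finset.univ
  step : ∀ i < J, HitsSignificant N.dist N.Tight (radius i) (C i) → ∃ H : V → Finset V,
    (∀ v, ∃ t alive, GreedyState (fun x c => Between N.dist c.1 x c.2) N.highwayDimension
      (localFamily N.dist N.Tight (radius (i + 8)) (C i) v) alive (H v) t) ∧
    (∀ v, (ballPart N.dist (C (i + 8)) v (3 / 2 * radius (i + 8))).card ≤ (H v).card) ∧
    HitsSignificant N.dist N.Tight (radius (i + 8)) (C (i + 8))

namespace LevelSets

variable [Fintype V] [Nontrivial V] {J : ℕ} {C : ℕ → Finset V}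
  (hC : LevelSets N J C) (hc : N.graph.Connected) (hl : N.LenGeOne) (hu : N.UniqueShortestPaths)
include hC hc hl hu

omit [Nontrivial V] in
theorem hits (i : ℕ) (hi : i < J + 8) : HitsSignificant N.dist N.Tight (radius i) (C i) := by
  induction i using Nat.strong_induction_on with
  | _ i ih =>
    rcases lt_or_ge i 8 with h | h
    · rw [hC.low i h]
      exact (isGeodesicMetric hc hl hu).hitsSignificant_univ _
    · obtain ⟨j, rfl⟩ := Nat.exists_eq_add_of_le' h
      obtain ⟨H, -, -, h3⟩ := hC.step j (by omega) (ih j (by omega) (by omega))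
      exact h3

/-- A ball at one of the first eight scales holds a single vertex; from then on sparsity is
inherited from eight scales below. -/
theorem sparse (i : ℕ) (hi : i < J + 8) (v : V) :
    ((ballPart N.dist (C i) v (3 / 2 * radius i)).card : ℝ) ≤
      64 * (N.highwayDimension * Real.logb 2 N.highwayDimension) := by
  classical
  have hh := two_le_highwayDimension hc hl
  have hh' : (2 : ℝ) ≤ N.highwayDimension := by exact_mod_cast hh
  induction i using Nat.strong_induction_on generalizing v with
  | _ i ih =>
    rcases lt_or_ge i 8 with h | h
    · have hl1 : 1 ≤ Real.logb 2 N.highwayDimension := by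
        rw [Real.le_logb_iff_rpow_le (by norm_num) (by linarith)]
        simpa using hh'
      have hone : (ballPart N.dist (C i) v (3 / 2 * radius i)).card ≤ 1 := by
        have hsub : ballPart N.dist (C i) v (3 / 2 * radius i) ⊆ {v} := by
          intro u hu'
          simp only [ballPart, Finset.mem_filter] at hu'
          by_contra hne
          rw [Finset.mem_singleton] at hne
          have h1 := one_le_dist hc hl (Ne.symm hne)
          have h2 : scale i ≤ scale 7 := scale_mono (by omega)
          have h3 : (scale i : ℝ) ≤ 24 := by
            have : scale 7 = 24 := rfl
            exact_mod_cast this ▸ h2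
          have h4 := hu'.2
          unfold radius at h4
          linarith
        simpa using Finset.card_le_card hsub
      have hone' : ((ballPart N.dist (C i) v (3 / 2 * radius i)).card : ℝ) ≤ 1 := by
        exact_mod_cast hone
      nlinarith
    · obtain ⟨j, rfl⟩ := Nat.exists_eq_add_of_le' h
      obtain ⟨H, h1, h2, -⟩ := hC.step j (by omega) (hits hC hc hl hu j (by omega))
      obtain ⟨t, alive, hg⟩ := h1 v
      have hF := (isGeodesicMetric hc hl hu).card_localFamily_le (locallyHit hc hl hu)
        (radius_pos (j + 8)) (C := C j)
        (fun v => by rw [radius_add_eight]; exact ih j (by omega) (by omega) v) v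
      calc ((ballPart N.dist (C (j + 8)) v (3 / 2 * radius (j + 8))).card : ℝ)
          ≤ (H v).card := by exact_mod_cast h2 v
        _ ≤ _ := hg.card_le_log
        _ ≤ _ := one_add_mul_log_le hh hF

/-- Beyond the diameter the local families are empty, and the local search leaves nothing. -/
theorem eq_empty {i : ℕ} (hiJ : i < J + 8) (hi : 64 * N.diameter ≤ 2 ^ (i / 2)) : C i = ∅ := by
  classical
  have hD := one_le_diameter hc hl
  have h8 : 8 ≤ i := by
    by_contra hcon
    have h1 : i / 2 ≤ 3 := by omega
    have h2 := pow_le_pow_right₀ (by norm_num : (1 : ℝ) ≤ 2) h1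
    norm_num at h2
    linarith
  obtain ⟨j, rfl⟩ := Nat.exists_eq_add_of_le' h8
  obtain ⟨H, h1, h2, -⟩ := hC.step j (by omega) (hits hC hc hl hu j (by omega))
  refine Finset.eq_empty_of_forall_notMem fun v hv => ?_
  obtain ⟨t, alive, hg⟩ := h1 v
  have hrad : N.diameter ≤ 7 / 8 * radius (j + 8) := by
    have h3 : ((2 * 2 ^ ((j + 8) / 2) : ℕ) : ℝ) ≤ scale (j + 8) := by
      exact_mod_cast two_pow_le_scale _
    push_cast at h3
    unfold radius
    linarith
  have h3 := hg.eq_empty (IsGeodesicMetric.localFamily_eq_empty dist_le_diameter hrad _ v)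
  have h4 := h2 v
  rw [h3, Finset.card_empty, Nat.le_zero, Finset.card_eq_zero] at h4
  have h5 : v ∈ ballPart N.dist (C (j + 8)) v (3 / 2 * radius (j + 8)) := by
    simp only [ballPart, Finset.mem_filter]
    refine ⟨hv, ?_⟩
    rw [dist_self hl]
    have := radius_pos (j + 8)
    positivity
  rw [h4] at h5
  simp at h5

/-- The labels for an importance that respects the levels up to a scale beyond the diameter. -/
theorem card_label_le {key : V → ℕ} (hJ : N.diameter ≤ radius J)
    (level : ∀ i < J, ∀ x u, x ∈ C i → key x ≤ key u → ∃ j ≥ i, j < J ∧ u ∈ C j) (v : V) :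
    ((N.canonicalLabel key v).card : ℝ) ≤ 1000 * (N.highwayDimension *
      Real.logb 2 N.highwayDimension * (1 + Real.logb 2 N.diameter)) := by
  classical
  have hD := one_le_diameter hc hl
  have hlog : 0 ≤ Real.logb 2 N.diameter := Real.logb_nonneg (by norm_num) hD
  have hh' : (2 : ℝ) ≤ N.highwayDimension := by exact_mod_cast two_le_highwayDimension hc hl
  have hl1 : 1 ≤ Real.logb 2 N.highwayDimension := by
    rw [Real.le_logb_iff_rpow_le (by norm_num) (by linarith)]
    simpa using hh'
  set M := 2 * (⌈Real.logb 2 N.diameter⌉₊ + 6) with hM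
  have hMempty : ∀ i < J, M ≤ i → C i = ∅ := fun i hiJ hi => eq_empty hC hc hl hu (by omega) (by
    have h1 : N.diameter = (2 : ℝ) ^ (Real.logb 2 N.diameter) := by
      rw [Real.rpow_logb] <;> linarith
    have h2 : (2 : ℝ) ^ (Real.logb 2 N.diameter) ≤
        (2 : ℝ) ^ ((⌈Real.logb 2 N.diameter⌉₊ : ℕ) : ℝ) :=
      Real.rpow_le_rpow_of_exponent_le (by norm_num) (Nat.le_ceil _)
    rw [Real.rpow_natCast] at h2
    have h3 : (2 : ℝ) ^ (⌈Real.logb 2 N.diameter⌉₊ + 6) ≤ 2 ^ (i / 2) :=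
      pow_le_pow_right₀ (by norm_num) (by omega)
    rw [pow_add] at h3
    linarith)
  let C' : ℕ → Finset V := fun i => if i < J then C i else ∅
  have hbound := card_canonicalLabel_le hc hl (key := key) (r := radius) (C := C') (M := J)
    (M' := M) (k := 64 * (N.highwayDimension * Real.logb 2 N.highwayDimension)) (α := 3 / 2)
    (by norm_num) (by simp [radius, scale]; norm_num)
    (fun i => by
      have h1 : ((2 * scale (i + 1) : ℕ) : ℝ) ≤ ((3 * scale i : ℕ) : ℝ) := by
        exact_mod_cast (scale_succ i).2
      push_cast at h1
      unfold radius
      linarith)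
    (fun i j hij => by
      have h1 : (scale i : ℝ) ≤ scale j := by exact_mod_cast scale_mono hij
      unfold radius
      linarith) hJ
    (fun i hi s t p hp hlen => by
      simp only [C', if_pos hi]
      exact exists_mem_support_of_hitsSignificant hc hl hu (hits hC hc hl hu i (by omega)) hp hlen)
    (fun i v => by
      by_cases hi : i < J
      · simp only [C', if_pos hi]
        have := sparse hC hc hl hu i (by omega) v
        simp only [ballPart] at this
        convert this
      · simp only [C', if_neg hi, Finset.filter_empty, Finset.card_empty, Nat.cast_zero]
        positivity)
    (fun i hi => by
      simp only [C']
      split_ifs with hiJ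
      · exact hMempty i hiJ hi
      · rfl)
    (fun i x u hx hle => by
      by_cases hi : i < J
      · simp only [C', if_pos hi] at hx
        obtain ⟨j, hj, hjJ, hju⟩ := level i hi x u hx hle
        exact ⟨j, hj, by simpa only [C', if_pos hjJ] using hju⟩
      · simp [C', hi] at hx) v
  have hMle : (M : ℝ) ≤ 2 * Real.logb 2 N.diameter + 14 := by
    have := (Nat.ceil_lt_add_one hlog).le
    rw [hM]
    push_cast
    linarith
  have hk : (1 : ℝ) ≤ N.highwayDimension * Real.logb 2 N.highwayDimension := by nlinarith
  set k := N.highwayDimension * Real.logb 2 N.highwayDimension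
  have h1 : (M : ℝ) * (64 * k) ≤ (2 * Real.logb 2 N.diameter + 14) * (64 * k) :=
    mul_le_mul_of_nonneg_right hMle (by linarith)
  nlinarith [mul_nonneg hlog (by linarith : 0 ≤ k)]

end LevelSets

end Network

/-! ### Programs with counted loops -/

namespace RAM

/-- The contents of the arrays. -/
abbrev Mem := ℕ → ℕ → ℕ

/-- Programs whose only variables are loop counters and the parameters `var 0` and `var 1`, which
bound the loops, and `var 2`, the largest value ever stored in an array. `loop x b p` executes
`p` for `var x = 0, …, var b - 1`. -/
inductive Stm
  | skip
  | store (a : ℕ) (i e : Exp)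
  | seq (p q : Stm)
  | ite (b : Exp) (p q : Stm)
  | loop (x b : ℕ) (p : Stm)

/-- Apply `f 0`, …, `f (n - 1)` in this order. -/
def iter {α : Type*} (f : ℕ → α → α) (a : α) : ℕ → α
  | 0 => a
  | n + 1 => f n (iter f a n)

theorem iter_induct {α : Type*} {f : ℕ → α → α} {a : α} (P : ℕ → α → Prop) {n : ℕ} (h0 : P 0 a)
    (hs : ∀ k < n, ∀ b, P k b → P (k + 1) (f k b)) : P n (iter f a n) := by
  induction n with
  | zero => exact h0
  | succ n ih => exact hs n (by omega) _ (ih fun k hk => hs k (by omega))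

/-- Change one cell. -/
def setCell (A : Mem) (a i k : ℕ) : Mem := fun b j => if b = a ∧ j = i then k else A b j

/-- The effect of a program on the arrays. Stored values are cut off at `var 2`, which bounds
all values by construction. -/
def Stm.run : Stm → (ℕ → ℕ) → Mem → Mem
  | .skip, _, A => A
  | .store a i e, env, A =>
      setCell A a (i.value ⟨env, A⟩) (min (e.value ⟨env, A⟩) (env 2))
  | .seq p q, env, A => q.run env (p.run env A)
  | .ite b p q, env, A => if b.value ⟨env, A⟩ ≠ 0 then p.run env A else q.run env A
  | .loop x b p, env, A => iter (fun k => p.run (Function.update env x k)) A (env b)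

/-- Translation to commands of the machine. Counters are reset to `0` after the loop. -/
def Stm.compile : Stm → Cmd
  | .skip => .skip
  | .store a i e => .cond (.bin .lt e (.var 2)) (.store a i e) (.store a i (.var 2))
  | .seq p q => .seq p.compile q.compile
  | .ite b p q => .cond b p.compile q.compile
  | .loop x b p => .seq (.assign x (.const 0))
      (.seq (.loop (.bin .lt (.var x) (.var b))
        (.seq p.compile (.assign x (.bin .add (.var x) (.const 1)))))
        (.assign x (.const 0)))

/-- Nested loops use increasing counters, the first at least `lo`, and are bounded by `var 0` or
`var 1`. -/
def Stm.WellFormed : ℕ → Stm → Prop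
  | _, .skip => True
  | _, .store _ _ _ => True
  | lo, .seq p q => p.WellFormed lo ∧ q.WellFormed lo
  | lo, .ite _ p q => p.WellFormed lo ∧ q.WellFormed lo
  | lo, .loop x b p => lo ≤ x ∧ b < 2 ∧ p.WellFormed (x + 1)

/-- The arrays that a program may change. -/
def Stm.writes : Stm → List ℕ
  | .skip => []
  | .store a _ _ => [a]
  | .seq p q => p.writes ++ q.writes
  | .ite _ p q => p.writes ++ q.writes
  | .loop _ _ p => p.writes

theorem Stm.run_frame (p : Stm) (env : ℕ → ℕ) (A : Mem) {a : ℕ} (ha : a ∉ p.writes) :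
    p.run env A a = A a := by
  induction p generalizing env A with
  | skip => rfl
  | store b i e =>
    simp only [writes, List.mem_singleton] at ha
    funext j
    simp [run, setCell, ha]
  | seq p q ihp ihq =>
    simp only [writes, List.mem_append, not_or] at ha
    simp only [run]
    rw [ihq _ _ ha.2, ihp _ _ ha.1]
  | ite b p q ihp ihq =>
    simp only [writes, List.mem_append, not_or] at ha
    simp only [run]
    split_ifs
    · exact ihp _ _ ha.1
    · exact ihq _ _ ha.2
  | loop x b p ih =>
    simp only [run]
    exact iter_induct (fun _ (B : Mem) => B a = A a) rfl fun k _ B hB => by rw [ih _ _ ha, hB]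

/-! ### Running time -/

/-- A size of expressions that controls both the bit lengths of their values and their costs. -/
def Exp.weight : Exp → ℕ
  | .const k => k.size + 1
  | .var _ => 1
  | .load _ i => i.weight + 1
  | .bin _ e f => e.weight + f.weight + 1

theorem size_mul_le (a b : ℕ) : (a * b).size ≤ a.size + b.size := by
  rw [Nat.size_le, pow_add]
  exact Nat.mul_lt_mul'' (Nat.lt_size_self a) (Nat.lt_size_self b)

theorem size_add_le (a b : ℕ) : (a + b).size ≤ a.size + b.size + 1 := by
  rw [Nat.size_le, pow_succ, pow_add]
  have h1 := Nat.lt_size_self a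
  have h2 := Nat.lt_size_self b
  have h3 := Nat.one_le_two_pow (n := a.size)
  have h4 := Nat.one_le_two_pow (n := b.size)
  nlinarith

theorem BinOp.size_apply_le (op : BinOp) (a b : ℕ) :
    (op.apply a b).size ≤ a.size + b.size + 1 := by
  cases op with
  | add => exact size_add_le a b
  | sub => exact (Nat.size_le_size (Nat.sub_le a b)).trans (by omega)
  | mul => exact (size_mul_le a b).trans (by omega)
  | div => exact (Nat.size_le_size (Nat.div_le_self a b)).trans (by omega)
  | mod => exact (Nat.size_le_size (Nat.mod_le a b)).trans (by omega)
  | lt =>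
    have : (1 : ℕ).size = 1 := Nat.size_one
    simp only [apply]
    split_ifs <;> simp
  | eq =>
    have : (1 : ℕ).size = 1 := Nat.size_one
    simp only [apply]
    split_ifs <;> simp

/-- All cells have at most `X` bits. -/
def SizeLE (A : Mem) (X : ℕ) : Prop := ∀ a i, (A a i).size ≤ X

theorem Exp.size_value_le {env : ℕ → ℕ} {A : Mem} {X : ℕ} (hX : 1 ≤ X)
    (henv : ∀ y, (env y).size ≤ X) (hA : SizeLE A X) (e : Exp) :
    (e.value ⟨env, A⟩).size ≤ e.weight * X := by
  induction e with
  | const k =>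
    simp only [value, weight]
    nlinarith
  | var x => simpa [value, weight] using henv x
  | load a i ih =>
    simp only [value, weight]
    have := hA a (i.value ⟨env, A⟩)
    nlinarith
  | bin op e f ihe ihf =>
    simp only [value, weight]
    have := op.size_apply_le (e.value ⟨env, A⟩) (f.value ⟨env, A⟩)
    nlinarith

/-- The bound for the cost of an expression. -/
def Exp.costBound (e : Exp) : Polynomial ℕ :=
  Polynomial.C e.weight * (1 + Polynomial.C e.weight * Polynomial.X)

theorem Exp.cost_le {env : ℕ → ℕ} {A : Mem} {X : ℕ} (hX : 1 ≤ X)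
    (henv : ∀ y, (env y).size ≤ X) (hA : SizeLE A X) (e : Exp) :
    e.cost ⟨env, A⟩ ≤ e.costBound.eval X := by
  simp only [costBound, Polynomial.eval_mul, Polynomial.eval_C, Polynomial.eval_add,
    Polynomial.eval_one, Polynomial.eval_X]
  induction e with
  | const k =>
    simp only [cost, weight]
    nlinarith [Nat.zero_le k.size, Nat.zero_le (k.size * X)]
  | var x =>
    have := henv x
    simp only [cost, weight]
    linarith
  | load a i ih =>
    have h1 := hA a (i.value ⟨env, A⟩)
    simp only [cost, weight]
    nlinarith [Nat.zero_le (i.weight * X)]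
  | bin op e f ihe ihf =>
    have h1 := Exp.size_value_le hX henv hA (.bin op e f)
    simp only [cost, weight, value] at h1 ⊢
    nlinarith [Nat.zero_le (e.weight * X), Nat.zero_le (f.weight * X),
      Nat.zero_le (e.weight * (f.weight * X))]

/-- The time bound for a program, in terms of a bound for the numbers of iterations of the loops and
for the bit lengths of all values. -/
def Stm.timeBound : Stm → Polynomial ℕ
  | .skip => 1
  | .store _ i e => 2 + (Exp.bin .lt e (.var 2)).costBound + i.costBound + e.costBound +
      (Exp.var 2).costBound
  | .seq p q => 1 + p.timeBound + q.timeBound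
  | .ite b p q => 1 + b.costBound + p.timeBound + q.timeBound
  | .loop x b p =>
      let guard := 1 + (Exp.bin .lt (.var x) (.var b)).costBound
      4 + 2 * (Exp.const 0).costBound + guard + Polynomial.X *
        (guard + p.timeBound + 2 + (Exp.bin .add (.var x) (.const 1)).costBound)

theorem size_le_self (k : ℕ) : k.size ≤ k := by
  rw [Nat.size_le]
  exact Nat.lt_two_pow_self

theorem Stm.sizeLE_run (p : Stm) {env : ℕ → ℕ} {A : Mem} {X : ℕ} (h2 : (env 2).size ≤ X)
    {lo : ℕ} (hlo : 3 ≤ lo) (hp : p.WellFormed lo) (hA : SizeLE A X) :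
    SizeLE (p.run env A) X := by
  induction p generalizing env A lo with
  | skip => exact hA
  | store a i e =>
    intro b j
    simp only [run, setCell]
    split_ifs
    · exact (Nat.size_le_size (min_le_right _ _)).trans h2
    · exact hA b j
  | seq p q ihp ihq => exact ihq h2 hlo hp.2 (ihp h2 hlo hp.1 hA)
  | ite b p q ihp ihq =>
    simp only [run]
    split_ifs
    · exact ihp h2 hlo hp.1 hA
    · exact ihq h2 hlo hp.2 hA
  | loop x b p ih =>
    simp only [run]
    obtain ⟨hx, -, hp⟩ := hp
    refine iter_induct (fun _ B => SizeLE B X) hA fun k _ B hB => ih ?_ (by omega) hp hB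
    rwa [Function.update_of_ne (by omega)]

/-- A compiled program halts in polynomial time with the effect prescribed by `Stm.run`. -/
theorem Stm.exec_compile (p : Stm) {env : ℕ → ℕ} {A : Mem} {X lo : ℕ} (hX : 1 ≤ X) (hlo : 3 ≤ lo)
    (hp : p.WellFormed lo) (hzero : ∀ y, lo ≤ y → env y = 0) (henv : ∀ y, (env y).size ≤ X)
    (hb : ∀ b < 2, env b ≤ X) (hA : SizeLE A X) :
    ∃ t ≤ p.timeBound.eval X, Exec p.compile ⟨env, A⟩ t ⟨env, p.run env A⟩ := by
  induction p generalizing env A lo with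
  | skip => exact ⟨1, by simp [timeBound], Exec.skip _⟩
  | store a i e =>
    have c1 := Exp.cost_le hX henv hA (.bin .lt e (.var 2))
    have c2 := Exp.cost_le hX henv hA i
    have c3 := Exp.cost_le hX henv hA e
    have c4 := Exp.cost_le hX henv hA (.var 2)
    have ht : (Stm.store a i e).timeBound.eval X = 2 +
      (Exp.bin .lt e (.var 2)).costBound.eval X + i.costBound.eval X + e.costBound.eval X +
      (Exp.var 2).costBound.eval X := by simp [timeBound]
    rw [ht]
    by_cases h : e.value ⟨env, A⟩ < env 2
    · have hE := Exec.store ⟨env, A⟩ a i e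
      have hs : Store.setArr ⟨env, A⟩ a (i.value ⟨env, A⟩) (e.value ⟨env, A⟩) =
          ⟨env, (Stm.store a i e).run env A⟩ := by
        simp only [run, Store.setArr, min_eq_left h.le]
        rfl
      rw [hs] at hE
      exact ⟨_, by omega, Exec.cond_true (by simp [Exp.value, BinOp.apply, h]) hE⟩
    · have hE := Exec.store ⟨env, A⟩ a i (.var 2)
      have hs : Store.setArr ⟨env, A⟩ a (i.value ⟨env, A⟩) ((Exp.var 2).value ⟨env, A⟩) =
          ⟨env, (Stm.store a i e).run env A⟩ := by
        simp only [run, Store.setArr, min_eq_right (not_lt.1 h), Exp.value]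
        rfl
      rw [hs] at hE
      exact ⟨_, by omega, Exec.cond_false (by simp [Exp.value, BinOp.apply, h]) hE⟩
  | seq p q ihp ihq =>
    obtain ⟨t, ht, h⟩ := ihp hlo hp.1 hzero henv hb hA
    obtain ⟨t', ht', h'⟩ := ihq hlo hp.2 hzero henv hb (p.sizeLE_run (henv 2) hlo hp.1 hA)
    refine ⟨_, ?_, Exec.seq h h'⟩
    simp only [timeBound, Polynomial.eval_add, Polynomial.eval_one]
    omega
  | ite b p q ihp ihq =>
    have c1 := Exp.cost_le hX henv hA b
    simp only [timeBound, Polynomial.eval_add, Polynomial.eval_one, run]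
    by_cases h : b.value ⟨env, A⟩ = 0
    · obtain ⟨t, ht, h'⟩ := ihq hlo hp.2 hzero henv hb hA
      rw [if_neg (not_not.2 h)]
      exact ⟨_, by omega, Exec.cond_false h h'⟩
    · obtain ⟨t, ht, h'⟩ := ihp hlo hp.1 hzero henv hb hA
      rw [if_pos h]
      exact ⟨_, by omega, Exec.cond_true h h'⟩
  | loop x b p ih =>
    obtain ⟨hx, hb2, hp⟩ := hp
    set f : ℕ → Mem → Mem := fun k => p.run (Function.update env x k) with hf
    have hset : ∀ (k k' : ℕ) (B : Mem),
        (⟨Function.update env x k, B⟩ : Store).setVar x k' = ⟨Function.update env x k', B⟩ := by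
      intro k k' B
      simp only [Store.setVar]
      congr 1
      funext y
      by_cases hy : y = x <;> simp [hy]
    have henvk : ∀ k ≤ X, ∀ y, (Function.update env x k y).size ≤ X := by
      intro k hk y
      by_cases hy : y = x
      · subst hy
        simpa using (size_le_self k).trans hk
      · rw [Function.update_of_ne hy]
        exact henv y
    have hxb : b ≠ x := by omega
    have hx2 : 2 ≠ x := by omega
    have hsize : ∀ k, SizeLE (iter f A k) X := fun k =>
      iter_induct (fun _ B => SizeLE B X) hA fun k _ B hB => p.sizeLE_run
        (by rw [Function.update_of_ne hx2]; exact henv 2) (by omega) hp hB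
    set g := (1 + (Exp.bin .lt (.var x) (.var b)).costBound.eval X) with hg
    set c := (g + p.timeBound.eval X + 2 +
      (Exp.bin .add (.var x) (.const 1)).costBound.eval X) with hc
    have hbX := hb b hb2
    have hloop : ∀ m, m ≤ env b → ∃ t ≤ m * c + g,
        Exec (.loop (.bin .lt (.var x) (.var b))
          (.seq p.compile (.assign x (.bin .add (.var x) (.const 1)))))
          ⟨Function.update env x (env b - m), iter f A (env b - m)⟩ t
          ⟨Function.update env x (env b), iter f A (env b)⟩ := by
      intro m hm
      induction m with
      | zero =>
        refine ⟨_, ?_, Exec.loop_false ?_⟩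
        · have := Exp.cost_le hX (henvk (env b - 0) (by omega)) (hsize (env b - 0))
            (.bin .lt (.var x) (.var b))
          omega
        · simp [Exp.value, BinOp.apply, Function.update_of_ne hxb]
      | succ m ihm =>
        obtain ⟨t, ht, hE⟩ := ihm (by omega)
        have hk : env b - m = env b - (m + 1) + 1 := by omega
        set k := env b - (m + 1) with hkdef
        rw [hk] at hE
        have c1 := Exp.cost_le hX (henvk k (by omega)) (hsize k) (.bin .lt (.var x) (.var b))
        have c2 := Exp.cost_le hX (henvk k (by omega)) (hsize (k + 1))
          (.bin .add (.var x) (.const 1))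
        obtain ⟨t', ht', hE'⟩ := ih (env := Function.update env x k) (A := iter f A k)
          (lo := x + 1) (by omega) hp
          (fun y hy => by
            rw [Function.update_of_ne (by omega)]
            exact hzero y (by omega))
          (henvk k (by omega))
          (fun b' hb' => by
            rw [Function.update_of_ne (by omega)]
            exact hb b' hb') (hsize k)
        have hassign := Exec.assign ⟨Function.update env x k, iter f A (k + 1)⟩ x
          (.bin .add (.var x) (.const 1))
        have hval : (Exp.bin .add (.var x) (.const 1)).value
            ⟨Function.update env x k, iter f A (k + 1)⟩ = k + 1 := by
          simp [Exp.value, BinOp.apply]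
        rw [hset, hval] at hassign
        refine ⟨_, ?_, Exec.loop_true ?_ (Exec.seq hE' hassign) hE⟩
        · have : (m + 1) * c = m * c + c := by ring
          omega
        · have : k < env b := by omega
          simp [Exp.value, BinOp.apply, Function.update_of_ne hxb, this]
    obtain ⟨t, ht, hE⟩ := hloop (env b) le_rfl
    rw [Nat.sub_self] at hE
    have hx0 : Function.update env x 0 = env := by
      rw [Function.update_eq_self_iff, hzero x hx]
    have a1 := Exec.assign ⟨env, A⟩ x (.const 0)
    have h0 := hset 0 0 A
    rw [hx0] at h0 hE
    rw [show (Exp.const 0).value ⟨env, A⟩ = 0 from rfl, h0] at a1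
    have a2 := Exec.assign ⟨Function.update env x (env b), iter f A (env b)⟩ x (.const 0)
    rw [hset, show (Exp.const 0).value ⟨Function.update env x (env b), iter f A (env b)⟩ = 0
      from rfl, hx0] at a2
    have c3 := Exp.cost_le hX henv hA (.const 0)
    have c4 := Exp.cost_le hX (henvk (env b) (by omega)) (hsize (env b)) (.const 0)
    refine ⟨_, ?_, Exec.seq a1 (Exec.seq hE a2)⟩
    have hmul : env b * c ≤ X * c := Nat.mul_le_mul_right c hbX
    have htb : (Stm.loop x b p).timeBound.eval X =
      4 + 2 * (Exp.const 0).costBound.eval X + g + X * c := by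
      simp only [timeBound, Polynomial.eval_add, Polynomial.eval_mul, Polynomial.eval_X,
        Polynomial.eval_ofNat, Polynomial.eval_one, hc, hg]
    rw [htb]
    omega

/-! ### Effects of loops -/

open Classical in
/-- Overwrite the cells of array `a` in the set `S` by the values of `g`. -/
def setOn (A : Mem) (a : ℕ) (S : ℕ → Prop) (g : ℕ → ℕ) : Mem :=
  fun b j => if b = a ∧ S j then g j else A b j

theorem setOn_of_ne {A : Mem} {a b : ℕ} (h : b ≠ a) (S : ℕ → Prop) (g : ℕ → ℕ) :
    setOn A a S g b = A b := by
  funext j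
  simp [setOn, h]

/-- Add `g` to array `a`, cut off at `W`. -/
def addOn (W : ℕ) (A : Mem) (a : ℕ) (g : ℕ → ℕ) : Mem :=
  fun b j => if b = a then min W (A b j + g j) else A b j

theorem addOn_of_ne {W : ℕ} {A : Mem} {a b : ℕ} (h : b ≠ a) (g : ℕ → ℕ) :
    addOn W A a g b = A b := by
  funext j
  simp [addOn, h]

theorem setCell_eq_setOn (A : Mem) (a i k : ℕ) (g : ℕ → ℕ) (h : g i = k) :
    setCell A a i k = setOn A a (fun j => j = i) g := by
  funext b j
  simp only [setCell, setOn]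
  split_ifs with h1
  · rw [h1.2, h]
  · rfl

theorem setCell_eq_addOn (W : ℕ) (A : Mem) (a i k : ℕ) (hA : ∀ j, A a j ≤ W) :
    setCell A a i (min (A a i + k) W) = addOn W A a (fun j => if j = i then k else 0) := by
  funext b j
  simp only [setCell, addOn]
  by_cases hb : b = a
  · subst hb
    by_cases hj : j = i
    · subst hj
      simp [min_comm]
    · simp [hj, hA j]
  · simp [hb]

theorem setOn_setOn (A : Mem) (a : ℕ) (S S' : ℕ → Prop) (g : ℕ → ℕ) :
    setOn (setOn A a S g) a S' g = setOn A a (fun j => S j ∨ S' j) g := by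
  funext b j
  by_cases hb : b = a <;> by_cases h1 : S j <;> by_cases h2 : S' j <;> simp [setOn, hb, h1, h2]

theorem iter_setOn {f : ℕ → Mem → Mem} {A₀ : Mem} {a n : ℕ} {S : ℕ → ℕ → Prop} {g : ℕ → ℕ}
    (h : ∀ k < n, ∀ A : Mem, (∀ b, b ≠ a → A b = A₀ b) → f k A = setOn A a (S k) g) :
    iter f A₀ n = setOn A₀ a (fun j => ∃ k < n, S k j) g := by
  refine iter_induct (fun m B => B = setOn A₀ a (fun j => ∃ k < m, S k j) g) ?_ ?_
  · funext b j
    simp [setOn]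
  · rintro k hk B rfl
    rw [h k hk _ fun b hb => setOn_of_ne hb _ _]
    rw [setOn_setOn]
    congr 1
    funext j
    exact propext Nat.exists_lt_succ_right.symm

theorem iter_addOn {W : ℕ} {f : ℕ → Mem → Mem} {A₀ : Mem} {a n : ℕ} {g : ℕ → ℕ → ℕ}
    (hA₀ : ∀ j, A₀ a j ≤ W)
    (h : ∀ k < n, ∀ A : Mem, (∀ b, b ≠ a → A b = A₀ b) → (∀ j, A a j ≤ W) →
      f k A = addOn W A a (g k)) :
    iter f A₀ n = addOn W A₀ a (fun j => ∑ k ∈ Finset.range n, g k j) := by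
  refine iter_induct (fun m B => B = addOn W A₀ a (fun j => ∑ k ∈ Finset.range m, g k j)) ?_ ?_
  · funext b j
    by_cases hb : b = a
    · subst hb
      simp [addOn, hA₀ j]
    · simp [addOn, hb]
  · rintro k hk B rfl
    rw [h k hk _ (fun b hb => addOn_of_ne hb _) (fun j => by simp [addOn])]
    funext b j
    by_cases hb : b = a
    · simp only [addOn, hb, if_true, Finset.sum_range_succ]
      omega
    · simp [addOn, hb]

end RAM

/-! ### Parameters of the loops -/

namespace RAM

theorem exec_while {b : Exp} {c : Cmd} (σ : ℕ → Store) {m G T : ℕ}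
    (hstep : ∀ k < m, b.value (σ k) ≠ 0 ∧ ∃ t ≤ T, Exec c (σ k) t (σ (k + 1)))
    (hend : b.value (σ m) = 0) (hcost : ∀ k ≤ m, b.cost (σ k) ≤ G) :
    ∃ t ≤ m * (1 + G + T) + (1 + G), Exec (.loop b c) (σ 0) t (σ m) := by
  have h : ∀ j ≤ m, ∃ t ≤ j * (1 + G + T) + (1 + G), Exec (.loop b c) (σ (m - j)) t (σ m) := by
    intro j hj
    induction j with
    | zero =>
      have := hcost m le_rfl
      rw [Nat.sub_zero]
      exact ⟨_, by omega, Exec.loop_false hend⟩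
    | succ j ih =>
      obtain ⟨t, ht, hE⟩ := ih (by omega)
      obtain ⟨hb, t', ht', hE'⟩ := hstep (m - (j + 1)) (by omega)
      rw [show m - (j + 1) + 1 = m - j by omega] at hE'
      have h1 := hcost (m - (j + 1)) (by omega)
      have h2 : (j + 1) * (1 + G + T) = j * (1 + G + T) + (1 + G + T) := by ring
      exact ⟨_, by omega, Exec.loop_true hb hE' hE⟩
  simpa using h m le_rfl

/-- The variables during the computation of the parameters. -/
def params (a b c d : ℕ) : ℕ → ℕ
  | 0 => a
  | 1 => b
  | 2 => c
  | 3 => d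
  | _ => 0

theorem params_setVar (a b c d k : ℕ) (A : Mem) :
    (⟨params a b c d, A⟩ : Store).setVar 0 k = ⟨params k b c d, A⟩ ∧
    (⟨params a b c d, A⟩ : Store).setVar 1 k = ⟨params a k c d, A⟩ ∧
    (⟨params a b c d, A⟩ : Store).setVar 2 k = ⟨params a b k d, A⟩ ∧
    (⟨params a b c d, A⟩ : Store).setVar 3 k = ⟨params a b c k, A⟩ := by
  refine ⟨?_, ?_, ?_, ?_⟩ <;>
  · simp only [Store.setVar]
    congr 1
    funext y
    match y with
    | 0 | 1 | 2 | 3 => rfl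
    | y + 4 => rfl

theorem size_params_le {a b c d X : ℕ} (ha : a.size ≤ X) (hb : b.size ≤ X) (hc : c.size ≤ X)
    (hd : d.size ≤ X) (y : ℕ) : (params a b c d y).size ≤ X := by
  match y with
  | 0 => exact ha
  | 1 => exact hb
  | 2 => exact hc
  | 3 => exact hd
  | y + 4 => simp [params]

theorem cost_params_le {a b c d X : ℕ} {A : Mem} (hX : 1 ≤ X) (ha : a.size ≤ X) (hb : b.size ≤ X)
    (hc : c.size ≤ X) (hd : d.size ≤ X) (hA : SizeLE A X) (e : Exp) :
    e.cost ⟨params a b c d, A⟩ ≤ e.costBound.eval X :=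
  Exp.cost_le hX (size_params_le ha hb hc hd) hA e

/-- The upper limit of the first loop of `setup`: the length of the input. -/
def inputLength : Exp := .bin .add (.const 1) (.bin .mul (.const 2) (.bin .mul (.var 0) (.var 0)))

/-- The factor that `setup` multiplies to `var 2` for an input cell. -/
def inputFactor : Exp := .bin .mul (.var 2) (.bin .add (.const 1) (.load 0 (.var 3)))

/-- `1024 * (var 2) ^ 4`. -/
def capExp : Exp :=
  .bin .mul (.const 1024) (.bin .mul (.bin .mul (.var 2) (.var 2)) (.bin .mul (.var 2) (.var 2)))

/-- The variable `x` increased by `k`. -/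
def incr (x k : ℕ) : Exp := .bin .add (.var x) (.const k)

/-- Compute the parameters: `var 0` is the number of vertices; with `B` the product of `1 + k` over
all input numbers `k`, `var 1` becomes `4 * B.size + 10` and `var 2` becomes `1024 * B ^ 4`. -/
def setup : Cmd :=
  .seq (.assign 0 (.load 0 (.const 0)))
  (.seq (.assign 2 (.const 1))
  (.seq (.loop (.bin .lt (.var 3) inputLength)
    (.seq (.assign 2 inputFactor) (.assign 3 (incr 3 1))))
  (.seq (.assign 3 (.var 2))
  (.seq (.loop (.var 3)
    (.seq (.assign 3 (.bin .div (.var 3) (.const 2))) (.assign 1 (incr 1 4))))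
  (.seq (.assign 1 (incr 1 10)) (.assign 2 capExp))))))

/-- The time bound for `setup`, in terms of a bound for the bit lengths of all values and for the
numbers of iterations. -/
def setupBound : Polynomial ℕ :=
  let guard := (Exp.bin .lt (.var 3) inputLength).costBound
  let body := 3 + inputFactor.costBound + (incr 3 1).costBound
  let guard' := (Exp.var 3).costBound
  let body' := 3 + (Exp.bin .div (.var 3) (.const 2)).costBound + (incr 1 4).costBound
  20 + (Exp.load 0 (.const 0)).costBound + (Exp.const 1).costBound +
    (Polynomial.X * (1 + guard + body) + (1 + guard)) + (Exp.var 2).costBound +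
    (Polynomial.X * (1 + guard' + body') + (1 + guard')) + (incr 1 10).costBound +
    capExp.costBound

/-- The product of `1 + k` over all input numbers `k`. -/
def inputProd (w : List ℕ) : ℕ := (w.map fun k => 1 + k).prod

theorem inputProd_pos (w : List ℕ) : 0 < inputProd w := by
  induction w with
  | nil => simp [inputProd]
  | cons k w ih =>
    simp only [inputProd, List.map_cons, List.prod_cons] at ih ⊢
    positivity

theorem inputProd_lt (w : List ℕ) (hw : w ≠ []) : inputProd w < 2 ^ inputSize w := by
  have h : ∀ w : List ℕ, inputProd w * 2 ^ w.length ≤ 2 ^ inputSize w := by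
    intro w
    induction w with
    | nil => simp [inputProd, inputSize]
    | cons k w ih =>
      simp only [inputProd, inputSize, List.map_cons, List.prod_cons, List.sum_cons,
        List.length_cons] at ih ⊢
      have hk : 1 + k ≤ 2 ^ k.size := by
        have := Nat.lt_size_self k
        omega
      calc (1 + k) * (w.map fun k => 1 + k).prod * 2 ^ (w.length + 1)
          = (2 * (1 + k)) * ((w.map fun k => 1 + k).prod * 2 ^ w.length) := by
            rw [pow_succ]; ring
        _ ≤ (2 * 2 ^ k.size) * 2 ^ (w.map fun k => 1 + k.size).sum :=
            Nat.mul_le_mul (by omega) ih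
        _ = 2 ^ (1 + k.size + (w.map fun k => 1 + k.size).sum) := by
            rw [pow_add, pow_add, pow_one]
  have h1 := h w
  have h2 : 2 ≤ 2 ^ w.length := by
    have : w.length ≠ 0 := by simpa using hw
    exact Nat.le_self_pow this 2
  have h3 := inputProd_pos w
  nlinarith

theorem size_inputProd_le (w : List ℕ) (hw : w ≠ []) : (inputProd w).size ≤ inputSize w :=
  Nat.size_le.2 (inputProd_lt w hw)

theorem length_le_inputSize (w : List ℕ) : w.length ≤ inputSize w := by
  induction w with
  | nil => simp
  | cons k w ih =>
    simp only [inputSize, List.map_cons, List.sum_cons, List.length_cons] at ih ⊢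
    omega

theorem size_getD_le (w : List ℕ) (i : ℕ) : (w.getD i 0).size ≤ inputSize w := by
  induction w generalizing i with
  | nil => simp
  | cons k w ih =>
    simp only [inputSize, List.map_cons, List.sum_cons] at ih ⊢
    cases i with
    | zero => simp only [List.getD_cons_zero]; omega
    | succ i =>
      have := ih i
      simp only [List.getD_cons_succ]
      omega

theorem inputProd_take_succ (w : List ℕ) {k : ℕ} (hk : k < w.length) :
    inputProd (w.take (k + 1)) = inputProd (w.take k) * (1 + w.getD k 0) := by
  rw [List.take_succ_eq_append_getElem hk, inputProd, List.map_append, List.prod_append]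
  simp [inputProd, List.getElem?_eq_getElem hk]

theorem inputProd_take_le (w : List ℕ) (k : ℕ) : inputProd (w.take k) ≤ inputProd w := by
  have h : inputProd w = inputProd (w.take k) * inputProd (w.drop k) := by
    conv_lhs => rw [← List.take_append_drop k w]
    simp only [inputProd, List.map_append, List.prod_append]
  rw [h]
  exact Nat.le_mul_of_pos_right _ (inputProd_pos _)

theorem size_div_two_pow (B k : ℕ) (hk : k < B.size) : B / 2 ^ k ≠ 0 := by
  rw [Nat.lt_size] at hk
  exact (Nat.div_pos hk (by positivity)).ne'

theorem exec_setup {w : List ℕ} {n X : ℕ} (hn : w.getD 0 0 = n) (hlen : w.length = 1 + 2 * (n * n))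
    (hX : 4 * inputSize w + 25 ≤ X) :
    ∃ t ≤ setupBound.eval X, Exec setup (start w) t
      ⟨params n (4 * (inputProd w).size + 10) (1024 * inputProd w ^ 4) 0, (start w).arr⟩ := by
  have hw : w ≠ [] := by
    rintro rfl
    simp only [List.length_nil] at hlen
    omega
  set A := (start w).arr with hA
  have hsz := size_inputProd_le w hw
  have hlenX := length_le_inputSize w
  have hX1 : 1 ≤ X := by omega
  have hAX : SizeLE A X := by
    intro a i
    simp only [hA, start]
    split_ifs
    · exact (size_getD_le w i).trans (by omega)
    · simp
  have hnX : n.size ≤ X := by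
    rw [← hn]
    exact (size_getD_le w 0).trans (by omega)
  have hsmall : ∀ k ≤ X, k.size ≤ X := fun k hk => (size_le_self k).trans hk
  have hstart : start w = ⟨params 0 0 0 0, A⟩ := by
    simp only [start, hA]
    congr 1
    funext y
    match y with
    | 0 | 1 | 2 | 3 => rfl
    | y + 4 => rfl
  have e1 := Exec.assign ⟨params 0 0 0 0, A⟩ 0 (.load 0 (.const 0))
  have c1 := cost_params_le hX1 (X := X) (by simp) (by simp) (by simp) (by simp) hAX
    (a := 0) (b := 0) (c := 0) (d := 0) (.load 0 (.const 0))
  rw [show (Exp.load 0 (.const 0)).value ⟨params 0 0 0 0, A⟩ = n by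
    simpa [Exp.value, hA, start] using hn, (params_setVar _ _ _ _ _ _).1] at e1
  have e2 := Exec.assign ⟨params n 0 0 0, A⟩ 2 (.const 1)
  have c2 := cost_params_le hX1 hnX (by simp) (by simp) (by simp) hAX
    (b := 0) (c := 0) (d := 0) (.const 1)
  rw [show (Exp.const 1).value ⟨params n 0 0 0, A⟩ = 1 from rfl,
    (params_setVar _ _ _ _ _ _).2.2.1] at e2
  -- The product of the input.
  let P : ℕ → ℕ := fun k => inputProd (w.take k)
  have hP : ∀ k, (P k).size ≤ X := fun k =>
    (Nat.size_le_size (inputProd_take_le w k)).trans (by omega)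
  obtain ⟨t3, ht3, e3⟩ := exec_while (b := .bin .lt (.var 3) inputLength)
    (c := .seq (.assign 2 inputFactor) (.assign 3 (incr 3 1)))
    (fun k => ⟨params n 0 (P k) k, A⟩) (m := w.length)
    (G := (Exp.bin .lt (.var 3) inputLength).costBound.eval X)
    (T := 3 + inputFactor.costBound.eval X + (incr 3 1).costBound.eval X)
    (fun k hk => by
      refine ⟨by simpa [Exp.value, inputLength, BinOp.apply, params] using by omega, ?_⟩
      have f1 := Exec.assign ⟨params n 0 (P k) k, A⟩ 2 inputFactor
      have d1 := cost_params_le hX1 hnX (by simp) (hP k) (hsmall k (by omega)) hAX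
        (b := 0) inputFactor
      rw [show inputFactor.value ⟨params n 0 (P k) k, A⟩ = P (k + 1) by
        simp only [P, inputProd_take_succ w hk]
        simp [Exp.value, inputFactor, BinOp.apply, params, hA, start],
        (params_setVar _ _ _ _ _ _).2.2.1] at f1
      have f2 := Exec.assign ⟨params n 0 (P (k + 1)) k, A⟩ 3 (incr 3 1)
      have d2 := cost_params_le hX1 hnX (by simp) (hP (k + 1)) (hsmall k (by omega))
        hAX (b := 0) (incr 3 1)
      rw [show (incr 3 1).value ⟨params n 0 (P (k + 1)) k, A⟩ = k + 1 from rfl,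
        (params_setVar _ _ _ _ _ _).2.2.2] at f2
      exact ⟨_, by omega, Exec.seq f1 f2⟩)
    (by simpa [Exp.value, inputLength, BinOp.apply, params] using by omega)
    (fun k hk => cost_params_le hX1
      hnX (by simp) (hP k) (hsmall k (by omega)) hAX _)
  have hPw : P w.length = inputProd w := by simp [P]
  rw [show P 0 = 1 by simp [P, inputProd], hPw] at e3
  set B := inputProd w with hB
  have hBX : B.size ≤ X := by omega
  have e4 := Exec.assign ⟨params n 0 B w.length, A⟩ 3 (.var 2)
  have c4 := cost_params_le hX1 hnX (by simp) hBX (hsmall w.length (by omega)) hAX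
    (b := 0) (.var 2)
  rw [show (Exp.var 2).value ⟨params n 0 B w.length, A⟩ = B from rfl,
    (params_setVar _ _ _ _ _ _).2.2.2] at e4
  -- The number of bits of the product, times four.
  have hdiv : ∀ k, (B / 2 ^ k).size ≤ X := fun k =>
    (Nat.size_le_size (Nat.div_le_self _ _)).trans hBX
  obtain ⟨t5, ht5, e5⟩ := exec_while (b := .var 3)
    (c := .seq (.assign 3 (.bin .div (.var 3) (.const 2))) (.assign 1 (incr 1 4)))
    (fun k => ⟨params n (4 * k) B (B / 2 ^ k), A⟩) (m := B.size)
    (G := (Exp.var 3).costBound.eval X)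
    (T := 3 + (Exp.bin .div (.var 3) (.const 2)).costBound.eval X + (incr 1 4).costBound.eval X)
    (fun k hk => by
      refine ⟨size_div_two_pow B k hk, ?_⟩
      have f1 := Exec.assign ⟨params n (4 * k) B (B / 2 ^ k), A⟩ 3 (.bin .div (.var 3) (.const 2))
      have d1 := cost_params_le hX1 hnX (hsmall (4 * k) (by omega)) hBX (hdiv k) hAX
        (.bin .div (.var 3) (.const 2))
      rw [show (Exp.bin .div (.var 3) (.const 2)).value ⟨params n (4 * k) B (B / 2 ^ k), A⟩ =
        B / 2 ^ (k + 1) by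
          simp only [Exp.value, BinOp.apply, params, Nat.div_div_eq_div_mul, pow_succ],
        (params_setVar _ _ _ _ _ _).2.2.2] at f1
      have f2 := Exec.assign ⟨params n (4 * k) B (B / 2 ^ (k + 1)), A⟩ 1 (incr 1 4)
      have d2 := cost_params_le hX1
        hnX (hsmall (4 * k) (by omega)) hBX (hdiv (k + 1)) hAX (incr 1 4)
      rw [show (incr 1 4).value ⟨params n (4 * k) B (B / 2 ^ (k + 1)), A⟩ = 4 * (k + 1) from rfl,
        (params_setVar _ _ _ _ _ _).2.1] at f2
      exact ⟨_, by omega, Exec.seq f1 f2⟩)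
    (by
      simp only [Exp.value, params]
      exact Nat.div_eq_of_lt (Nat.lt_size_self B))
    (fun k hk => cost_params_le hX1
      hnX (hsmall (4 * k) (by omega)) hBX (hdiv k) hAX _)
  rw [Nat.div_eq_of_lt (Nat.lt_size_self B), Nat.mul_zero, pow_zero, Nat.div_one] at e5
  have e6 := Exec.assign ⟨params n (4 * B.size) B 0, A⟩ 1 (incr 1 10)
  have c6 := cost_params_le hX1 hnX (hsmall (4 * B.size) (by omega)) hBX (by simp)
    hAX (d := 0) (incr 1 10)
  rw [show (incr 1 10).value ⟨params n (4 * B.size) B 0, A⟩ = 4 * B.size + 10 from rfl,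
    (params_setVar _ _ _ _ _ _).2.1] at e6
  have e7 := Exec.assign ⟨params n (4 * B.size + 10) B 0, A⟩ 2 capExp
  have c7 := cost_params_le hX1
    hnX (hsmall (4 * B.size + 10) (by omega)) hBX (by simp) hAX (d := 0) capExp
  rw [show capExp.value ⟨params n (4 * B.size + 10) B 0, A⟩ = 1024 * B ^ 4 by
    simp only [Exp.value, capExp, BinOp.apply, params]
    ring, (params_setVar _ _ _ _ _ _).2.2.1] at e7
  rw [hstart]
  refine ⟨_, ?_, Exec.seq e1 (Exec.seq e2 (Exec.seq e3 (Exec.seq e4 (Exec.seq e5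
    (Exec.seq e6 e7)))))⟩
  simp only [setupBound, Polynomial.eval_add, Polynomial.eval_mul, Polynomial.eval_X,
    Polynomial.eval_ofNat, Polynomial.eval_one]
  have h3 := ht3.trans (Nat.add_le_add_right (Nat.mul_le_mul_right _
    (show w.length ≤ X by omega)) _)
  have h5 := ht5.trans (Nat.add_le_add_right (Nat.mul_le_mul_right _ hBX) _)
  omega

end RAM

/-! ### Reasoning about programs -/

namespace RAM

theorem BinOp.eq_apply (a b : ℕ) :
    BinOp.eq.apply a b = open Classical in if a = b then 1 else 0 := by
  by_cases h : a = b <;> simp [apply, h]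

theorem BinOp.lt_apply (a b : ℕ) :
    BinOp.lt.apply a b = open Classical in if a < b then 1 else 0 := by
  by_cases h : a < b <;> simp [apply, h]

theorem BinOp.add_apply (a b : ℕ) : BinOp.add.apply a b = a + b := rfl

theorem BinOp.mul_apply (a b : ℕ) : BinOp.mul.apply a b = a * b := rfl

/-- The arrays that an expression reads. -/
def Exp.reads : Exp → List ℕ
  | .const _ => []
  | .var _ => []
  | .load a i => a :: i.reads
  | .bin _ e f => e.reads ++ f.reads

theorem Exp.value_congr {env : ℕ → ℕ} {A A' : Mem} (e : Exp) (h : ∀ b ∈ e.reads, A b = A' b) :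
    e.value ⟨env, A⟩ = e.value ⟨env, A'⟩ := by
  induction e with
  | const k => rfl
  | var x => rfl
  | load a i ih =>
    simp only [reads, List.mem_cons, forall_eq_or_imp] at h
    simp only [value]
    rw [ih h.2, h.1]
  | bin op e f ihe ihf =>
    simp only [reads, List.mem_append] at h
    simp only [value]
    rw [ihe fun b hb => h b (Or.inl hb), ihf fun b hb => h b (Or.inr hb)]

/-- From every memory that agrees with `A` outside array `a`, the program `p` overwrites the cells
of array `a` in `S` by the values of `g` and changes nothing else. -/
def Marks (p : Stm) (env : ℕ → ℕ) (A : Mem) (a : ℕ) (g : ℕ → ℕ) (S : ℕ → Prop) : Prop :=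
  ∀ A' : Mem, (∀ b, b ≠ a → A' b = A b) → p.run env A' = setOn A' a S g

theorem value_eq_of_agree {env : ℕ → ℕ} {A A' : Mem} {a : ℕ} {e : Exp} (he : a ∉ e.reads)
    (h : ∀ b, b ≠ a → A' b = A b) : e.value ⟨env, A'⟩ = e.value ⟨env, A⟩ :=
  e.value_congr fun b hb => h b (by rintro rfl; exact he hb)

namespace Marks

variable {p q : Stm} {env : ℕ → ℕ} {A : Mem} {a : ℕ} {g : ℕ → ℕ}

theorem loop {x b : ℕ} {S : ℕ → ℕ → Prop}
    (h : ∀ k < env b, Marks p (Function.update env x k) A a g (S k)) :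
    Marks (.loop x b p) env A a g (fun c => ∃ k < env b, S k c) := fun _ hA' =>
  iter_setOn fun k hk B hB => h k hk B fun b hb => (hB b hb).trans (hA' b hb)

theorem store {i e : Exp} (hi : a ∉ i.reads) (he : a ∉ e.reads)
    (hg : g (i.value ⟨env, A⟩) = min (e.value ⟨env, A⟩) (env 2)) :
    Marks (.store a i e) env A a g (fun c => c = i.value ⟨env, A⟩) := fun A' hA' => by
  simp only [Stm.run]
  rw [value_eq_of_agree hi hA', value_eq_of_agree he hA']
  exact setCell_eq_setOn _ _ _ _ _ hg

theorem skip : Marks .skip env A a g (fun _ => False) := fun _ _ => by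
  funext b j
  simp [Stm.run, setOn]

theorem ite {b : Exp} {S S' : ℕ → Prop} (hb : a ∉ b.reads) (hp : Marks p env A a g S)
    (hq : Marks q env A a g S') :
    Marks (.ite b p q) env A a g
      (fun c => (b.value ⟨env, A⟩ ≠ 0 ∧ S c) ∨ (b.value ⟨env, A⟩ = 0 ∧ S' c)) := fun A' hA' => by
  simp only [Stm.run]
  rw [value_eq_of_agree hb hA']
  by_cases h : b.value ⟨env, A⟩ = 0
  · simpa [h] using hq A' hA'
  · simpa [h] using hp A' hA'

theorem run_eq {S : ℕ → Prop} (h : Marks p env A a g S) : p.run env A = setOn A a S g :=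
  h A fun _ _ => rfl

end Marks

/-- From every memory that agrees with `A` outside array `a`, the program `p` adds `g` to array `a`,
cut off at `var 2`, and changes nothing else. -/
def Adds (p : Stm) (env : ℕ → ℕ) (A : Mem) (a : ℕ) (g : ℕ → ℕ) : Prop :=
  ∀ A' : Mem, (∀ b, b ≠ a → A' b = A b) → (∀ j, A' a j ≤ env 2) →
    p.run env A' = addOn (env 2) A' a g

namespace Adds

variable {p : Stm} {env : ℕ → ℕ} {A : Mem} {a : ℕ}

theorem loop {x b : ℕ} {g : ℕ → ℕ → ℕ} (hx : x ≠ 2)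
    (h : ∀ k < env b, Adds p (Function.update env x k) A a (g k)) :
    Adds (.loop x b p) env A a (fun c => ∑ k ∈ Finset.range (env b), g k c) := fun A' hA' hW =>
  iter_addOn hW fun k hk B hB hBW => by
    have h1 := h k hk B (fun b hb => (hB b hb).trans (hA' b hb))
    rw [Function.update_of_ne hx.symm] at h1
    exact h1 hBW

theorem store {i e : Exp} (hi : a ∉ i.reads) (he : a ∉ e.reads) :
    Adds (.store a i (.bin .add (.load a i) e)) env A a
      (fun c => if c = i.value ⟨env, A⟩ then e.value ⟨env, A⟩ else 0) := fun A' hA' hW => by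
  simp only [Stm.run, Exp.value, BinOp.apply]
  rw [value_eq_of_agree hi hA', value_eq_of_agree he hA']
  exact setCell_eq_addOn _ _ _ _ _ hW

theorem run_eq {g : ℕ → ℕ} (h : Adds p env A a g) (hW : ∀ j, A a j ≤ env 2) :
    p.run env A = addOn (env 2) A a g :=
  h A (fun _ _ => rfl) hW

end Adds

/-! ### The program -/

/-!
Matrices are stored row by row, with `var 0 = n` columns. Array `0` holds the input, array `4` the
common denominator of all edge lengths, arrays `5` and `2` the edge lengths and the distances
multiplied by it, and array `12` the scales. Row `i` of array `6` is the hitting set at scale `i`.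
While the hitting set at scale `var 3 + 8` is computed, array `7` holds the pairs of a local
family that are still to be hit and row `v` of array `8` the greedy hitting set for `v`; arrays
`9` and `11` hold counts, and array `10` the vertex chosen next. Array `13` holds the keys, and
array `1` the labels, with distances given by the numerators in array `2` and the denominators in
array `3`.
-/

/-- The index of the entry in row `i` and column `j` of a matrix with `var 0` columns. -/
def ix (i j : Exp) : Exp := .bin .add (.bin .mul i (.var 0)) j

/-- `x ≤ y`. -/
def leExp (x y : Exp) : Exp := .bin .lt x (.bin .add y (.const 1))

/-- Conjunction. -/
def andExp (x y : Exp) : Exp := .bin .mul x y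

/-- The distance, multiplied by the common denominator `denom`. -/
def distExp (i j : Exp) : Exp := .load 2 (ix i j)

/-- The common denominator of the edge lengths. -/
def denom : Exp := .load 4 (.const 0)

/-- `x` lies on the shortest path from `a` to `b`. -/
def onPath (a x b : Exp) : Exp := .bin .eq (.bin .add (distExp a x) (distExp x b)) (distExp a b)

/-- `a * dist(i, j) ≤ b * scale(var 3)`. -/
def withinExp (a b : ℕ) (i j : Exp) : Exp :=
  leExp (.bin .mul (.const a) (distExp i j))
    (.bin .mul (.const b) (.bin .mul denom (.load 12 (.var 3))))

/-- `i = j`, or `ij` is an edge that is a shortest path: the entry of the length matrix is the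
distance. -/
def tightExp (i j : Exp) : Exp := .bin .eq (.load 5 (ix i j)) (distExp i j)

/-- The pair `(var 6, var 7)` of vertices of the hitting set `var 3` belongs to the local family of
`var 4`, with the ends `var 5`, `var 8` of the witness and its vertex `var 9` near `var 4`. -/
def familyExp : Exp :=
  andExp (andExp (.load 6 (ix (.var 3) (.var 6))) (.load 6 (ix (.var 3) (.var 7))))
  (andExp (andExp (withinExp 8 5 (.var 4) (.var 6)) (withinExp 8 5 (.var 4) (.var 7)))
  (andExp (andExp (tightExp (.var 5) (.var 6)) (tightExp (.var 7) (.var 8)))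
  (andExp (.bin .eq (distExp (.var 5) (.var 8))
      (.bin .add (.bin .add (distExp (.var 5) (.var 6)) (distExp (.var 6) (.var 7)))
        (distExp (.var 7) (.var 8))))
  (andExp (.bin .lt (.bin .mul (.const 7) (.bin .mul denom (.load 12 (.var 3))))
      (.bin .mul (.const 32) (distExp (.var 5) (.var 8))))
  (andExp (onPath (.var 5) (.var 9) (.var 8)) (withinExp 16 7 (.var 4) (.var 9)))))))

/-- Write the local family of `var 4` to array `7`. -/
def markFamily : Stm :=
  .seq (.loop 5 0 (.loop 6 0 (.store 7 (ix (.var 5) (.var 6)) (.const 0))))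
    (.loop 5 0 (.loop 6 0 (.loop 7 0 (.loop 8 0 (.loop 9 0
      (.ite familyExp (.store 7 (ix (.var 6) (.var 7)) (.const 1)) .skip))))))

/-- The vertex hitting most members, as computed by `findBest`. -/
def best : Exp := .load 10 (.const 0)

/-- Write to array `9` how many members of the family in array `7` each vertex hits. -/
def countHits : Stm :=
  .seq (.loop 7 0 (.store 9 (.var 7) (.const 0)))
    (.loop 7 0 (.loop 8 0 (.loop 9 0 (.store 9 (.var 7) (.bin .add (.load 9 (.var 7))
      (.bin .mul (.bin .lt (.const 0) (.load 7 (ix (.var 8) (.var 9))))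
        (onPath (.var 8) (.var 7) (.var 9))))))))

/-- Find a vertex with the largest entry of array `9`. -/
def findBest : Stm :=
  .seq (.store 10 (.const 0) (.const 0))
    (.loop 7 0 (.ite (.bin .lt (.load 9 best) (.load 9 (.var 7))) (.store 10 (.const 0) (.var 7))
      .skip))

/-- Add the best vertex to row `var 4` of array `8` and remove the members that it hits. -/
def chooseBest : Stm :=
  .ite (.load 9 best)
    (.seq (.store 8 (ix (.var 4) best) (.const 1))
      (.loop 7 0 (.loop 8 0 (.ite (onPath (.var 7) best (.var 8))
        (.store 7 (ix (.var 7) (.var 8)) (.const 0)) .skip)))) .skip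

/-- One choice of the greedy algorithm. -/
def greedyRound : Stm := .seq countHits (.seq findBest chooseBest)

/-- Write a greedy hitting set of the local family of `var 4` to row `var 4` of array `8`. As the
family has at most `n * n` members, `n * n` choices suffice. -/
def hitFamily : Stm :=
  .seq markFamily (.seq (.loop 5 0 (.store 8 (ix (.var 4) (.var 5)) (.const 0)))
    (.loop 5 0 (.loop 6 0 greedyRound)))

/-- The row of array `6` that holds the hitting set to be computed. -/
def newRow : Exp := .bin .add (.var 3) (.const 8)

/-- The vertex `var 6` lies in the ball around `var 5` in which the hitting set has to be sparse. -/
def inBall : Exp := withinExp 8 3 (.var 5) (.var 6)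

/-- Replace the part of the hitting set in the ball around `var 5` by row `var 5` of array `8` if
that makes it smaller. -/
def improve : Stm :=
  .seq (.seq (.store 11 (.const 0) (.const 0)) (.store 11 (.const 1) (.const 0)))
  (.seq (.loop 6 0 (.store 11 (.const 0) (.bin .add (.load 11 (.const 0))
      (.bin .mul (.bin .lt (.const 0) (.load 6 (ix newRow (.var 6)))) inBall))))
  (.seq (.loop 6 0 (.store 11 (.const 1) (.bin .add (.load 11 (.const 1))
      (.bin .lt (.const 0) (.load 8 (ix (.var 5) (.var 6)))))))
  (.ite (.bin .lt (.load 11 (.const 1)) (.load 11 (.const 0)))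
    (.loop 6 0 (.ite (.load 8 (ix (.var 5) (.var 6))) (.store 6 (ix newRow (.var 6)) (.const 1))
      (.ite inBall (.store 6 (ix newRow (.var 6)) (.const 0)) .skip))) .skip)))

/-- Compute the hitting set eight scales above scale `var 3`: the greedy hitting sets of all local
families, then local search in `n` passes. -/
def level : Stm := .seq (.loop 4 0 hitFamily) (.loop 4 0 (.loop 5 0 improve))

/-! ### The data in the memory -/

open Classical in
/-- The set of vertices in row `i` of array `a`. -/
def rowSet (n : ℕ) (A : Mem) (a i : ℕ) : Finset (Fin n) :=
  Finset.univ.filter fun u => A a (i * n + u) ≠ 0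

open Classical in
/-- The set of pairs in array `a`. -/
def pairSet (n : ℕ) (A : Mem) (a : ℕ) : Finset (Fin n × Fin n) :=
  Finset.univ.filter fun p => A a (p.1 * n + p.2) ≠ 0

theorem rowSet_congr {n : ℕ} {A A' : Mem} {a : ℕ} (h : A a = A' a) (i : ℕ) :
    rowSet n A a i = rowSet n A' a i := by
  simp [rowSet, h]

theorem mem_rowSet {n : ℕ} {A : Mem} {a i : ℕ} {u : Fin n} :
    u ∈ rowSet n A a i ↔ A a (i * n + u) ≠ 0 := by
  simp [rowSet]

theorem mem_pairSet {n : ℕ} {A : Mem} {a : ℕ} {p : Fin n × Fin n} :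
    p ∈ pairSet n A a ↔ A a (p.1 * n + p.2) ≠ 0 := by
  simp [pairSet]

theorem pairSet_congr {n : ℕ} {A A' : Mem} {a : ℕ} (h : A a = A' a) :
    pairSet n A a = pairSet n A' a := by
  simp [pairSet, h]

theorem index_inj {n i i' u u' : ℕ} (hu : u < n) (hu' : u' < n) :
    i * n + u = i' * n + u' ↔ i = i' ∧ u = u' := by
  constructor
  · intro h
    have h1 : (i * n + u) / n = i := by
      rw [mul_comm, Nat.mul_add_div (by omega), Nat.div_eq_of_lt hu, add_zero]
    have h2 : (i' * n + u') / n = i' := by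
      rw [mul_comm, Nat.mul_add_div (by omega), Nat.div_eq_of_lt hu', add_zero]
    have h3 : i = i' := by rw [← h1, ← h2, h]
    subst h3
    exact ⟨rfl, by omega⟩
  · rintro ⟨rfl, rfl⟩
    rfl

theorem sum_range_indicator {n : ℕ} {f : ℕ → ℕ} {S : Finset (Fin n)}
    (h : ∀ u : Fin n, f u = if u ∈ S then 1 else 0) : ∑ k ∈ Finset.range n, f k = S.card := by
  rw [Finset.sum_range, Finset.sum_congr rfl fun u _ => h u]
  simp

theorem sum_range_range_indicator {n : ℕ} {f : ℕ → ℕ → ℕ} {S : Finset (Fin n × Fin n)}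
    (h : ∀ a b : Fin n, f a b = if (a, b) ∈ S then 1 else 0) :
    ∑ a ∈ Finset.range n, ∑ b ∈ Finset.range n, f a b = S.card := by
  rw [Finset.sum_range, Finset.sum_congr rfl fun a _ => Finset.sum_range _,
    ← Fintype.sum_prod_type', Finset.sum_congr rfl fun p _ => h p.1 p.2]
  simp

/-- The arrays hold the common denominator, the distances, the edges that are shortest paths and the
scales. -/
structure DistMem {n : ℕ} (G : Network (Fin n)) (J : ℕ) (A : Mem) : Prop where
  pos : 0 < A 4 0
  dist (u v : Fin n) : (A 2 (u * n + v) : ℝ) = A 4 0 * G.dist u v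
  tight (u v : Fin n) : A 5 (u * n + v) = A 2 (u * n + v) ↔ G.Tight u v
  scale (i : ℕ) (hi : i < J) : A 12 i = Network.scale i

namespace DistMem

variable {n J : ℕ} {G : Network (Fin n)} {A : Mem}

theorem congr {A' : Mem} (h : DistMem G J A) (h2 : A' 2 = A 2) (h4 : A' 4 = A 4) (h5 : A' 5 = A 5)
    (h12 : A' 12 = A 12) : DistMem G J A' where
  pos := by rw [h4]; exact h.pos
  dist u v := by rw [h4, h2]; exact h.dist u v
  tight u v := by rw [h5, h2]; exact h.tight u v
  scale i hi := by rw [h12]; exact h.scale i hi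

theorem add_eq_iff (h : DistMem G J A) (a x b : Fin n) :
    A 2 (a * n + x) + A 2 (x * n + b) = A 2 (a * n + b) ↔ Between G.dist a x b := by
  have hpos : (0 : ℝ) < A 4 0 := by exact_mod_cast h.pos
  rw [← Nat.cast_inj (R := ℝ), Nat.cast_add, h.dist, h.dist, h.dist, ← mul_add,
    mul_right_inj' hpos.ne']
  rfl

theorem add_add_eq_iff (h : DistMem G J A) (a' a b b' : Fin n) :
    A 2 (a' * n + b') = A 2 (a' * n + a) + A 2 (a * n + b) + A 2 (b * n + b') ↔
      G.dist a' b' = G.dist a' a + G.dist a b + G.dist b b' := by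
  have hpos : (0 : ℝ) < A 4 0 := by exact_mod_cast h.pos
  rw [← Nat.cast_inj (R := ℝ), Nat.cast_add, Nat.cast_add, h.dist, h.dist, h.dist, h.dist,
    ← mul_add, ← mul_add, mul_right_inj' hpos.ne']

theorem within_iff (h : DistMem G J A) {j : ℕ} (hj : j < J) {p q : ℕ} (hp : 0 < p)
    (u v : Fin n) : p * A 2 (u * n + v) ≤ q * (A 4 0 * A 12 j) ↔
      G.dist u v ≤ 4 * q / p * Network.radius (j + 8) := by
  have hpos : (0 : ℝ) < A 4 0 := by exact_mod_cast h.pos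
  have hp' : (0 : ℝ) < p := by exact_mod_cast hp
  rw [← Nat.cast_le (α := ℝ), Nat.cast_mul, Nat.cast_mul, Nat.cast_mul, h.dist, h.scale j hj]
  have h1 := Network.radius_add_eight j
  have h2 : (Network.scale j : ℝ) = 4 * Network.radius (j + 8) := by
    unfold Network.radius at h1 ⊢
    linarith
  rw [h2, show (p : ℝ) * (A 4 0 * G.dist u v) = A 4 0 * (p * G.dist u v) by ring,
    show (q : ℝ) * (A 4 0 * (4 * Network.radius (j + 8))) =
      A 4 0 * (4 * q * Network.radius (j + 8)) by ring, mul_le_mul_iff_right₀ hpos,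
    div_mul_eq_mul_div, le_div_iff₀ hp', mul_comm (p : ℝ)]

end DistMem

/-! ### The local families and their greedy hitting sets -/

section

variable {n J j : ℕ} {G : Network (Fin n)} {A : Mem} {env : ℕ → ℕ}

theorem onPath_value {a x b : Exp} {a' x' b' : Fin n} (hD : DistMem G J A) (h0 : env 0 = n)
    (ha : a.value ⟨env, A⟩ = a') (hx : x.value ⟨env, A⟩ = x') (hb : b.value ⟨env, A⟩ = b') :
    (onPath a x b).value ⟨env, A⟩ =
      (open Classical in if Between G.dist a' x' b' then 1 else 0) := by
  simp only [onPath, distExp, ix, Exp.value, BinOp.eq_apply, BinOp.add_apply, BinOp.mul_apply, ha,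
    hx, hb, h0]
  by_cases h : Between G.dist a' x' b'
  · rw [if_pos h, if_pos ((hD.add_eq_iff a' x' b').2 h)]
  · rw [if_neg h, if_neg (mt (hD.add_eq_iff a' x' b').1 h)]

theorem withinExp_value {u v : Exp} {u' v' : Fin n} {p q : ℕ} (hp : 0 < p) (hD : DistMem G J A)
    (h0 : env 0 = n) (h3 : env 3 = j) (hj : j < J)
    (hu : u.value ⟨env, A⟩ = u') (hv : v.value ⟨env, A⟩ = v') :
    (withinExp p q u v).value ⟨env, A⟩ = (open Classical in
      if G.dist u' v' ≤ 4 * q / p * Network.radius (j + 8) then 1 else 0) := by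
  simp only [withinExp, leExp, denom, distExp, ix, Exp.value, BinOp.lt_apply,
    BinOp.add_apply, BinOp.mul_apply, hu, hv, h0, h3,
    Nat.lt_succ_iff, hD.within_iff hj hp]

theorem familyExp_value {v a' a b b' w : Fin n} (hD : DistMem G J A) (h0 : env 0 = n)
    (h3 : env 3 = j) (hj : j < J) (h4 : env 4 = v) (h5 : env 5 = a') (h6 : env 6 = a)
    (h7 : env 7 = b) (h8 : env 8 = b') (h9 : env 9 = w) :
    familyExp.value ⟨env, A⟩ ≠ 0 ↔ (a ∈ rowSet n A 6 j ∧ b ∈ rowSet n A 6 j ∧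
      G.dist v a ≤ 5 / 2 * Network.radius (j + 8) ∧
      G.dist v b ≤ 5 / 2 * Network.radius (j + 8) ∧
      Significant G.dist G.Tight (7 / 8 * Network.radius (j + 8)) a' a b b' ∧
      Between G.dist a' w b' ∧ G.dist v w ≤ 7 / 4 * Network.radius (j + 8)) := by
  have e1 := withinExp_value (p := 8) (q := 5) (u := .var 4) (v := .var 6) (by norm_num)
    hD h0 h3 hj h4 h6
  have e2 := withinExp_value (p := 8) (q := 5) (u := .var 4) (v := .var 7) (by norm_num)
    hD h0 h3 hj h4 h7
  have e3 := withinExp_value (p := 16) (q := 7) (u := .var 4) (v := .var 9) (by norm_num)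
    hD h0 h3 hj h4 h9
  have e4 := onPath_value (a := .var 5) (x := .var 9) (b := .var 8) hD h0 h5 h9 h8
  have e5 : (7 * (A 4 0 * A 12 j) < 32 * A 2 (a' * n + b')) ↔
      7 / 8 * Network.radius (j + 8) < G.dist a' b' := by
    have := hD.within_iff hj (p := 32) (q := 7) (by norm_num) a' b'
    rw [← not_le, this, not_le]
    norm_num
  simp only [familyExp, andExp, tightExp, distExp, ix, denom, Exp.value,
    BinOp.eq_apply, BinOp.lt_apply, BinOp.add_apply, BinOp.mul_apply, e1, e2, e3, e4,
    h0, h3, h5, h6, h7, h8, hD.tight, hD.add_add_eq_iff, e5, mul_ne_zero_iff, mem_rowSet,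
    Significant, ne_eq, ite_eq_right_iff, one_ne_zero, imp_false, not_not]
  norm_num
  tauto

theorem run_markFamily (v : Fin n) (hD : DistMem G J A) (h0 : env 0 = n) (h2 : 1 ≤ env 2)
    (h3 : env 3 = j) (hj : j < J) (h4 : env 4 = v) :
    pairSet n (markFamily.run env A) 7 =
      localFamily G.dist G.Tight (Network.radius (j + 8)) (rowSet n A 6 j) v := by
  have hclear : Marks (.loop 5 0 (.loop 6 0 (.store 7 (ix (.var 5) (.var 6)) (.const 0)))) env A 7
      (fun _ => 0) _ := Marks.loop fun k hk => Marks.loop fun l hl =>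
    Marks.store (by decide) (by decide) (by simp [Exp.value])
  set A₁ := Stm.run (.loop 5 0 (.loop 6 0 (.store 7 (ix (.var 5) (.var 6)) (.const 0)))) env A
    with hA₁
  have hA₁b : ∀ b, b ≠ 7 → A₁ b = A b := fun b hb => by
    rw [hA₁, hclear.run_eq, setOn_of_ne hb]
  have hA₁7 : ∀ a b : Fin n, A₁ 7 (a * n + b) = 0 := by
    intro a b
    rw [hA₁, hclear.run_eq, setOn, if_pos]
    refine ⟨rfl, a, by rw [h0]; exact a.2, b, ?_, ?_⟩
    · rw [Function.update_of_ne (by decide), h0]; exact b.2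
    · simp [ix, Exp.value, BinOp.apply, h0]
  have hD₁ : DistMem G J A₁ := hD.congr (hA₁b 2 (by decide)) (hA₁b 4 (by decide))
    (hA₁b 5 (by decide)) (hA₁b 12 (by decide))
  have hrow : rowSet n A₁ 6 j = rowSet n A 6 j := rowSet_congr (hA₁b 6 (by decide)) j
  have hmark : Marks (.loop 5 0 (.loop 6 0 (.loop 7 0 (.loop 8 0 (.loop 9 0
      (.ite familyExp (.store 7 (ix (.var 6) (.var 7)) (.const 1)) .skip)))))) env A₁ 7
      (fun _ => 1) _ := Marks.loop fun _ _ => Marks.loop fun _ _ => Marks.loop fun _ _ =>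
    Marks.loop fun _ _ => Marks.loop fun _ _ => Marks.ite (by decide)
      (Marks.store (by decide) (by decide)
        (by simpa [Exp.value, Function.update_apply] using h2)) Marks.skip
  ext ⟨a, b⟩
  rw [mem_pairSet, markFamily, Stm.run, ← hA₁, hmark.run_eq]
  simp only [setOn, true_and, hA₁7, localFamily, Finset.mem_filter, Finset.mem_univ]
  simp only [ne_eq, ite_eq_right_iff, one_ne_zero, imp_false, not_not, Function.update_apply, h0,
    and_false, or_false, if_false, OfNat.zero_ne_ofNat]
  have hval : ∀ a' a b b' w : Fin n, _ := fun a' a b b' w =>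
    familyExp_value (env := Function.update (Function.update (Function.update (Function.update
      (Function.update env 5 a') 6 a) 7 b) 8 b') 9 w) (v := v) (a' := a') (a := a) (b := b)
      (b' := b') (w := w) hD₁ (by simp [h0])
      (by simp [h3]) hj (by simp [h4])
      (by simp) (by simp)
      (by simp) (by simp)
      (by simp)
  constructor
  · rintro ⟨a', ha', a₁, ha₁, b₁, hb₁, b', hb', w, hw, hne, heq⟩
    simp only [ix, Exp.value, BinOp.apply, Function.update_apply, h0] at heq
    norm_num at heq
    obtain ⟨h5, h6⟩ := (index_inj b.2 hb₁).1 heq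
    subst h5 h6
    have := (hval ⟨a', ha'⟩ a b ⟨b', hb'⟩ ⟨w, hw⟩).1 hne
    rw [hrow] at this
    obtain ⟨g1, g2, g3, g4, g5, g6, g7⟩ := this
    exact ⟨g1, g2, g3, g4, _, _, _, g5, g6, g7⟩
  · rintro ⟨g1, g2, g3, g4, a', b', w, g5, g6, g7⟩
    refine ⟨a', a'.2, a, a.2, b, b.2, b', b'.2, w, w.2, ?_, ?_⟩
    · refine (hval a' a b b' w).2 ?_
      rw [hrow]
      exact ⟨g1, g2, g3, g4, g5, g6, g7⟩
    · simp [ix, Exp.value, BinOp.apply, h0]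

/-- Programs do not write values above `var 2`. -/
theorem Stm.run_le (p : Stm) {A : Mem} {env : ℕ → ℕ} {lo : ℕ} (hlo : 3 ≤ lo)
    (hp : p.WellFormed lo) (hA : ∀ b i, A b i ≤ env 2) (b i : ℕ) : p.run env A b i ≤ env 2 := by
  induction p generalizing env A lo b i with
  | skip => exact hA b i
  | store a i' e =>
    simp only [run, setCell]
    split_ifs
    · exact min_le_right _ _
    · exact hA b i
  | seq p q ihp ihq => exact ihq hlo hp.2 (ihp hlo hp.1 hA) b i
  | ite c p q ihp ihq =>
    simp only [run]
    split_ifs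
    · exact ihp hlo hp.1 hA b i
    · exact ihq hlo hp.2 hA b i
  | loop x c p ih =>
    simp only [run]
    obtain ⟨hx, -, hp⟩ := hp
    refine iter_induct (fun _ (B : Mem) => ∀ b i, B b i ≤ env 2) hA (fun k _ B hB b i => ?_) b i
    have h2 : Function.update env x k 2 = env 2 := Function.update_of_ne (by omega) _ _
    rw [← h2] at hB ⊢
    exact ih (lo := x + 1) (by omega) hp hB b i

open Classical in
theorem run_countHits (hD : DistMem G J A) (hA : ∀ b i, A b i ≤ env 2) (h0 : env 0 = n)
    (h2 : n * n ≤ env 2) (x : Fin n) :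
    countHits.run env A 9 x =
      ((pairSet n A 7).filter fun c => Between G.dist c.1 x c.2).card := by
  have hclear : Marks (.loop 7 0 (.store 9 (.var 7) (.const 0))) env A 9 (fun _ => 0) _ :=
    Marks.loop fun k hk => Marks.store (by decide) (by decide) (by simp [Exp.value])
  set A₁ := Stm.run (.loop 7 0 (.store 9 (.var 7) (.const 0))) env A with hA₁
  have hA₁b : ∀ b, b ≠ 9 → A₁ b = A b := fun b hb => by
    rw [hA₁, hclear.run_eq, setOn_of_ne hb]
  have hA₁9 : A₁ 9 x = 0 := by
    rw [hA₁, hclear.run_eq, setOn, if_pos]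
    exact ⟨rfl, x, by rw [h0]; exact x.2, by simp [Exp.value]⟩
  have hA₁le : ∀ b i, A₁ b i ≤ env 2 := Stm.run_le _ (lo := 3) le_rfl (by simp [Stm.WellFormed]) hA
  have hD₁ : DistMem G J A₁ := hD.congr (hA₁b 2 (by decide)) (hA₁b 4 (by decide))
    (hA₁b 5 (by decide)) (hA₁b 12 (by decide))
  have hadd : Adds (.loop 7 0 (.loop 8 0 (.loop 9 0 (.store 9 (.var 7) (.bin .add
      (.load 9 (.var 7)) (.bin .mul (.bin .lt (.const 0) (.load 7 (ix (.var 8) (.var 9))))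
        (onPath (.var 8) (.var 7) (.var 9)))))))) env A₁ 9 _ :=
    Adds.loop (by decide) fun _ _ => Adds.loop (by decide) fun _ _ => Adds.loop (by decide)
      fun _ _ => Adds.store (by decide) (by decide)
  rw [countHits, Stm.run, ← hA₁, hadd.run_eq (hA₁le 9), ← pairSet_congr (hA₁b 7 (by decide))]
  simp only [addOn, if_true, hA₁9, zero_add]
  have hsum : ∀ k : Fin n, ∑ a ∈ Finset.range (Function.update env 7 (k : ℕ) 0),
      ∑ b ∈ Finset.range (Function.update (Function.update env 7 (k : ℕ)) 8 a 0),
        (if (x : ℕ) = (Exp.var 7).value ⟨Function.update (Function.update (Function.update env 7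
          (k : ℕ)) 8 a) 9 b, A₁⟩ then (Exp.bin .mul (.bin .lt (.const 0)
          (.load 7 (ix (.var 8) (.var 9)))) (onPath (.var 8) (.var 7) (.var 9))).value
          ⟨Function.update (Function.update (Function.update env 7 (k : ℕ)) 8 a) 9 b, A₁⟩ else 0) =
      if x = k then ((pairSet n A₁ 7).filter fun c => Between G.dist c.1 x c.2).card else 0 := by
    intro k
    by_cases hk : x = k
    · subst hk
      simp only [Function.update_apply, h0, if_true, OfNat.zero_ne_ofNat, if_false]
      refine sum_range_range_indicator fun a b => ?_
      have h1 := onPath_value (a := .var 8) (x := .var 7) (b := .var 9) (a' := a) (x' := x)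
        (b' := b) (env := Function.update (Function.update (Function.update env 7 (x : ℕ)) 8
          (a : ℕ)) 9 (b : ℕ)) hD₁ (by simp [h0]) (by simp [Exp.value]) (by simp [Exp.value])
          (by simp [Exp.value])
      rw [if_pos (by simp [Exp.value]), Exp.value, h1]
      by_cases h2 : A₁ 7 (a * n + b) = 0 <;> by_cases h3 : Between G.dist a x b <;>
        simp [Exp.value, BinOp.apply, ix, h0, mem_pairSet, h2, h3, Nat.pos_iff_ne_zero]
    · have hk' : (x : ℕ) ≠ k := fun h => hk (Fin.ext h)
      simp [Exp.value, hk, hk']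
  rw [h0, Finset.sum_range, Finset.sum_congr rfl fun k _ => hsum k, Finset.sum_ite_eq,
    if_pos (Finset.mem_univ _)]
  refine min_eq_right ((Finset.card_le_univ _).trans ?_)
  simpa using h2

theorem run_findBest (h0 : env 0 = n) (hn : 0 < n) (h2 : n ≤ env 2) :
    findBest.run env A 10 0 < n ∧ ∀ y < n, A 9 y ≤ A 9 (findBest.run env A 10 0) := by
  have key : ∀ m ≤ n, ∀ B : Mem, B = iter (fun k => Stm.run
      (.ite (.bin .lt (.load 9 best) (.load 9 (.var 7))) (.store 10 (.const 0) (.var 7)) .skip)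
      (Function.update env 7 k)) (Stm.run (.store 10 (.const 0) (.const 0)) env A) m →
      B 9 = A 9 ∧ B 10 0 < n ∧ ∀ y < m, A 9 y ≤ A 9 (B 10 0) := by
    rintro m hm B rfl
    refine iter_induct (fun m (B : Mem) => B 9 = A 9 ∧ B 10 0 < n ∧ ∀ y < m, A 9 y ≤ A 9 (B 10 0))
      ⟨Stm.run_frame _ _ _ (by decide), ?_, fun y hy => absurd hy (by omega)⟩ ?_
    · simpa [Stm.run, setCell, Exp.value] using hn
    · rintro k hk B ⟨h9, hlt, hmax⟩
      refine ⟨(Stm.run_frame _ _ _ (by decide)).trans h9, ?_⟩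
      have hcond : (Exp.bin .lt (.load 9 best) (.load 9 (.var 7))).value
          ⟨Function.update env 7 k, B⟩ ≠ 0 ↔ A 9 (B 10 0) < A 9 k := by
        simp [Exp.value, best, BinOp.apply, h9]
      by_cases hc : A 9 (B 10 0) < A 9 k
      · have hB : Stm.run (.ite (.bin .lt (.load 9 best) (.load 9 (.var 7)))
            (.store 10 (.const 0) (.var 7)) .skip) (Function.update env 7 k) B 10 0 = k := by
          have hkW : k ≤ env 2 := by omega
          rw [Stm.run, if_pos (hcond.2 hc)]
          simp [Stm.run, setCell, Exp.value, hkW]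
        rw [hB]
        refine ⟨by omega, fun y hy => ?_⟩
        rcases Nat.lt_succ_iff_lt_or_eq.1 hy with h | rfl
        · exact (hmax y h).trans hc.le
        · exact le_rfl
      · rw [Stm.run, if_neg (mt hcond.1 hc), Stm.run]
        refine ⟨hlt, fun y hy => ?_⟩
        rcases Nat.lt_succ_iff_lt_or_eq.1 hy with h | rfl
        · exact hmax y h
        · exact not_lt.1 hc
  have := key n le_rfl _ rfl
  simp only [findBest, Stm.run, h0]
  exact this.2

open Classical in
/-- A round of the greedy algorithm changes nothing if there is nothing left to hit; otherwise it
adds a vertex that hits the most members. -/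
theorem run_greedyRound (hD : DistMem G J A) (hA : ∀ b i, A b i ≤ env 2) (h0 : env 0 = n)
    (hn : 0 < n) (h2 : n * n ≤ env 2) {v : Fin n} (h4 : env 4 = v) :
    let on := fun (x : Fin n) (c : Fin n × Fin n) => Between G.dist c.1 x c.2
    let B := greedyRound.run env A
    ((∀ c ∈ pairSet n A 7, ∀ x, ¬ on x c) → pairSet n B 7 = pairSet n A 7 ∧ B 8 = A 8) ∧
    ((∃ c ∈ pairSet n A 7, ∃ x, on x c) → ∃ x, (∃ c ∈ pairSet n A 7, on x c) ∧
      (∀ y, ((pairSet n A 7).filter (on y)).card ≤ ((pairSet n A 7).filter (on x)).card) ∧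
      pairSet n B 7 = (pairSet n A 7).filter (fun c => ¬ on x c) ∧
      rowSet n B 8 v = insert x (rowSet n A 8 v) ∧
      ∀ w, w ≠ v → rowSet n B 8 w = rowSet n A 8 w) := by
  intro on B
  have hn2 : n ≤ env 2 := (Nat.le_mul_self n).trans h2
  set A₁ := countHits.run env A with hA₁
  set A₂ := findBest.run env A₁ with hA₂
  have f1 : ∀ b, b ≠ 9 → A₁ b = A b := fun b hb => Stm.run_frame _ _ _ (by
    simpa [countHits, Stm.writes] using hb)
  have f2 : ∀ b, b ≠ 10 → A₂ b = A₁ b := fun b hb => Stm.run_frame _ _ _ (by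
    simpa [findBest, Stm.writes] using hb)
  obtain ⟨hbest, hmax⟩ := run_findBest (A := A₁) h0 hn hn2
  rw [← hA₂] at hbest hmax
  set x : Fin n := ⟨A₂ 10 0, hbest⟩ with hx
  have hcount := run_countHits hD hA h0 h2
  rw [← hA₁] at hcount
  have hcx : A₂ 9 (A₂ 10 0) = ((pairSet n A 7).filter (on x)).card := by
    rw [f2 9 (by decide)]
    exact hcount x
  have hD₂ : DistMem G J A₂ := hD.congr (by rw [f2 2, f1 2] <;> decide)
    (by rw [f2 4, f1 4] <;> decide) (by rw [f2 5, f1 5] <;> decide)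
    (by rw [f2 12, f1 12] <;> decide)
  have h7 : A₂ 7 = A 7 := by rw [f2 7, f1 7] <;> decide
  have h8 : A₂ 8 = A 8 := by rw [f2 8, f1 8] <;> decide
  have hmaxcard : ∀ y, ((pairSet n A 7).filter (on y)).card ≤
      ((pairSet n A 7).filter (on x)).card := by
    intro y
    have := hmax y y.2
    have h5 := hcount x
    rw [hcount y] at this
    exact this.trans_eq h5
  have hB : B = chooseBest.run env A₂ := rfl
  constructor
  · intro hnone
    have hzero : A₂ 9 (A₂ 10 0) = 0 := by
      rw [hcx, Finset.card_eq_zero]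
      exact Finset.filter_false_of_mem fun c hc => hnone c hc x
    have : B = A₂ := by
      rw [hB]
      simp [chooseBest, Stm.run, Exp.value, best, hzero]
    rw [this]
    exact ⟨pairSet_congr h7, h8⟩
  · rintro ⟨c, hc, y, hy⟩
    have hpos : 0 < ((pairSet n A 7).filter (on x)).card :=
      lt_of_lt_of_le (Finset.card_pos.2 ⟨c, Finset.mem_filter.2 ⟨hc, hy⟩⟩) (hmaxcard y)
    obtain ⟨c', hc'⟩ := Finset.card_pos.1 hpos
    refine ⟨x, ⟨c', (Finset.mem_filter.1 hc').1, (Finset.mem_filter.1 hc').2⟩, hmaxcard, ?_⟩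
    set A₃ := Stm.run (.store 8 (ix (.var 4) best) (.const 1)) env A₂ with hA₃
    have hA₃b : ∀ b, b ≠ 8 → A₃ b = A₂ b := fun b hb => Stm.run_frame _ _ _ (by
      simpa [Stm.writes] using hb)
    have hA₃8 : ∀ i, A₃ 8 i = if i = v * n + x then 1 else A₂ 8 i := by
      intro i
      have h1 : min 1 (env 2) = 1 := min_eq_left (by omega)
      simp [hA₃, Stm.run, setCell, Exp.value, BinOp.apply, ix, best, h0, h4, hx, h1]
    have hB' : B = Stm.run (.loop 7 0 (.loop 8 0 (.ite (onPath (.var 7) best (.var 8))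
        (.store 7 (ix (.var 7) (.var 8)) (.const 0)) .skip))) env A₃ := by
      rw [hB, chooseBest, Stm.run, if_pos]
      · rfl
      · simp only [Exp.value, best]
        rw [hcx]
        exact hpos.ne'
    have hD₃ : DistMem G J A₃ := hD₂.congr (hA₃b 2 (by decide)) (hA₃b 4 (by decide))
      (hA₃b 5 (by decide)) (hA₃b 12 (by decide))
    have hmark : Marks (.loop 7 0 (.loop 8 0 (.ite (onPath (.var 7) best (.var 8))
        (.store 7 (ix (.var 7) (.var 8)) (.const 0)) .skip))) env A₃ 7 (fun _ => 0) _ :=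
      Marks.loop fun _ _ => Marks.loop fun _ _ => Marks.ite (by decide)
        (Marks.store (by decide) (by decide) (by simp [Exp.value])) Marks.skip
    have hB8 : B 8 = A₃ 8 := by
      rw [hB']
      exact Stm.run_frame _ _ _ (by decide)
    have hval : ∀ a b : Fin n, (onPath (.var 7) best (.var 8)).value
        ⟨Function.update (Function.update env 7 (a : ℕ)) 8 (b : ℕ), A₃⟩ ≠ 0 ↔ on x (a, b) := by
      intro a b
      rw [onPath_value (a' := a) (x' := x) (b' := b) hD₃ (by simp [h0]) (by simp [Exp.value])
        (by simp [Exp.value, best, hA₃b 10 (by decide), hx]) (by simp [Exp.value])]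
      simp [on]
    refine ⟨?_, ?_, fun w hw => ?_⟩
    · ext ⟨a, b⟩
      rw [mem_pairSet, hB', hmark.run_eq, Finset.mem_filter, mem_pairSet, ← h7,
        ← hA₃b 7 (by decide)]
      simp only [setOn, true_and, and_false, or_false, h0, Function.update_of_ne
        (show (0 : ℕ) ≠ 7 by decide)]
      by_cases hon : on x (a, b)
      · rw [if_pos]
        · simp [hon]
        · refine ⟨a, a.2, b, b.2, (hval a b).2 hon, ?_⟩
          simp [ix, Exp.value, BinOp.apply, h0]
      · rw [if_neg]
        · simp [hon]
        · rintro ⟨a₁, ha₁, b₁, hb₁, h5, h6⟩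
          simp only [ix, Exp.value, BinOp.apply, Function.update_apply, h0] at h6
          norm_num at h6
          obtain ⟨h7', h8'⟩ := (index_inj b.2 hb₁).1 h6
          subst h7' h8'
          exact hon ((hval a b).1 h5)
    · ext u
      rw [Finset.mem_insert, mem_rowSet, mem_rowSet, hB8, hA₃8, h8]
      by_cases hu : u = x
      · simp [hu]
      · rw [if_neg]
        · simp [hu]
        · intro h
          exact hu (Fin.ext ((index_inj u.2 x.2).1 h).2)
    · ext u
      rw [mem_rowSet, mem_rowSet, hB8, hA₃8, h8, if_neg]
      intro h
      exact hw (Fin.ext ((index_inj u.2 x.2).1 h).1)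

/-- The greedy loop: every round with a member left to hit removes one, and there are at most
`n * n` members. -/
theorem run_hitFamily (hg : IsGeodesicMetric G.dist G.Tight) (hD : DistMem G J A)
    (hA : ∀ b i, A b i ≤ env 2) (h0 : env 0 = n) (hn : 0 < n) (h2 : n * n ≤ env 2)
    (h3 : env 3 = j) (hj : j < J) {v : Fin n} (h4 : env 4 = v) {h : ℕ}
    (hopt : ∃ O : Finset (Fin n), O.card ≤ h ∧
      ∀ c ∈ localFamily G.dist G.Tight (Network.radius (j + 8)) (rowSet n A 6 j) v,
        ∃ x ∈ O, Between G.dist c.1 x c.2) :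
    (∃ t alive, GreedyState (fun x c => Between G.dist c.1 x c.2) h
      (localFamily G.dist G.Tight (Network.radius (j + 8)) (rowSet n A 6 j) v) alive
      (rowSet n (hitFamily.run env A) 8 v) t) ∧
    (∀ c ∈ localFamily G.dist G.Tight (Network.radius (j + 8)) (rowSet n A 6 j) v,
      ∃ x ∈ rowSet n (hitFamily.run env A) 8 v, Between G.dist c.1 x c.2) ∧
    (∀ w, w ≠ v → rowSet n (hitFamily.run env A) 8 w = rowSet n A 8 w) := by
  classical
  set F := localFamily G.dist G.Tight (Network.radius (j + 8)) (rowSet n A 6 j) v with hF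
  set on := fun (x : Fin n) (c : Fin n × Fin n) => Between G.dist c.1 x c.2 with hon
  set A₁ := markFamily.run env A with hA₁
  have hn2 : 1 ≤ env 2 := le_trans (Nat.mul_pos hn hn) h2
  have f1 : ∀ b, b ≠ 7 → A₁ b = A b := fun b hb => Stm.run_frame _ _ _ (by
    simpa [markFamily, Stm.writes] using hb)
  have hA₁le : ∀ b i, A₁ b i ≤ env 2 :=
    Stm.run_le _ (lo := 3) le_rfl (by simp [markFamily, Stm.WellFormed]) hA
  have hp₁ : pairSet n A₁ 7 = F := run_markFamily v hD h0 hn2 h3 hj h4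
  set clear : Stm := .loop 5 0 (.store 8 (ix (.var 4) (.var 5)) (.const 0)) with hclear
  set A₂ := clear.run env A₁ with hA₂
  have f2 : ∀ b, b ≠ 8 → A₂ b = A₁ b := fun b hb => Stm.run_frame _ _ _ (by
    simpa [hclear, Stm.writes] using hb)
  have hA₂le : ∀ b i, A₂ b i ≤ env 2 :=
    Stm.run_le _ (lo := 3) le_rfl (by simp [hclear, Stm.WellFormed]) hA₁le
  have hmark : Marks clear env A₁ 8 (fun _ => 0) _ :=
    Marks.loop fun k hk => Marks.store (by decide) (by decide) (by simp [Exp.value])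
  have hrow₂ : rowSet n A₂ 8 v = ∅ := by
    refine Finset.eq_empty_of_forall_notMem fun u hu => ?_
    rw [mem_rowSet, hA₂, hmark.run_eq, setOn, if_pos] at hu
    · exact hu rfl
    · exact ⟨rfl, u, by rw [h0]; exact u.2, by simp [ix, Exp.value, BinOp.apply, h0, h4]⟩
  have hrow₂' : ∀ w, w ≠ v → rowSet n A₂ 8 w = rowSet n A 8 w := by
    intro w hw
    ext u
    rw [mem_rowSet, mem_rowSet, hA₂, hmark.run_eq, setOn, if_neg, f1 8 (by decide)]
    rintro ⟨-, k, hk, h5⟩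
    simp only [ix, Exp.value, BinOp.apply, Function.update_apply, h0, h4] at h5
    norm_num at h5
    rw [h0] at hk
    exact hw (Fin.ext ((index_inj u.2 hk).1 h5).1)
  have hD₂ : DistMem G J A₂ := hD.congr (by rw [f2 2, f1 2] <;> decide)
    (by rw [f2 4, f1 4] <;> decide) (by rw [f2 5, f1 5] <;> decide)
    (by rw [f2 12, f1 12] <;> decide)
  let I : ℕ → Mem → Prop := fun m B => DistMem G J B ∧ (∀ b i, B b i ≤ env 2) ∧
    (∃ t, GreedyState on h F (pairSet n B 7) (rowSet n B 8 v) t) ∧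
    (pairSet n B 7).card ≤ n * n - m ∧ ∀ w, w ≠ v → rowSet n B 8 w = rowSet n A 8 w
  have hinit : I 0 A₂ := by
    refine ⟨hD₂, hA₂le, ⟨0, ?_⟩, ?_, hrow₂'⟩
    · rw [hrow₂, pairSet_congr (f2 7 (by decide)), hp₁]
      exact GreedyState.init on h F
    · exact (Finset.card_le_univ _).trans (by simp)
  have hround : ∀ (m : ℕ) (B : Mem) (env' : ℕ → ℕ), I m B → env' 0 = n → env' 4 = v →
      env' 2 = env 2 → I (m + 1) (greedyRound.run env' B) := by
    rintro m B env' ⟨hDB, hBle, ⟨t, hs⟩, hcard, hrows⟩ h0' h4' h2'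
    have g1 : ∀ b, b ∉ [9, 10, 8, 7] → greedyRound.run env' B b = B b := fun b hb =>
      Stm.run_frame _ _ _ (by
        simp only [greedyRound, countHits, findBest, chooseBest, Stm.writes, List.mem_append,
          List.mem_cons, List.not_mem_nil, or_false, not_or] at hb ⊢
        tauto)
    have hDB' : DistMem G J (greedyRound.run env' B) := hDB.congr (g1 2 (by decide))
      (g1 4 (by decide)) (g1 5 (by decide)) (g1 12 (by decide))
    have hle' : ∀ b i, greedyRound.run env' B b i ≤ env 2 := by
      rw [← h2'] at hBle ⊢
      exact Stm.run_le _ (lo := 7) (by omega)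
        (by simp [greedyRound, countHits, findBest, chooseBest, Stm.WellFormed]) hBle
    obtain ⟨hnone, hsome⟩ := run_greedyRound hDB (h2' ▸ hBle) h0' hn (h2' ▸ h2) h4'
    by_cases hex : ∃ c ∈ pairSet n B 7, ∃ x, on x c
    · obtain ⟨x, ⟨c, hc, hxc⟩, hmax, e1, e2, e3⟩ := hsome hex
      have hstep := hs.step ⟨c, hc⟩ hopt (x := x) (fun y => by convert hmax y)
      refine ⟨hDB', hle', ⟨t + 1, ?_⟩, ?_, fun w hw => (e3 w hw).trans (hrows w hw)⟩
      · rw [e1, e2]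
        convert hstep
      · rw [e1]
        have h5 : ((pairSet n B 7).filter fun c => ¬ on x c).card < (pairSet n B 7).card :=
          Finset.card_lt_card (Finset.filter_ssubset.2 ⟨c, hc, not_not.2 hxc⟩)
        convert (show ((pairSet n B 7).filter fun c => ¬ on x c).card ≤ n * n - (m + 1) by omega)
    · push Not at hex
      obtain ⟨e1, e2⟩ := hnone hex
      have hempty : pairSet n B 7 = ∅ := Finset.eq_empty_of_forall_notMem fun c hc =>
        hex c hc c.1 (hg.between_left _ _)
      have e3 : ∀ w, rowSet n (greedyRound.run env' B) 8 w = rowSet n B 8 w :=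
        fun w => rowSet_congr e2 w
      refine ⟨hDB', hle', ⟨t, ?_⟩, ?_, fun w hw => (e3 w).trans (hrows w hw)⟩
      · rw [e1, e3]
        exact hs
      · rw [e1, hempty]
        simp
  have hfinal : I (n * n) ((Stm.loop 5 0 (.loop 6 0 greedyRound)).run env A₂) := by
    simp only [Stm.run, h0]
    refine iter_induct (fun k B => I (k * n) B) (by rwa [Nat.zero_mul]) fun k _ B hB => ?_
    rw [Function.update_of_ne (by decide), h0, Nat.succ_mul]
    refine iter_induct (fun l B => I (k * n + l) B) hB fun l _ B' hB' => ?_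
    exact hround _ _ _ hB' (by simp [h0]) (by simp [h4]) (by simp)
  have hend : hitFamily.run env A = (Stm.loop 5 0 (.loop 6 0 greedyRound)).run env A₂ := rfl
  rw [hend]
  obtain ⟨-, -, ⟨t, hs⟩, hcard, hrows⟩ := hfinal
  refine ⟨⟨t, _, hs⟩, fun c hc => hs.hit c hc ?_, hrows⟩
  rw [Nat.sub_self, Nat.le_zero, Finset.card_eq_zero] at hcard
  rw [hcard]
  simp

/-! ### The local search -/

theorem run_improve (hD : DistMem G J A) (hA : ∀ b i, A b i ≤ env 2) (h0 : env 0 = n) (hn : 0 < n)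
    (h2 : n ≤ env 2)
    (h3 : env 3 = j) (hj : j < J) {v : Fin n} (h5 : env 5 = v) :
    let C := rowSet n A 6 (j + 8)
    let ball := ballPart G.dist C v (3 / 2 * Network.radius (j + 8))
    let B := improve.run env A
    ((rowSet n A 8 v).card < ball.card → rowSet n B 6 (j + 8) = (C \ ball) ∪ rowSet n A 8 v) ∧
    (ball.card ≤ (rowSet n A 8 v).card → B 6 = A 6) ∧
    (∀ i, i ≠ j + 8 → rowSet n B 6 i = rowSet n A 6 i) := by
  classical
  intro C ball B
  set A₁ := Stm.run (.seq (.store 11 (.const 0) (.const 0)) (.store 11 (.const 1) (.const 0))) env A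
    with hA₁
  set countC : Stm := .loop 6 0 (.store 11 (.const 0) (.bin .add (.load 11 (.const 0))
      (.bin .mul (.bin .lt (.const 0) (.load 6 (ix newRow (.var 6)))) inBall))) with hcountC
  set countH : Stm := .loop 6 0 (.store 11 (.const 1) (.bin .add (.load 11 (.const 1))
      (.bin .lt (.const 0) (.load 8 (ix (.var 5) (.var 6)))))) with hcountH
  set A₂ := countC.run env A₁ with hA₂
  set A₃ := countH.run env A₂ with hA₃
  have f1 : ∀ b, b ≠ 11 → A₁ b = A b := fun b hb => Stm.run_frame _ _ _ (by
    simpa [Stm.writes] using hb)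
  have f2 : ∀ b, b ≠ 11 → A₂ b = A₁ b := fun b hb => Stm.run_frame _ _ _ (by
    simpa [hcountC, Stm.writes] using hb)
  have f3 : ∀ b, b ≠ 11 → A₃ b = A₂ b := fun b hb => Stm.run_frame _ _ _ (by
    simpa [hcountH, Stm.writes] using hb)
  have f3' : ∀ b, b ≠ 11 → A₃ b = A b := fun b hb => by rw [f3 b hb, f2 b hb, f1 b hb]
  have le₁ : ∀ b i, A₁ b i ≤ env 2 :=
    Stm.run_le _ (lo := 3) le_rfl (by simp [Stm.WellFormed]) hA
  have le₂ : ∀ b i, A₂ b i ≤ env 2 :=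
    Stm.run_le _ (lo := 3) le_rfl (by simp [hcountC, Stm.WellFormed]) le₁
  have hD₁ : DistMem G J A₁ := hD.congr (f1 2 (by decide)) (f1 4 (by decide)) (f1 5 (by decide))
    (f1 12 (by decide))
  have hD₃ : DistMem G J A₃ := hD.congr (f3' 2 (by decide)) (f3' 4 (by decide))
    (f3' 5 (by decide)) (f3' 12 (by decide))
  have z₁ : A₁ 11 0 = 0 ∧ A₁ 11 1 = 0 := by
    constructor <;> simp [hA₁, Stm.run, setCell, Exp.value]
  have hball : ∀ (B : Mem) (u : Fin n), DistMem G J B →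
      inBall.value ⟨Function.update env 6 (u : ℕ), B⟩ =
        if G.dist v u ≤ 3 / 2 * Network.radius (j + 8) then 1 else 0 := by
    intro B u hDB
    rw [inBall, withinExp_value (u' := v) (v' := u) (j := j) (by norm_num) hDB (by simp [h0])
      (by simp [h3]) hj (by simp [Exp.value, h5]) (by simp [Exp.value])]
    norm_num
  have mem_ball : ∀ u, u ∈ ball ↔ u ∈ C ∧ G.dist v u ≤ 3 / 2 * Network.radius (j + 8) :=
    fun u => by simp [ball, ballPart]
  have addC : Adds countC env A₁ 11 _ := Adds.loop (by decide) fun _ _ =>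
    Adds.store (by decide) (by decide)
  have addH : Adds countH env A₂ 11 _ := Adds.loop (by decide) fun _ _ =>
    Adds.store (by decide) (by decide)
  have hcard : ∀ S : Finset (Fin n), S.card ≤ env 2 := fun S =>
    (Finset.card_le_univ S).trans (by simpa using h2)
  have c₂ : A₂ 11 0 = ball.card ∧ A₂ 11 1 = 0 := by
    rw [hA₂, addC.run_eq (le₁ 11)]
    simp only [addOn, if_true, z₁, zero_add]
    constructor
    · simp only [Exp.value, if_true, h0]
      rw [sum_range_indicator (S := ball) fun u => ?_]
      · exact min_eq_right (hcard _)
      · rw [hball A₁ u hD₁]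
        have hC : A₁ 6 ((j + 8) * n + u) ≠ 0 ↔ u ∈ C := by
          rw [f1 6 (by decide), mem_rowSet]
        by_cases h6 : u ∈ C <;> by_cases h7 : G.dist v u ≤ 3 / 2 * Network.radius (j + 8)
        all_goals
          have h8 := mem_ball u
          simp only [h6, h7, and_true, and_false, iff_true, iff_false] at h8
          have h9 := hC
          simp only [h6, iff_true, iff_false, not_not] at h9
          simp [ix, newRow, Exp.value, BinOp.apply, h0, h3, h7, h8, h9, Nat.pos_iff_ne_zero]
    · simp [Exp.value]
  have c₃ : A₃ 11 0 = ball.card ∧ A₃ 11 1 = (rowSet n A 8 v).card := by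
    rw [hA₃, addH.run_eq (le₂ 11)]
    simp only [addOn, if_true, c₂, zero_add]
    constructor
    · simpa [Exp.value] using hcard _
    · simp only [Exp.value, if_true, h0]
      rw [sum_range_indicator (S := rowSet n A 8 v) fun u => ?_]
      · exact min_eq_right (hcard _)
      · have h6 : A₂ 8 (v * n + u) ≠ 0 ↔ u ∈ rowSet n A 8 v := by
          rw [f2 8 (by decide), f1 8 (by decide), mem_rowSet]
        by_cases h7 : u ∈ rowSet n A 8 v <;> simp only [h7, iff_true, iff_false, not_not] at h6 <;>
          simp [ix, Exp.value, BinOp.apply, h0, h5, h6, h7, Nat.pos_iff_ne_zero]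
  have hB : B = Stm.run (.ite (.bin .lt (.load 11 (.const 1)) (.load 11 (.const 0)))
    (.loop 6 0 (.ite (.load 8 (ix (.var 5) (.var 6))) (.store 6 (ix newRow (.var 6)) (.const 1))
      (.ite inBall (.store 6 (ix newRow (.var 6)) (.const 0)) .skip))) .skip) env A₃ := rfl
  have hcond : (Exp.bin .lt (.load 11 (.const 1)) (.load 11 (.const 0))).value ⟨env, A₃⟩ ≠ 0 ↔
      (rowSet n A 8 v).card < ball.card := by
    simp [Exp.value, BinOp.apply, c₃]
  by_cases hlt : (rowSet n A 8 v).card < ball.card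
  swap
  · have hB' : B 6 = A 6 := by
      rw [hB, Stm.run, if_neg (mt hcond.1 hlt), Stm.run, f3' 6 (by decide)]
    exact ⟨fun h => absurd h hlt, fun _ => hB', fun i _ => rowSet_congr hB' i⟩
  have hn1 : 1 ≤ env 2 := by omega
  -- The new entries: `1` for the vertices of the greedy hitting set, `0` in the rest of the ball.
  have hmark : Marks (.loop 6 0 (.ite (.load 8 (ix (.var 5) (.var 6)))
      (.store 6 (ix newRow (.var 6)) (.const 1))
      (.ite inBall (.store 6 (ix newRow (.var 6)) (.const 0)) .skip))) env A₃ 6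
      (fun c => if A₃ 8 (v * n + c % n) = 0 then 0 else 1)
      (fun c => ∃ k < env 0, c = (j + 8) * n + k ∧
        (A₃ 8 (v * n + k) ≠ 0 ∨ inBall.value ⟨Function.update env 6 k, A₃⟩ ≠ 0)) := by
    have hloop := Marks.loop (p := .ite (.load 8 (ix (.var 5) (.var 6)))
      (.store 6 (ix newRow (.var 6)) (.const 1))
      (.ite inBall (.store 6 (ix newRow (.var 6)) (.const 0)) .skip)) (env := env) (A := A₃)
      (a := 6) (g := fun c => if A₃ 8 (v * n + c % n) = 0 then 0 else 1) (x := 6) (b := 0)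
      (S := fun k c => c = (j + 8) * n + k ∧
        (A₃ 8 (v * n + k) ≠ 0 ∨ inBall.value ⟨Function.update env 6 k, A₃⟩ ≠ 0))
    refine hloop fun k hk A' hA' => ?_
    rw [h0] at hk
    have e1 : (Exp.load 8 (ix (.var 5) (.var 6))).value ⟨Function.update env 6 k, A'⟩ =
        A₃ 8 (v * n + k) := by
      simp [Exp.value, ix, BinOp.apply, h0, h5, hA' 8 (by decide)]
    have e2 : inBall.value ⟨Function.update env 6 k, A'⟩ =
        inBall.value ⟨Function.update env 6 k, A₃⟩ := value_eq_of_agree (by decide) hA'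
    have e3 : (ix newRow (.var 6)).value ⟨Function.update env 6 k, A'⟩ = (j + 8) * n + k := by
      simp [Exp.value, ix, newRow, BinOp.apply, h0, h3]
    have e4 : ((j + 8) * n + k) % n = k := by
      rw [Nat.mul_add_mod', Nat.mod_eq_of_lt hk]
    have e5 : min 1 (Function.update env 6 k 2) = 1 := by
      rw [Function.update_of_ne (by decide)]
      exact min_eq_left hn1
    simp only [Stm.run, e1, e2, e3]
    by_cases h6 : A₃ 8 (v * n + k) = 0
    · by_cases h7 : inBall.value ⟨Function.update env 6 k, A₃⟩ = 0
      · funext b i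
        simp [setOn, h6, h7]
      · simp only [h6, h7, ne_eq, not_true_eq_false, not_false_eq_true, if_false, if_true,
          false_or, and_true]
        exact setCell_eq_setOn _ _ _ _ _ (by simp [e4, h6, Exp.value])
    · simp only [h6, ne_eq, not_false_eq_true, if_true, true_or, and_true]
      exact setCell_eq_setOn _ _ _ _ _ (by simp only [e4, h6, Exp.value, if_false, e5])
  have hB6 : ∀ i, B 6 i = setOn A₃ 6 (fun c => ∃ k < env 0, c = (j + 8) * n + k ∧
        (A₃ 8 (v * n + k) ≠ 0 ∨ inBall.value ⟨Function.update env 6 k, A₃⟩ ≠ 0))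
      (fun c => if A₃ 8 (v * n + c % n) = 0 then 0 else 1) 6 i := by
    intro i
    rw [hB, Stm.run, if_pos (hcond.2 hlt), hmark.run_eq]
  refine ⟨fun _ => ?_, fun h => absurd hlt (not_lt.2 h), fun i hi => ?_⟩
  · ext u
    have h6 : A₃ 8 (v * n + u) ≠ 0 ↔ u ∈ rowSet n A 8 v := by
      rw [f3' 8 (by decide), mem_rowSet]
    have h7 : inBall.value ⟨Function.update env 6 (u : ℕ), A₃⟩ ≠ 0 ↔
        G.dist v u ≤ 3 / 2 * Network.radius (j + 8) := by
      rw [hball A₃ u hD₃]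
      simp
    have e4 : ((j + 8) * n + u) % n = u := by
      rw [Nat.mul_add_mod', Nat.mod_eq_of_lt u.2]
    rw [mem_rowSet, hB6, setOn, Finset.mem_union, Finset.mem_sdiff, mem_ball]
    by_cases hS : u ∈ rowSet n A 8 v ∨ G.dist v u ≤ 3 / 2 * Network.radius (j + 8)
    · rw [if_pos ⟨rfl, u, by rw [h0]; exact u.2, rfl, hS.imp h6.2 h7.2⟩]
      simp only [e4]
      rcases hS with hS | hS
      · simp [h6.2 hS, hS]
      · by_cases h8 : u ∈ rowSet n A 8 v
        · simp [h6.2 h8, h8]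
        · simp [not_not.1 (mt h6.1 h8), h8, hS]
    · rw [if_neg]
      · rw [not_or] at hS
        rw [f3' 6 (by decide), ← mem_rowSet]
        simp [hS, C]
      · rintro ⟨-, k, hk, h8, h9⟩
        rw [h0] at hk
        have h10 := ((index_inj u.2 hk).1 h8).2
        subst h10
        exact hS (h9.imp h6.1 h7.1)
  · ext u
    rw [mem_rowSet, mem_rowSet, hB6, setOn, if_neg, f3' 6 (by decide)]
    rintro ⟨-, k, hk, h8, -⟩
    rw [h0] at hk
    exact hi ((index_inj u.2 hk).1 h8).1

/-- The effect of the first loop of `level`. -/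
theorem run_hitFamilies (hg : IsGeodesicMetric G.dist G.Tight) {h : ℕ}
    (hd : LocallyHit G.dist G.Tight h) (hD : DistMem G J A) (hA : ∀ b i, A b i ≤ env 2)
    (h0 : env 0 = n) (hn : 0 < n) (h2 : n * n ≤ env 2) (h3 : env 3 = j) (hj : j < J) :
    let B := (Stm.loop 4 0 hitFamily).run env A
    ∀ v : Fin n,
      (∃ t alive, GreedyState (fun x c => Between G.dist c.1 x c.2) h
        (localFamily G.dist G.Tight (Network.radius (j + 8)) (rowSet n A 6 j) v) alive
        (rowSet n B 8 v) t) ∧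
      ∀ c ∈ localFamily G.dist G.Tight (Network.radius (j + 8)) (rowSet n A 6 j) v,
        ∃ x ∈ rowSet n B 8 v, Between G.dist c.1 x c.2 := by
  intro B
  set F := localFamily G.dist G.Tight (Network.radius (j + 8)) (rowSet n A 6 j) with hF
  let I : ℕ → Mem → Prop := fun m B => (∀ b, b ∉ hitFamily.writes → B b = A b) ∧
    (∀ b i, B b i ≤ env 2) ∧ ∀ v : Fin n, (v : ℕ) < m →
      (∃ t alive, GreedyState (fun x c => Between G.dist c.1 x c.2) h (F v) alive
        (rowSet n B 8 v) t) ∧ ∀ c ∈ F v, ∃ x ∈ rowSet n B 8 v, Between G.dist c.1 x c.2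
  have hI : I (env 0) B := by
    refine iter_induct I ⟨fun _ _ => rfl, hA, fun v hv => absurd hv (by omega)⟩ ?_
    rintro k hk B ⟨hB, hle, hrows⟩
    have h2' : Function.update env 4 k 2 = env 2 := Function.update_of_ne (by decide) _ _
    rw [h0] at hk
    have hrow : rowSet n B 6 j = rowSet n A 6 j := rowSet_congr (hB 6 (by decide)) j
    obtain ⟨r1, r2, r3⟩ := run_hitFamily (A := B) (env := Function.update env 4 k) (J := J) (j := j)
      (v := ⟨k, hk⟩) (h := h) hg (hD.congr (hB 2 (by decide)) (hB 4 (by decide)) (hB 5 (by decide))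
      (hB 12 (by decide))) (by rwa [h2']) (by simp [h0]) hn (by rwa [h2']) (by simp [h3]) hj
      (by simp) (IsGeodesicMetric.exists_hits_localFamily hd (Network.radius_pos _) _ _)
    rw [hrow] at r1 r2
    refine ⟨fun b hb => (Stm.run_frame _ _ _ hb).trans (hB b hb), ?_, fun v hv => ?_⟩
    · rw [← h2'] at hle ⊢
      exact Stm.run_le _ (lo := 5) (by omega) (by simp [hitFamily, markFamily, greedyRound,
        countHits, findBest, chooseBest, Stm.WellFormed]) hle
    · by_cases hvk : v = ⟨k, hk⟩
      · subst hvk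
        exact ⟨r1, r2⟩
      · rw [r3 v hvk]
        refine hrows v ?_
        have : (v : ℕ) ≠ k := fun h => hvk (Fin.ext h)
        omega
  intro v
  exact hI.2.2 v (by rw [h0]; exact v.2)

/-- The effect of the second loop of `level`: local search terminates within `n` passes, because a
pass that changes the hitting set makes it smaller. -/
theorem run_improvements (hg : IsGeodesicMetric G.dist G.Tight) (hD : DistMem G J A)
    (hA : ∀ b i, A b i ≤ env 2) (h0 : env 0 = n) (hn : 0 < n) (h2 : n ≤ env 2)
    (h3 : env 3 = j) (hj : j < J)
    (hlow : HitsSignificant G.dist G.Tight (Network.radius j) (rowSet n A 6 j))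
    (hhigh : HitsSignificant G.dist G.Tight (Network.radius (j + 8)) (rowSet n A 6 (j + 8)))
    (hH : ∀ v : Fin n, ∀ c ∈ localFamily G.dist G.Tight (Network.radius (j + 8)) (rowSet n A 6 j) v,
      ∃ x ∈ rowSet n A 8 v, Between G.dist c.1 x c.2) :
    let B := (Stm.loop 4 0 (.loop 5 0 improve)).run env A
    (∀ v : Fin n, (ballPart G.dist (rowSet n B 6 (j + 8)) v
      (3 / 2 * Network.radius (j + 8))).card ≤ (rowSet n A 8 v).card) ∧
    HitsSignificant G.dist G.Tight (Network.radius (j + 8)) (rowSet n B 6 (j + 8)) ∧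
    ∀ i, i ≠ j + 8 → rowSet n B 6 i = rowSet n A 6 i := by
  classical
  intro B
  let stable : Finset (Fin n) → ℕ → Prop := fun C m => ∀ v : Fin n, (v : ℕ) < m →
    (ballPart G.dist C v (3 / 2 * Network.radius (j + 8))).card ≤ (rowSet n A 8 v).card
  let I : Mem → Prop := fun B => (∀ b, b ∉ improve.writes → B b = A b) ∧
    (∀ b i, B b i ≤ env 2) ∧
    HitsSignificant G.dist G.Tight (Network.radius (j + 8)) (rowSet n B 6 (j + 8)) ∧
    ∀ i, i ≠ j + 8 → rowSet n B 6 i = rowSet n A 6 i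
  -- One replacement step.
  have hstep : ∀ (env' : ℕ → ℕ) (B : Mem) (v : Fin n), I B → env' 0 = n → env' 2 = env 2 →
      env' 3 = j → env' 5 = v → I (improve.run env' B) ∧
      ((ballPart G.dist (rowSet n B 6 (j + 8)) v (3 / 2 * Network.radius (j + 8))).card ≤
          (rowSet n A 8 v).card ∧ rowSet n (improve.run env' B) 6 (j + 8) = rowSet n B 6 (j + 8) ∨
        (rowSet n A 8 v).card <
          (ballPart G.dist (rowSet n B 6 (j + 8)) v (3 / 2 * Network.radius (j + 8))).card ∧
        (rowSet n (improve.run env' B) 6 (j + 8)).card < (rowSet n B 6 (j + 8)).card) := by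
    rintro env' B v ⟨hB, hle, hhit, hrows⟩ h0' h2' h3' h5'
    have hrow : rowSet n B 8 v = rowSet n A 8 v := rowSet_congr (hB 8 (by decide)) v
    obtain ⟨r1, r2, r3⟩ := run_improve (A := B) (env := env') (J := J) (j := j) (v := v)
      (hD.congr (hB 2 (by decide)) (hB 4 (by decide)) (hB 5 (by decide)) (hB 12 (by decide)))
      (by rwa [h2']) h0' hn (by rwa [h2']) h3' hj h5'
    rw [hrow] at r1 r2
    have f1 : ∀ b, b ∉ improve.writes → improve.run env' B b = A b := fun b hb =>
      (Stm.run_frame _ _ _ hb).trans (hB b hb)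
    have f2 : ∀ b i, improve.run env' B b i ≤ env 2 := by
      rw [← h2'] at hle ⊢
      exact Stm.run_le _ (lo := 6) (by omega) (by simp [improve, Stm.WellFormed]) hle
    have f3 : ∀ i, i ≠ j + 8 → rowSet n (improve.run env' B) 6 i = rowSet n A 6 i :=
      fun i hi => (r3 i hi).trans (hrows i hi)
    rcases le_or_gt (ballPart G.dist (rowSet n B 6 (j + 8)) v
      (3 / 2 * Network.radius (j + 8))).card (rowSet n A 8 v).card with hle' | hlt
    · have heq : rowSet n (improve.run env' B) 6 (j + 8) = rowSet n B 6 (j + 8) :=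
        rowSet_congr (r2 hle') _
      exact ⟨⟨f1, f2, by rwa [heq], f3⟩, Or.inl ⟨hle', heq⟩⟩
    · have hsub : ballPart G.dist (rowSet n B 6 (j + 8)) v (3 / 2 * Network.radius (j + 8)) ⊆
          rowSet n B 6 (j + 8) := by
        unfold ballPart
        exact Finset.filter_subset _ _
      refine ⟨⟨f1, f2, ?_, f3⟩, Or.inr ⟨hlt, ?_⟩⟩
      · rw [r1 hlt]
        refine hg.hitsSignificant_replace (Network.radius_pos _)
          (by rwa [Network.radius_add_eight]) hhit (hH v)
          (fun x hx => Finset.mem_union.2 (Or.inr (by convert hx))) fun x hx hxv => ?_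
        refine Finset.mem_union.2 (Or.inl (Finset.mem_sdiff.2 ⟨hx, fun hx' => hxv ?_⟩))
        simp only [ballPart, Finset.mem_filter] at hx'
        exact hx'.2
      · rw [r1 hlt]
        convert card_replace_lt hsub hlt
  have hpass : ∀ (m : ℕ) (env' : ℕ → ℕ) (B : Mem), I B → env' 0 = n → env' 2 = env 2 →
      env' 3 = j →
      (stable (rowSet n B 6 (j + 8)) n ∨ (rowSet n B 6 (j + 8)).card ≤ n - m) →
      I ((Stm.loop 5 0 improve).run env' B) ∧
      (stable (rowSet n ((Stm.loop 5 0 improve).run env' B) 6 (j + 8)) n ∨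
        (rowSet n ((Stm.loop 5 0 improve).run env' B) 6 (j + 8)).card ≤ n - (m + 1)) := by
    intro m env' B hB h0' h2' h3' hst
    have hinner := iter_induct (f := fun k => improve.run (Function.update env' 5 k)) (a := B)
      (fun l B' => I B' ∧
        ((rowSet n B' 6 (j + 8) = rowSet n B 6 (j + 8) ∧ stable (rowSet n B 6 (j + 8)) l) ∨
        ((rowSet n B' 6 (j + 8)).card < (rowSet n B 6 (j + 8)).card ∧
          ¬ stable (rowSet n B 6 (j + 8)) n))) (n := n)
      ⟨hB, Or.inl ⟨rfl, fun v hv => absurd hv (by omega)⟩⟩ (by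
        rintro k hk B' ⟨hB', hor⟩
        obtain ⟨g1, g2⟩ := hstep (Function.update env' 5 k) B' ⟨k, hk⟩ hB' (by simp [h0'])
          (by simp [h2']) (by simp [h3']) (by simp)
        refine ⟨g1, ?_⟩
        rcases hor with ⟨e1, e2⟩ | ⟨e1, e2⟩
        · rw [e1] at g2
          rcases g2 with ⟨e3, e4⟩ | ⟨e3, e4⟩
          · refine Or.inl ⟨e4, fun v hv => ?_⟩
            rcases Nat.lt_succ_iff_lt_or_eq.1 hv with h | h
            · exact e2 v h
            · rwa [show v = ⟨k, hk⟩ from Fin.ext h]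
          · exact Or.inr ⟨e4, fun hs => absurd (hs ⟨k, hk⟩ hk) (not_le.2 e3)⟩
        · refine Or.inr ⟨?_, e2⟩
          rcases g2 with ⟨-, e4⟩ | ⟨-, e4⟩
          · rwa [e4]
          · exact e4.trans e1)
    simp only [Stm.run, h0']
    obtain ⟨g1, ⟨e1, e2⟩ | ⟨e1, e2⟩⟩ := hinner
    · refine ⟨g1, Or.inl ?_⟩
      rw [e1]
      exact e2
    · refine ⟨g1, Or.inr ?_⟩
      have := hst.resolve_left e2
      omega
  have hfinal : I B ∧ (stable (rowSet n B 6 (j + 8)) n ∨ (rowSet n B 6 (j + 8)).card ≤ n - n) := by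
    have houter := iter_induct (f := fun k => (Stm.loop 5 0 improve).run (Function.update env 4 k))
      (a := A) (fun m B => I B ∧ (stable (rowSet n B 6 (j + 8)) n ∨
        (rowSet n B 6 (j + 8)).card ≤ n - m)) (n := n)
      ⟨⟨fun _ _ => rfl, hA, hhigh, fun _ _ => rfl⟩, Or.inr ?_⟩ fun k _ B' hB' =>
        hpass k _ B' hB'.1 (by simp [h0]) (by simp) (by simp [h3]) hB'.2
    · simpa only [B, Stm.run, h0] using houter
    · exact (Finset.card_le_univ _).trans (by simp)
  obtain ⟨⟨-, -, g3, g4⟩, hor⟩ := hfinal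
  refine ⟨fun v => ?_, g3, g4⟩
  rcases hor with hs | hcard
  · exact hs v v.2
  · rw [Nat.sub_self, Nat.le_zero, Finset.card_eq_zero] at hcard
    rw [hcard]
    simp [ballPart]

/-! ### All scales -/

/-- The hitting sets for all scales. -/
theorem run_levels (hc : G.graph.Connected) (hl : G.LenGeOne) (hu : G.UniqueShortestPaths)
    (hD : DistMem G J A) (hA : ∀ b i, A b i ≤ env 2) (h0 : env 0 = n) (h1 : env 1 = J) (hn : 0 < n)
    (h2 : n * n ≤ env 2) (hrow : ∀ i < J + 8, rowSet n A 6 i = Finset.univ) :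
    G.LevelSets J (rowSet n ((Stm.loop 3 1 level).run env A) 6) := by
  have hg := Network.isGeodesicMetric hc hl hu
  let Good : Mem → ℕ → Prop := fun B i => ∃ H : Fin n → Finset (Fin n),
    (∀ v, ∃ t alive, GreedyState (fun x c => Between G.dist c.1 x c.2) G.highwayDimension
      (localFamily G.dist G.Tight (Network.radius (i + 8)) (rowSet n B 6 i) v) alive (H v) t) ∧
    (∀ v, (ballPart G.dist (rowSet n B 6 (i + 8)) v
      (3 / 2 * Network.radius (i + 8))).card ≤ (H v).card) ∧
    HitsSignificant G.dist G.Tight (Network.radius (i + 8)) (rowSet n B 6 (i + 8))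
  let I : ℕ → Mem → Prop := fun k B => (∀ b, b ∉ level.writes → B b = A b) ∧
    (∀ b i, B b i ≤ env 2) ∧ (∀ i < J + 8, (i < 8 ∨ k + 8 ≤ i) → rowSet n B 6 i = Finset.univ) ∧
    ∀ i < k, Good B i
  have hI : I J ((Stm.loop 3 1 level).run env A) := by
    simp only [Stm.run, h1]
    refine iter_induct I ⟨fun _ _ => rfl, hA, fun i hi _ => hrow i hi,
      fun i hi => absurd hi (by omega)⟩ ?_
    rintro j hj B ⟨hB, hle, huniv, hgood⟩
    have h2' : Function.update env 3 j 2 = env 2 := Function.update_of_ne (by decide) _ _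
    have hDB : DistMem G J B := hD.congr (hB 2 (by decide)) (hB 4 (by decide)) (hB 5 (by decide))
      (hB 12 (by decide))
    have hlow : HitsSignificant G.dist G.Tight (Network.radius j) (rowSet n B 6 j) := by
      rcases lt_or_ge j 8 with h | h
      · rw [huniv j (by omega) (Or.inl h)]
        exact hg.hitsSignificant_univ _
      · obtain ⟨i, rfl⟩ := Nat.exists_eq_add_of_le' h
        obtain ⟨-, -, -, h'⟩ := hgood i (by omega)
        exact h'
    set B₁ := (Stm.loop 4 0 hitFamily).run (Function.update env 3 j) B with hB₁
    have f1 : ∀ b, b ∉ hitFamily.writes → B₁ b = B b := fun b hb => Stm.run_frame _ _ _ hb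
    have le₁ : ∀ b i, B₁ b i ≤ Function.update env 3 j 2 :=
      Stm.run_le _ (lo := 4) (by omega) (by simp [hitFamily, markFamily, greedyRound,
        countHits, findBest, chooseBest, Stm.WellFormed]) (by rwa [h2'])
    have hfam := run_hitFamilies (A := B) (env := Function.update env 3 j) (J := J) (j := j) hg
      (Network.locallyHit hc hl hu) hDB (by rwa [h2']) (by simp [h0]) hn (by rwa [h2']) (by simp) hj
    rw [← hB₁] at hfam
    have hrow6 : ∀ i, rowSet n B₁ 6 i = rowSet n B 6 i := rowSet_congr (f1 6 (by decide))
    obtain ⟨r1, r2, r3⟩ := run_improvements (A := B₁) (env := Function.update env 3 j) (J := J)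
      (j := j) hg (hDB.congr (f1 2 (by decide)) (f1 4 (by decide)) (f1 5 (by decide))
      (f1 12 (by decide))) le₁ (by simp [h0]) hn
      (by rw [h2']; exact (Nat.le_mul_self n).trans h2) (by simp) hj (by rwa [hrow6])
      (by
        rw [hrow6, huniv (j + 8) (by omega) (Or.inr (by omega))]
        exact hg.hitsSignificant_univ _)
      (fun v => by rw [hrow6]; exact (hfam v).2)
    have hend : level.run (Function.update env 3 j) B =
        (Stm.loop 4 0 (.loop 5 0 improve)).run (Function.update env 3 j) B₁ := rfl
    rw [← hend] at r1 r2 r3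
    have hrows : ∀ i, i ≠ j + 8 → rowSet n (level.run (Function.update env 3 j) B) 6 i =
        rowSet n B 6 i := fun i hi => (r3 i hi).trans (hrow6 i)
    refine ⟨fun b hb => (Stm.run_frame _ _ _ hb).trans (hB b hb), ?_, fun i hi hor => ?_, ?_⟩
    · rw [← h2']
      exact Stm.run_le level (lo := 4) (by omega) (by simp [level, improve, hitFamily, markFamily,
        greedyRound, countHits, findBest, chooseBest, Stm.WellFormed]) (by rwa [h2'])
    · rw [hrows i (by omega)]
      exact huniv i hi (by omega)
    · intro i hi
      rcases Nat.lt_succ_iff_lt_or_eq.1 hi with h | rfl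
      · simp only [Good, hrows i (by omega), hrows (i + 8) (by omega)]
        exact hgood i h
      · refine ⟨rowSet n B₁ 8 ∘ Fin.val, fun v => ?_, r1, r2⟩
        rw [hrows i (by omega)]
        exact (hfam v).1
  obtain ⟨-, -, huniv, hgood⟩ := hI
  exact ⟨fun i hi => huniv i (by omega) (Or.inl hi), fun i hi _ => hgood i hi⟩

end

end RAM

/-! ### Distances as integers -/

namespace IsGeodesicMetric

variable {V : Type*} [Fintype V] {d : V → V → ℝ} {T : V → V → Prop}

open Classical in
/-- The number of points that are closer to `a` than `b` is. -/
def rank (d : V → V → ℝ) (a b : V) : ℕ := (Finset.univ.filter fun x => d a x < d a b).card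

theorem rank_lt {a b c : V} (h : d a b < d a c) : rank d a b < rank d a c := by
  classical
  refine Finset.card_lt_card (Finset.ssubset_iff_subset_ne.2 ⟨fun x hx => ?_, fun heq => ?_⟩)
  · simp only [Finset.mem_filter, Finset.mem_univ, true_and] at hx ⊢
    exact hx.trans h
  · have hb : b ∈ Finset.univ.filter fun x => d a x < d a c := by simpa using h
    rw [← heq] at hb
    simp at hb

theorem rank_lt_card (a b : V) : rank d a b < Fintype.card V := by
  classical
  refine Finset.card_lt_univ_of_notMem (x := b) ?_
  simp

/-- A geodesic ends with a step from a point of smaller rank. -/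
theorem exists_last (hg : IsGeodesicMetric d T) {a b : V} (hab : a ≠ b) :
    ∃ c, T c b ∧ d a c + d c b = d a b ∧ rank d a c < rank d a b := by
  obtain ⟨c, hne, hT, h⟩ := hg.next hab.symm
  have h1 : d a c + d c b = d a b := by
    rw [hg.symm a c, hg.symm c b, hg.symm a b]
    linarith
  have h2 := hg.pos hne
  exact ⟨c, hg.step_symm hT, h1, rank_lt (by linarith)⟩

/-- A geodesic has at most as many steps as the rank of its end. -/
theorem le_rank_mul (hg : IsGeodesicMetric d T) {M : ℝ} (hM : ∀ a b, T a b → d a b ≤ M) (a b : V) :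
    d a b ≤ rank d a b * M := by
  induction hr : rank d a b using Nat.strong_induction_on generalizing b with
  | _ m ih =>
    have h0 : 0 ≤ M := (hg.nonneg a a).trans (hM a a (hg.step_self a))
    rcases eq_or_ne a b with rfl | hab
    · rw [hg.self]
      positivity
    · obtain ⟨c, hT, hc, hlt⟩ := hg.exists_last hab
      have h1 := ih _ (hr ▸ hlt) c rfl
      have h2 : ((rank d a c : ℝ) + 1) * M ≤ m * M :=
        mul_le_mul_of_nonneg_right (by exact_mod_cast hr ▸ hlt) h0
      have h3 := hM c b hT
      linarith

end IsGeodesicMetric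

namespace RationalNetwork

variable {n : ℕ} (N : RationalNetwork n)

/-- The numerators of the length matrix, as given in the input. -/
def num (i j : Fin n) : ℕ := (N.entry i j).num.natAbs

/-- The denominators of the length matrix, as given in the input. -/
def den (i j : Fin n) : ℕ := (N.entry i j).den

variable {N}

theorem den_pos (i j : Fin n) : 0 < N.den i j := (N.entry i j).den_pos

theorem lenGeOne_toNetwork (hl : ∀ e ∈ N.graph.edgeSet, 1 ≤ N.len e) : N.toNetwork.LenGeOne :=
  fun e he => by
    have := hl e he
    simp only [toNetwork]
    exact_mod_cast this

theorem num_eq_zero (hl : ∀ e ∈ N.graph.edgeSet, 1 ≤ N.len e) {i j : Fin n} :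
    N.num i j = 0 ↔ ¬ N.graph.Adj i j := by
  by_cases h : N.graph.Adj i j
  · have h1 := hl s(i, j) h
    have h2 : N.len s(i, j) ≠ 0 := by linarith
    simpa [num, entry, h] using h2
  · simp [num, entry, h]

theorem num_div_den (hl : ∀ e ∈ N.graph.edgeSet, 1 ≤ N.len e) {i j : Fin n}
    (h : N.graph.Adj i j) : (N.num i j : ℝ) / N.den i j = N.len s(i, j) := by
  have h1 := hl s(i, j) h
  have h2 : 0 ≤ (N.len s(i, j)).num := Rat.num_nonneg.2 (by linarith)
  have h3 : ((N.len s(i, j)).num.natAbs : ℝ) = (N.len s(i, j)).num := by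
    rw [← Int.cast_natCast, Int.natAbs_of_nonneg h2]
  simp only [num, den, entry, if_pos h]
  rw [h3]
  exact_mod_cast Rat.num_div_den (N.len s(i, j))

/-- The length matrix, multiplied by `Q`, with `W` for pairs that are not adjacent (recognizable by
numerator `0`, as edges have length at least `1`). -/
def scaledLen (N : RationalNetwork n) (Q W : ℕ) (i j : Fin n) : ℕ :=
  if i = j then 0 else N.num i j * (Q / N.den i j) + if N.num i j = 0 then W else 0

section

variable {Q W M : ℕ} (hl : ∀ e ∈ N.graph.edgeSet, 1 ≤ N.len e) (hQ : 0 < Q)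
  (hden : ∀ i j, N.den i j ∣ Q)
include hl hden

theorem scaledLen_of_adj {i j : Fin n} (h : N.graph.Adj i j) :
    (N.scaledLen Q W i j : ℝ) = Q * N.toNetwork.len s(i, j) := by
  have h1 : N.num i j ≠ 0 := fun h' => num_eq_zero hl |>.1 h' h
  have h2 : (N.den i j : ℝ) ≠ 0 := by exact_mod_cast (den_pos i j).ne'
  rw [scaledLen, if_neg h.ne, if_neg h1, add_zero, Nat.cast_mul,
    Nat.cast_div (hden i j) h2, show N.toNetwork.len s(i, j) = N.len s(i, j) from rfl,
    ← num_div_den hl h]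
  ring

theorem scaledLen_of_tight {i j : Fin n} (h : N.toNetwork.Tight i j) :
    (N.scaledLen Q W i j : ℝ) = Q * N.toNetwork.dist i j := by
  rcases h with rfl | ⟨h, h'⟩
  · simp [scaledLen, Network.dist_self (lenGeOne_toNetwork hl)]
  · rw [scaledLen_of_adj hl hden h, h']

variable (hc : N.graph.Connected) (hu : N.toNetwork.UniqueShortestPaths)
  (hM : ∀ i j, N.num i j * Q ≤ M) (hW : n * M < W)
include hQ hc hu hM hW

/-- The value `W` exceeds all distances multiplied by `Q`. -/
theorem mul_dist_lt (i j : Fin n) : Q * N.toNetwork.dist i j < W := by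
  have hQ' : (0 : ℝ) < Q := by exact_mod_cast hQ
  have hg := Network.isGeodesicMetric (N := N.toNetwork) hc (lenGeOne_toNetwork hl) hu
  have h1 : ∀ a b, N.toNetwork.Tight a b → N.toNetwork.dist a b ≤ M / Q := by
    intro a b h
    rw [le_div_iff₀ hQ', mul_comm]
    rcases h with rfl | ⟨h, h'⟩
    · rw [hg.self, mul_zero]
      positivity
    · rw [← h', ← scaledLen_of_adj (W := W) hl hden h, scaledLen, if_neg h.ne,
        if_neg fun h' => num_eq_zero hl |>.1 h' h]
      have := (Nat.mul_le_mul_left (N.num a b) (Nat.div_le_self Q (N.den a b))).trans (hM a b)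
      exact_mod_cast this
  have h2 := hg.le_rank_mul h1 i j
  have h3 : ((IsGeodesicMetric.rank N.toNetwork.dist i j : ℕ) : ℝ) ≤ n := by
    have := (IsGeodesicMetric.rank_lt_card (d := N.toNetwork.dist) i j).le
    rw [Fintype.card_fin] at this
    exact_mod_cast this
  calc (Q : ℝ) * N.toNetwork.dist i j ≤ Q * (n * (M / Q)) := by
        gcongr
        exact h2.trans (by gcongr)
    _ = n * M := by field_simp
    _ < W := by exact_mod_cast hW

theorem mul_dist_le_scaledLen (i j : Fin n) :
    Q * N.toNetwork.dist i j ≤ N.scaledLen Q W i j := by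
  rcases eq_or_ne i j with rfl | hij
  · simp [Network.dist_self (lenGeOne_toNetwork hl)]
  by_cases h : N.graph.Adj i j
  · rw [scaledLen_of_adj hl hden h]
    refine mul_le_mul_of_nonneg_left ?_ (Nat.cast_nonneg Q)
    have := Network.dist_le_length (N := N.toNetwork) (lenGeOne_toNetwork hl)
      (SimpleGraph.Walk.cons (show N.toNetwork.graph.Adj i j from h) SimpleGraph.Walk.nil)
    simpa [Network.length] using this
  · refine (mul_dist_lt hl hQ hden hc hu hM hW i j).le.trans ?_
    have h1 := (num_eq_zero hl (N := N)).2 h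
    simp [scaledLen, hij, h1]

theorem scaledLen_eq_iff (i j : Fin n) :
    (N.scaledLen Q W i j : ℝ) = Q * N.toNetwork.dist i j ↔ N.toNetwork.Tight i j := by
  refine ⟨fun h => ?_, scaledLen_of_tight hl hden⟩
  rcases eq_or_ne i j with rfl | hij
  · exact Or.inl rfl
  by_cases hadj : N.graph.Adj i j
  · refine Or.inr ⟨hadj, ?_⟩
    rw [scaledLen_of_adj hl hden hadj] at h
    exact mul_left_cancel₀ (by exact_mod_cast hQ.ne') h
  · have h1 := (num_eq_zero hl (N := N)).2 hadj
    have h2 := mul_dist_lt hl hQ hden hc hu hM hW i j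
    rw [← h] at h2
    simp [scaledLen, hij, h1] at h2

omit hl hQ hden hc hu in
theorem scaledLen_le (i j : Fin n) : N.scaledLen Q W i j ≤ W := by
  unfold scaledLen
  split_ifs with h1 h2
  · omega
  · simp [h2]
  · have h3 := (Nat.mul_le_mul_left (N.num i j) (Nat.div_le_self Q (N.den i j))).trans (hM i j)
    have h4 : M ≤ n * M := Nat.le_mul_of_pos_left _ (by have := i.2; omega)
    omega

end

end RationalNetwork

namespace RAM

/-! ### Preparing the data -/

/-- The value of `e` as an entry of a matrix: `var 4` and `var 5` are the row and the column. -/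
def fill (a : ℕ) (e : Exp) : Stm := .loop 4 0 (.loop 5 0 (.store a (ix (.var 4) (.var 5)) e))

/-- The numerator of the entry `(var 4, var 5)` of the length matrix. -/
def numExp : Exp := .load 0 (.bin .add (.const 1) (ix (.var 4) (.var 5)))

/-- The denominator of the entry `(var 4, var 5)` of the length matrix. -/
def denExp : Exp :=
  .load 0 (.bin .add (.bin .add (.const 1) (.bin .mul (.var 0) (.var 0))) (ix (.var 4) (.var 5)))

/-- Compute the common denominator: the product of all denominators. -/
def commonDenom : Stm :=
  .seq (.store 4 (.const 0) (.const 1))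
    (.loop 4 0 (.loop 5 0 (.store 4 (.const 0) (.bin .mul denom denExp))))

/-- The entry of `RationalNetwork.scaledLen`. -/
def scaledLenExp : Exp :=
  .bin .mul (.bin .eq (.bin .eq (.var 4) (.var 5)) (.const 0))
    (.bin .add (.bin .mul numExp (.bin .div denom denExp))
      (.bin .mul (.bin .eq numExp (.const 0)) (.var 2)))

/-- The length of a walk from `var 5` to `var 6` whose last step starts in `var 7`. -/
def viaExp : Exp :=
  .bin .add (.load 2 (ix (.var 5) (.var 7))) (.load 5 (ix (.var 7) (.var 6)))

/-- Shorten the walk from `var 5` to `var 6` if going through `var 7` helps. -/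
def relax : Stm :=
  .ite (.bin .lt viaExp (.load 2 (ix (.var 5) (.var 6))))
    (.store 2 (ix (.var 5) (.var 6)) viaExp) .skip

/-- The distances, by the method of Bellman and Ford: after `n` rounds of relaxing all edges, a walk
has been found for every shortest path. -/
def shortestPaths : Stm := .loop 4 0 (.loop 5 0 (.loop 6 0 (.loop 7 0 relax)))

/-- Write the scales to array `12`. -/
def writeScales : Stm :=
  .seq (.seq (.store 12 (.const 0) (.const 2)) (.store 12 (.const 1) (.const 3)))
    (.loop 4 1 (.store 12 (.bin .add (.var 4) (.const 2))
      (.bin .mul (.const 2) (.load 12 (.var 4)))))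

/-- At the start all hitting sets contain all vertices. -/
def writeRows : Stm :=
  .seq (.loop 4 1 (.loop 5 0 (.store 6 (ix (.var 4) (.var 5)) (.const 1))))
    (.loop 4 1 (.loop 5 0 (.store 6 (ix (.bin .add (.var 4) (.const 8)) (.var 5)) (.const 1))))

/-- Prepare the data for the computation of the hitting sets. -/
def prepare : Stm :=
  .seq commonDenom (.seq (fill 5 scaledLenExp) (.seq (fill 2 (.load 5 (ix (.var 4) (.var 5))))
    (.seq shortestPaths (.seq (fill 3 denom) (.seq writeScales writeRows)))))

/-- The input describes `N`, and the cap `W` on stored values exceeds all numbers that occur; by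
`cap`, this includes the distances multiplied by the product of all denominators. -/
structure InputMem {n : ℕ} (N : RationalNetwork n) (J W : ℕ) (A : Mem) : Prop where
  num (u v : Fin n) : A 0 (1 + (u * n + v)) = N.num u v
  den (u v : Fin n) : A 0 (1 + n * n + (u * n + v)) = N.den u v
  cap : n * ((∏ k ∈ Finset.range (n * n), (1 + A 0 (1 + k))) *
    ∏ k ∈ Finset.range (n * n), A 0 (1 + n * n + k)) < W
  scale (i : ℕ) (hi : i < J + 2) : Network.scale i ≤ W
  le (b i : ℕ) : A b i ≤ W

/-- The product of all denominators. -/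
def denomProd (n : ℕ) (A : Mem) : ℕ := ∏ k ∈ Finset.range (n * n), A 0 (1 + n * n + k)

theorem index_lt {n : ℕ} (u v : Fin n) : u * n + v < n * n := by
  have h1 := u.2
  have h2 := v.2
  have h3 : (u + 1 : ℕ) * n ≤ n * n := Nat.mul_le_mul_right n h1
  rw [Nat.succ_mul] at h3
  omega

namespace InputMem

variable {n J W : ℕ} {N : RationalNetwork n} {A : Mem} (h : InputMem N J W A)
include h

theorem cell_pos {k : ℕ} (hk : k < n * n) : 0 < A 0 (1 + n * n + k) := by
  have hn : 0 < n := Nat.pos_of_ne_zero (by rintro rfl; omega)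
  have h1 := h.den ⟨k / n, Nat.div_lt_of_lt_mul hk⟩ ⟨k % n, Nat.mod_lt k hn⟩
  simp only [Nat.div_add_mod'] at h1
  rw [h1]
  exact RationalNetwork.den_pos _ _

theorem denomProd_pos : 0 < denomProd n A :=
  Finset.prod_pos fun _ hk => h.cell_pos (Finset.mem_range.1 hk)

theorem den_dvd (u v : Fin n) : N.den u v ∣ denomProd n A := by
  rw [← h.den]
  exact Finset.dvd_prod_of_mem (fun k => A 0 (1 + n * n + k)) (Finset.mem_range.2 (index_lt u v))

theorem num_mul_le (u v : Fin n) : N.num u v * denomProd n A ≤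
    (∏ k ∈ Finset.range (n * n), (1 + A 0 (1 + k))) * denomProd n A := by
  refine Nat.mul_le_mul_right _ ?_
  rw [← h.num]
  have h1 := Finset.single_le_prod' (f := fun k => 1 + A 0 (1 + k)) (s := Finset.range (n * n))
    (fun _ _ => by omega) (Finset.mem_range.2 (index_lt u v))
  omega

theorem prod_le {m : ℕ} (hm : m ≤ n * n) (hn : 0 < n) :
    ∏ k ∈ Finset.range m, A 0 (1 + n * n + k) ≤ W := by
  have h1 : ∏ k ∈ Finset.range m, A 0 (1 + n * n + k) ≤ denomProd n A :=
    Finset.prod_le_prod_of_subset_of_one_le' (Finset.range_subset_range.2 hm)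
      fun k hk _ => h.cell_pos (Finset.mem_range.1 hk)
  have h2 : 0 < ∏ k ∈ Finset.range (n * n), (1 + A 0 (1 + k)) :=
    Finset.prod_pos fun k _ => by omega
  have h3 := h.cap
  have h4 : denomProd n A ≤ (∏ k ∈ Finset.range (n * n), (1 + A 0 (1 + k))) * denomProd n A :=
    Nat.le_mul_of_pos_left _ h2
  have h5 := Nat.le_mul_of_pos_left ((∏ k ∈ Finset.range (n * n), (1 + A 0 (1 + k))) *
    denomProd n A) hn
  unfold denomProd at *
  omega

end InputMem

section

variable {n J : ℕ} {A : Mem} {env : ℕ → ℕ}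

theorem run_fill {a : ℕ} {e : Exp} (he : a ∉ e.reads) (h0 : env 0 = n) (u v : Fin n) :
    (fill a e).run env A a (u * n + v) =
      min (e.value ⟨Function.update (Function.update env 4 (u : ℕ)) 5 (v : ℕ), A⟩) (env 2) := by
  have hmark : Marks (fill a e) env A a (fun c => min (e.value
      ⟨Function.update (Function.update env 4 (c / n)) 5 (c % n), A⟩) (env 2)) _ :=
    Marks.loop fun k hk => Marks.loop fun l hl => Marks.store (by simp [ix, Exp.reads]) he (by
      rw [Function.update_of_ne (by decide), h0] at hl
      have hn : 0 < n := by omega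
      have e1 : (ix (.var 4) (.var 5)).value
          ⟨Function.update (Function.update env 4 k) 5 l, A⟩ = k * n + l := by
        simp [ix, Exp.value, BinOp.apply, h0]
      rw [e1, mul_comm k n, Nat.mul_add_div hn, Nat.div_eq_of_lt hl, Nat.mul_add_mod,
        Nat.mod_eq_of_lt hl]
      simp)
  have hn : 0 < n := by have := u.2; omega
  rw [hmark.run_eq, setOn, if_pos]
  · simp only [mul_comm (u : ℕ) n, Nat.mul_add_div hn, Nat.div_eq_of_lt v.2, Nat.mul_add_mod,
      Nat.mod_eq_of_lt v.2, add_zero]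
  · refine ⟨rfl, u, by rw [h0]; exact u.2, v, ?_, ?_⟩
    · rw [Function.update_of_ne (by decide), h0]
      exact v.2
    · simp [ix, Exp.value, BinOp.apply, h0]

theorem run_commonDenom {N : RationalNetwork n} (h : InputMem N J (env 2) A) (h0 : env 0 = n)
    (hn : 0 < n) : commonDenom.run env A 4 0 = denomProd n A := by
  let I : ℕ → Mem → Prop := fun m B => B 0 = A 0 ∧
    B 4 0 = ∏ k ∈ Finset.range m, A 0 (1 + n * n + k)
  suffices hI : I (n * n) (commonDenom.run env A) from hI.2
  simp only [commonDenom, Stm.run, h0]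
  refine iter_induct (fun k B => I (k * n) B) ?_ fun k hk B hB => ?_
  · have h1 : 1 ≤ env 2 := by simpa using h.prod_le (m := 0) (by omega) hn
    refine ⟨?_, ?_⟩
    · funext i
      simp [setCell]
    · simpa [setCell, Exp.value] using h1
  · rw [Function.update_of_ne (by decide), h0, Nat.succ_mul]
    refine iter_induct (fun l B => I (k * n + l) B) hB fun l hl B' hB' => ?_
    have hlt := index_lt (⟨k, hk⟩ : Fin n) ⟨l, hl⟩
    have e1 : (Exp.bin .mul denom denExp).value
        ⟨Function.update (Function.update env 4 k) 5 l, B'⟩ =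
        ∏ i ∈ Finset.range (k * n + (l + 1)), A 0 (1 + n * n + i) := by
      rw [← add_assoc, Finset.prod_range_succ, ← hB'.2]
      simp [denom, denExp, ix, Exp.value, BinOp.apply, h0, hB'.1]
    refine ⟨?_, ?_⟩
    · funext i
      simp [setCell, hB'.1]
    · simp only [e1]
      have := h.prod_le (m := k * n + (l + 1)) (by simp only at hlt; omega) hn
      simpa [setCell, Exp.value] using this

theorem scaledLenExp_value {N : RationalNetwork n} {W : ℕ} {u v : Fin n}
    (hnum : A 0 (1 + (u * n + v)) = N.num u v)
    (hden : A 0 (1 + n * n + (u * n + v)) = N.den u v) (h0 : env 0 = n) (h2 : env 2 = W)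
    (h4 : env 4 = u) (h5 : env 5 = v) :
    scaledLenExp.value ⟨env, A⟩ = N.scaledLen (A 4 0) W u v := by
  simp only [scaledLenExp, numExp, denExp, denom, ix, Exp.value, BinOp.apply, h0, h2, h4, h5, hnum,
    hden, RationalNetwork.scaledLen]
  by_cases h6 : u = v
  · simp [h6]
  · have h7 : (u : ℕ) ≠ v := fun h => h6 (Fin.ext h)
    by_cases h8 : N.num u v = 0 <;> simp [h6, h7, h8]

/-- If every step of an iteration preserves a preorder `R` and establishes a property that is
inherited along `R`, then at the end all these properties hold. -/
theorem iter_forall {α : Type*} {f : ℕ → α → α} {R : α → α → Prop} {P : ℕ → α → Prop} {n : ℕ}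
    (hR : ∀ a, R a a) (hRt : ∀ a b c, R a b → R b c → R a c)
    (hP : ∀ k a b, R a b → P k a → P k b) {a : α}
    (h : ∀ k < n, ∀ b, R a b → R b (f k b) ∧ P k (f k b)) :
    R a (iter f a n) ∧ ∀ k < n, P k (iter f a n) := by
  refine iter_induct (fun m b => R a b ∧ ∀ k < m, P k b) ⟨hR a, fun k hk => absurd hk (by omega)⟩ ?_
  rintro k hk b ⟨hab, hb⟩
  obtain ⟨h1, h2⟩ := h k hk b hab
  refine ⟨hRt _ _ _ hab h1, fun l hl => ?_⟩
  rcases Nat.lt_succ_iff_lt_or_eq.1 hl with h3 | rfl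
  · exact hP l _ _ h1 (hb l h3)
  · exact h2

/-- Upper bounds on distances are correct at the start and remain correct; in round `m` they become
sharp for the pairs of rank `m`. -/
theorem run_shortestPaths {d : Fin n → Fin n → ℝ} {T : Fin n → Fin n → Prop}
    (hg : IsGeodesicMetric d T) {Q : ℕ} (h0 : env 0 = n) (hW : ∀ u v, Q * d u v ≤ env 2)
    (hlow : ∀ u v : Fin n, Q * d u v ≤ A 5 (u * n + v))
    (htight : ∀ u v : Fin n, T u v → (A 5 (u * n + v) : ℝ) = Q * d u v)
    (h2 : ∀ u v : Fin n, A 2 (u * n + v) = A 5 (u * n + v)) (u v : Fin n) :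
    (shortestPaths.run env A 2 (u * n + v) : ℝ) = Q * d u v := by
  let R : Mem → Mem → Prop := fun B B' => (∀ b, b ≠ 2 → B' b = B b) ∧
    ((∀ u v : Fin n, Q * d u v ≤ B 2 (u * n + v)) → ∀ u v : Fin n, Q * d u v ≤ B' 2 (u * n + v)) ∧
    ∀ u v : Fin n, B' 2 (u * n + v) ≤ B 2 (u * n + v)
  have hR : ∀ B, R B B := fun B => ⟨fun _ _ => rfl, fun h => h, fun _ _ => le_rfl⟩
  have hRt : ∀ B B' B'', R B B' → R B' B'' → R B B'' := fun B B' B'' h h' =>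
    ⟨fun b hb => (h'.1 b hb).trans (h.1 b hb), fun hB => h'.2.1 (h.2.1 hB),
      fun u v => (h'.2.2 u v).trans (h.2.2 u v)⟩
  have hrelax : ∀ (env' : ℕ → ℕ) (B : Mem) (i j k : Fin n), B 5 = A 5 → env' 0 = n →
      env' 2 = env 2 → env' 5 = i → env' 6 = j → env' 7 = k → R B (relax.run env' B) ∧
      relax.run env' B 2 (i * n + j) ≤ B 2 (i * n + k) + A 5 (k * n + j) := by
    intro env' B i j k hB5 h0' h2' h5' h6' h7'
    have e1 : viaExp.value ⟨env', B⟩ = B 2 (i * n + k) + A 5 (k * n + j) := by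
      simp [viaExp, ix, Exp.value, BinOp.apply, h0', h5', h6', h7', hB5]
    have e2 : (ix (.var 5) (.var 6)).value ⟨env', B⟩ = i * n + j := by
      simp [ix, Exp.value, BinOp.apply, h0', h5', h6']
    have e3 : (Exp.bin .lt viaExp (.load 2 (ix (.var 5) (.var 6)))).value ⟨env', B⟩ ≠ 0 ↔
        B 2 (i * n + k) + A 5 (k * n + j) < B 2 (i * n + j) := by
      rw [Exp.value, e1, Exp.value, e2]
      simp [BinOp.apply]
    by_cases hlt : B 2 (i * n + k) + A 5 (k * n + j) < B 2 (i * n + j)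
    · have hrun : relax.run env' B = setCell B 2 (i * n + j)
          (min (B 2 (i * n + k) + A 5 (k * n + j)) (env 2)) := by
        rw [relax, Stm.run, if_pos (e3.2 hlt), Stm.run, e1, e2, h2']
      rw [hrun]
      refine ⟨⟨fun b hb => ?_, fun hB u v => ?_, fun u v => ?_⟩, ?_⟩
      · funext c
        simp [setCell, hb]
      · simp only [setCell, true_and]
        split_ifs with heq
        · obtain ⟨h1, h2⟩ := (index_inj v.2 j.2).1 heq
          rw [Fin.ext h1, Fin.ext h2, Nat.cast_min, le_min_iff]
          refine ⟨?_, hW _ _⟩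
          have h3 := hB i k
          have h4 := hlow k j
          have h5 := mul_le_mul_of_nonneg_left (hg.triangle i k j) (Nat.cast_nonneg (α := ℝ) Q)
          push_cast
          linarith
        · exact hB u v
      · simp only [setCell, true_and]
        split_ifs with heq
        · rw [heq]
          exact (min_le_left _ _).trans hlt.le
        · exact le_rfl
      · simp [setCell]
    · rw [relax, Stm.run, if_neg (mt e3.1 hlt), Stm.run]
      exact ⟨hR B, not_lt.1 hlt⟩
  -- One round.
  have hround : ∀ (env' : ℕ → ℕ) (B : Mem), B 5 = A 5 → env' 0 = n → env' 2 = env 2 →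
      let B' := (Stm.loop 5 0 (.loop 6 0 (.loop 7 0 relax))).run env' B
      R B B' ∧ ∀ i j k : Fin n, B' 2 (i * n + j) ≤ B 2 (i * n + k) + A 5 (k * n + j) := by
    intro env' B hB5 h0' h2' B'
    let P : ℕ → ℕ → ℕ → Mem → Prop := fun i j k B' => ∀ (hi : i < n) (hj : j < n) (hk : k < n),
      B' 2 (i * n + j) ≤ B 2 (i * n + k) + A 5 (k * n + j)
    have hP : ∀ i j k C D, R C D → P i j k C → P i j k D := fun i j k C D hCD hC hi hj hk =>
      (hCD.2.2 ⟨i, hi⟩ ⟨j, hj⟩).trans (hC hi hj hk)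
    have key : R B B' ∧ ∀ i < n, ∀ j < n, ∀ k < n, P i j k B' := by
      simp only [B', Stm.run, h0']
      refine iter_forall (P := fun i C => ∀ j < n, ∀ k < n, P i j k C) hR hRt
        (fun i C D hCD hC j hj k hk => hP i j k C D hCD (hC j hj k hk)) fun i hi C hC => ?_
      simp only [Function.update_of_ne (show (0 : ℕ) ≠ 5 by decide), h0']
      refine iter_forall (P := fun j C => ∀ k < n, P i j k C) hR hRt
        (fun j C D hCD hC k hk => hP i j k C D hCD (hC k hk)) fun j hj D hD => ?_
      simp only [Function.update_of_ne (show (0 : ℕ) ≠ 5 by decide),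
        Function.update_of_ne (show (0 : ℕ) ≠ 6 by decide), h0']
      refine iter_forall (P := fun k C => P i j k C) hR hRt
        (fun k C D hCD hC => hP i j k C D hCD hC) fun k hk E hE => ?_
      have hBE : R B E := hRt _ _ _ hC (hRt _ _ _ hD hE)
      obtain ⟨r1, r2⟩ := hrelax
        (Function.update (Function.update (Function.update env' 5 i) 6 j) 7 k) E
        ⟨i, hi⟩ ⟨j, hj⟩ ⟨k, hk⟩ ((hBE.1 5 (by decide)).trans hB5) (by simp [h0']) (by simp [h2'])
        (by simp) (by simp) (by simp)
      refine ⟨r1, fun _ _ _ => r2.trans ?_⟩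
      exact Nat.add_le_add_right (hBE.2.2 ⟨i, hi⟩ ⟨k, hk⟩) _
    exact ⟨key.1, fun i j k => key.2 i i.2 j j.2 k k.2 i.2 j.2 k.2⟩
  have hfinal : R A (shortestPaths.run env A) ∧ ∀ i j : Fin n, IsGeodesicMetric.rank d i j ≤ n →
      (shortestPaths.run env A 2 (i * n + j) : ℝ) ≤ Q * d i j := by
    simp only [shortestPaths, Stm.run, h0]
    refine iter_induct (fun m B => R A B ∧ ∀ i j : Fin n, IsGeodesicMetric.rank d i j ≤ m →
      (B 2 (i * n + j) : ℝ) ≤ Q * d i j) ⟨hR A, fun i j hij => ?_⟩ ?_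
    · rcases eq_or_ne i j with rfl | hne
      · rw [h2, htight i i (hg.step_self i)]
      · obtain ⟨c, -, -, hc⟩ := hg.exists_last hne
        omega
    · rintro m - B ⟨hB, hm⟩
      obtain ⟨r1, r2⟩ := hround (Function.update env 4 m) B (hB.1 5 (by decide)) (by simp [h0])
        (by simp)
      simp only [Stm.run, Function.update_of_ne (show (0 : ℕ) ≠ 4 by decide), h0] at r1 r2
      simp only [Function.update_of_ne (show (0 : ℕ) ≠ 4 by decide), h0]
      refine ⟨hRt _ _ _ hB r1, fun i j hij => ?_⟩
      rcases eq_or_ne i j with rfl | hne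
      · refine le_trans ?_ (hm i i ?_)
        · exact_mod_cast r1.2.2 i i
        · have : IsGeodesicMetric.rank d i i = 0 := by
            simp [IsGeodesicMetric.rank, hg.self, (hg.nonneg i _).not_gt]
          omega
      · obtain ⟨c, hT, hc, hlt⟩ := hg.exists_last hne
        have h3 := hm i c (by omega)
        have h4 : ((_ : ℕ) : ℝ) ≤ ((_ : ℕ) : ℝ) := Nat.cast_le.2 (r2 i j c)
        rw [Nat.cast_add, htight c j hT] at h4
        rw [← hc, mul_add]
        linarith
  refine le_antisymm (hfinal.2 u v ?_) ?_
  · have := IsGeodesicMetric.rank_lt_card (d := d) u v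
    rw [Fintype.card_fin] at this
    exact this.le
  · exact hfinal.1.2.1 (fun i j => (hlow i j).trans_eq (by rw [h2])) u v

theorem run_writeScales (h1 : env 1 = J) (h2 : ∀ i < J + 2, Network.scale i ≤ env 2) :
    ∀ i < J + 2, writeScales.run env A 12 i = Network.scale i := by
  simp only [writeScales, Stm.run, h1]
  have s0 : Network.scale 0 = 2 := rfl
  have s1 : Network.scale 1 = 3 := rfl
  have b0 := h2 0 (by omega)
  have b1 := h2 1 (by omega)
  rw [s0] at b0
  rw [s1] at b1
  refine iter_induct (fun m (B : Mem) => ∀ i < m + 2, B 12 i = Network.scale i) ?_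
    fun k hk B hB i hi => ?_
  · intro i hi
    interval_cases i
    · simpa [setCell, Exp.value, s0] using b0
    · simpa [setCell, Exp.value, s1] using b1
  · have h3 := h2 (k + 2) (by omega)
    rw [Network.scale_add_two] at h3
    have h4 := hB k (by omega)
    by_cases hik : i = k + 2
    · subst hik
      simpa [setCell, Exp.value, BinOp.apply, h4, Network.scale_add_two] using h3
    · have := hB i (by omega)
      simpa [setCell, Exp.value, BinOp.apply, hik] using this

theorem run_writeRows (h0 : env 0 = n) (h1 : env 1 = J) (h2 : 1 ≤ env 2) (hJ : 8 ≤ J) :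
    ∀ i < J + 8, rowSet n (writeRows.run env A) 6 i = Finset.univ := by
  have m1 : ∀ A : Mem, Marks (.loop 4 1 (.loop 5 0 (.store 6 (ix (.var 4) (.var 5)) (.const 1))))
      env A 6 (fun _ => 1) _ := fun A => Marks.loop fun _ _ => Marks.loop fun _ _ =>
    Marks.store (by decide) (by decide) (by simpa [Exp.value] using h2)
  have m2 : ∀ A : Mem, Marks (.loop 4 1 (.loop 5 0 (.store 6 (ix (.bin .add (.var 4) (.const 8))
      (.var 5)) (.const 1)))) env A 6 (fun _ => 1) _ := fun A => Marks.loop fun _ _ =>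
    Marks.loop fun _ _ => Marks.store (by decide) (by decide) (by simpa [Exp.value] using h2)
  intro i hi
  refine Finset.eq_univ_of_forall fun u => ?_
  rw [mem_rowSet, writeRows, Stm.run, (m2 _).run_eq, (m1 _).run_eq]
  simp only [setOn, true_and]
  split_ifs with h3 h4
  · exact one_ne_zero
  · exact one_ne_zero
  · exfalso
    rcases lt_or_ge i J with h | h
    · exact h4 ⟨i, by rwa [h1], u, by simp [h0], by simp [ix, Exp.value, BinOp.apply, h0]⟩
    · refine h3 ⟨i - 8, by rw [h1]; omega, u, by simp [h0], ?_⟩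
      simp [ix, Exp.value, BinOp.apply, h0, show i - 8 + 8 = i by omega]

theorem run_prepare {N : RationalNetwork n} (hn : 0 < n) (hc : N.graph.Connected)
    (hl : ∀ e ∈ N.graph.edgeSet, 1 ≤ N.len e) (hu : N.toNetwork.UniqueShortestPaths)
    (h : InputMem N J (env 2) A) (h0 : env 0 = n) (h1 : env 1 = J) (hJ : 8 ≤ J) :
    let B := prepare.run env A
    DistMem N.toNetwork J B ∧ (∀ i < J + 8, rowSet n B 6 i = Finset.univ) ∧
      (∀ u v : Fin n, B 3 (u * n + v) = B 4 0) ∧ B 4 0 = denomProd n A := by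
  intro B
  have hg := Network.isGeodesicMetric (N := N.toNetwork) hc
    (RationalNetwork.lenGeOne_toNetwork hl) hu
  set Q := denomProd n A with hQdef
  have hQ := h.denomProd_pos
  have hlt := RationalNetwork.mul_dist_lt hl hQ h.den_dvd hc hu h.num_mul_le h.cap
  have hlow := RationalNetwork.mul_dist_le_scaledLen hl hQ h.den_dvd hc hu h.num_mul_le h.cap
  have htight := RationalNetwork.scaledLen_eq_iff hl hQ h.den_dvd hc hu h.num_mul_le h.cap
  have hle := RationalNetwork.scaledLen_le h.num_mul_le h.cap
  rw [← hQdef] at hlt hlow htight hle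
  have hQW : Q ≤ env 2 := h.prod_le le_rfl hn
  set A₁ := commonDenom.run env A with hA₁
  set A₂ := (fill 5 scaledLenExp).run env A₁ with hA₂
  set A₃ := (fill 2 (.load 5 (ix (.var 4) (.var 5)))).run env A₂ with hA₃
  set A₄ := shortestPaths.run env A₃ with hA₄
  set A₅ := (fill 3 denom).run env A₄ with hA₅
  set A₆ := writeScales.run env A₅ with hA₆
  have hB : B = writeRows.run env A₆ := rfl
  have f1 : ∀ b, b ≠ 4 → A₁ b = A b := fun b hb => Stm.run_frame _ _ _ (by
    simpa [commonDenom, Stm.writes] using hb)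
  have f2 : ∀ b, b ≠ 5 → A₂ b = A₁ b := fun b hb => Stm.run_frame _ _ _ (by
    simpa [fill, Stm.writes] using hb)
  have f3 : ∀ b, b ≠ 2 → A₃ b = A₂ b := fun b hb => Stm.run_frame _ _ _ (by
    simpa [fill, Stm.writes] using hb)
  have f4 : ∀ b, b ≠ 2 → A₄ b = A₃ b := fun b hb => Stm.run_frame _ _ _ (by
    simpa [shortestPaths, relax, Stm.writes] using hb)
  have f5 : ∀ b, b ≠ 3 → A₅ b = A₄ b := fun b hb => Stm.run_frame _ _ _ (by
    simpa [fill, Stm.writes] using hb)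
  have f6 : ∀ b, b ≠ 12 → A₆ b = A₅ b := fun b hb => Stm.run_frame _ _ _ (by
    simpa [writeScales, Stm.writes] using hb)
  have f7 : ∀ b, b ≠ 6 → B b = A₆ b := fun b hb => Stm.run_frame writeRows env A₆ (by
    simpa [writeRows, Stm.writes] using hb)
  have v1 : A₁ 4 0 = Q := run_commonDenom h h0 hn
  have v2 : ∀ u v : Fin n, A₂ 5 (u * n + v) = N.scaledLen Q (env 2) u v := by
    intro u v
    rw [hA₂, run_fill (by decide) h0, scaledLenExp_value (N := N) (u := u) (v := v) (W := env 2)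
      (by rw [f1 0 (by decide), h.num]) (by rw [f1 0 (by decide), h.den]) (by simp [h0]) (by simp)
      (by simp) (by simp), v1]
    exact min_eq_left (hle u v)
  have v3 : ∀ u v : Fin n, A₃ 2 (u * n + v) = A₃ 5 (u * n + v) := by
    intro u v
    rw [hA₃, run_fill (by decide) h0, ← hA₃, f3 5 (by decide)]
    simp only [ix, Exp.value, BinOp.apply]
    simp only [Function.update_apply, h0]
    norm_num
    rw [v2]
    exact hle u v
  have v3' : ∀ u v : Fin n, A₃ 5 (u * n + v) = N.scaledLen Q (env 2) u v := by
    intro u v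
    rw [f3 5 (by decide), v2]
  have v4 : ∀ u v : Fin n, (A₄ 2 (u * n + v) : ℝ) = Q * N.toNetwork.dist u v :=
    run_shortestPaths hg h0 (fun u v => (hlt u v).le) (fun u v => by rw [v3']; exact hlow u v)
      (fun u v hT => by rw [v3']; exact (htight u v).2 hT) v3
  have e4 : B 4 0 = Q := by
    rw [f7 4, f6 4, f5 4, f4 4, f3 4, f2 4, v1] <;> decide
  have e2 : B 2 = A₄ 2 := by rw [f7 2, f6 2, f5 2] <;> decide
  have e5 : ∀ u v : Fin n, B 5 (u * n + v) = N.scaledLen Q (env 2) u v := by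
    intro u v
    rw [← v3', f7 5, f6 5, f5 5, f4 5] <;> decide
  refine ⟨⟨by rw [e4]; exact hQ, fun u v => by rw [e2, e4, v4], fun u v => ?_, fun i hi => ?_⟩,
    run_writeRows h0 h1 (by omega) hJ, fun u v => ?_, e4⟩
  · rw [e5, e2, ← htight, ← v4, Nat.cast_inj]
  · rw [f7 12 (by decide)]
    exact run_writeScales h1 h.scale i (by omega)
  · rw [e4, f7 3 (by decide), f6 3 (by decide), hA₅, run_fill (by decide) h0]
    have : A₄ 4 0 = Q := by rw [f4 4, f3 4, f2 4, v1] <;> decide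
    simpa [denom, Exp.value, this] using hQW

end

/-! ### The labels -/

/-- The key of a vertex is determined by the last hitting set that contains it; ties are broken by
the number of the vertex. -/
def writeKeys : Stm :=
  .loop 3 1 (.loop 4 0 (.ite (.load 6 (ix (.var 3) (.var 4)))
    (.store 13 (.var 4) (ix (.var 3) (.var 4))) .skip))

/-- Make `var 5` a hub of `var 4` if no vertex on the shortest path between them has a larger
key. -/
def writeLabels : Stm :=
  .seq (fill 1 (.const 1))
    (.loop 4 0 (.loop 5 0 (.loop 6 0 (.ite (andExp (onPath (.var 4) (.var 6) (.var 5))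
      (.bin .lt (.load 13 (.var 5)) (.load 13 (.var 6))))
      (.store 1 (ix (.var 4) (.var 5)) (.const 0)) .skip))))

/-- The algorithm, once the parameters are known. -/
def labeling : Stm := .seq prepare (.seq (.loop 3 1 level) (.seq writeKeys writeLabels))

section

variable {n J : ℕ} {A : Mem} {env : ℕ → ℕ}

/-- Later levels overwrite earlier ones, so the last level of a vertex determines its key. -/
theorem run_writeKeys (h0 : env 0 = n) (h1 : env 1 = J) (h2 : J * n ≤ env 2) (hJ : 0 < J)
    (hrow : rowSet n A 6 0 = Finset.univ) (u : Fin n) :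
    ∃ i < J, u ∈ rowSet n A 6 i ∧ writeKeys.run env A 13 u = i * n + u ∧
      ∀ i' < J, u ∈ rowSet n A 6 i' → i' ≤ i := by
  have key : (∀ b, b ≠ 13 → writeKeys.run env A b = A b) ∧ ((∀ i < J, u ∉ rowSet n A 6 i) ∨
      ∃ i < J, u ∈ rowSet n A 6 i ∧ writeKeys.run env A 13 u = i * n + u ∧
        ∀ i' < J, u ∈ rowSet n A 6 i' → i' ≤ i) := by
    simp only [writeKeys, Stm.run, h1]
    refine iter_induct (fun m (B : Mem) => (∀ b, b ≠ 13 → B b = A b) ∧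
      ((∀ i < m, u ∉ rowSet n A 6 i) ∨ ∃ i < m, u ∈ rowSet n A 6 i ∧ B 13 u = i * n + u ∧
        ∀ i' < m, u ∈ rowSet n A 6 i' → i' ≤ i))
      ⟨fun _ _ => rfl, Or.inl fun i hi => absurd hi (by omega)⟩ ?_
    rintro k hk B ⟨hB, hor⟩
    have hmark : Marks (.loop 4 0 (.ite (.load 6 (ix (.var 3) (.var 4)))
        (.store 13 (.var 4) (ix (.var 3) (.var 4))) .skip)) (Function.update env 3 k) B 13
        (fun c => k * n + c) _ := Marks.loop fun l hl => Marks.ite (by decide)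
      (Marks.store (by decide) (by decide) (by
        have h3 : (k + 1) * n ≤ J * n := Nat.mul_le_mul_right n hk
        rw [Nat.succ_mul] at h3
        rw [Function.update_of_ne (by decide), h0] at hl
        have h4 : k * n + l ≤ env 2 := by omega
        simp [ix, Exp.value, BinOp.apply, h0, h4])) Marks.skip
    have hrun := hmark.run_eq
    have h13 : (Stm.loop 4 0 (.ite (.load 6 (ix (.var 3) (.var 4)))
        (.store 13 (.var 4) (ix (.var 3) (.var 4))) .skip)).run (Function.update env 3 k) B 13 u =
        if u ∈ rowSet n A 6 k then k * n + u else B 13 u := by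
      rw [hrun]
      simp only [setOn, true_and, and_false, or_false, mem_rowSet, ← hB 6 (by decide)]
      refine if_congr ⟨?_, fun hne => ⟨u, by simp [h0], ?_, ?_⟩⟩ rfl rfl
      · rintro ⟨l, -, h3, h4⟩
        simp [Exp.value] at h4
        subst h4
        simpa [ix, Exp.value, BinOp.apply, h0] using h3
      · simpa [ix, Exp.value, BinOp.apply, h0] using hne
      · simp [Exp.value]
    refine ⟨fun b hb => ?_, ?_⟩
    · have : iter (fun l => Stm.run (.ite (.load 6 (ix (.var 3) (.var 4)))
          (.store 13 (.var 4) (ix (.var 3) (.var 4))) .skip)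
          (Function.update (Function.update env 3 k) 4 l)) B (Function.update env 3 k 0) b = B b :=
        (congrFun hrun b).trans (setOn_of_ne hb _ _)
      exact this.trans (hB b hb)
    · simp only [Stm.run] at h13
      rw [h13]
      by_cases hu : u ∈ rowSet n A 6 k
      · rw [if_pos hu]
        exact Or.inr ⟨k, by omega, hu, rfl, fun i hi _ => by omega⟩
      · rw [if_neg hu]
        rcases hor with h3 | ⟨i, hi, h3, h4, h5⟩
        · refine Or.inl fun i hi => ?_
          rcases Nat.lt_succ_iff_lt_or_eq.1 hi with h | rfl
          · exact h3 i h
          · exact hu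
        · refine Or.inr ⟨i, by omega, h3, h4, fun i' hi' hu' => ?_⟩
          rcases Nat.lt_succ_iff_lt_or_eq.1 hi' with h | rfl
          · exact h5 i' h hu'
          · exact absurd hu' hu
  refine key.2.resolve_left fun h => h 0 hJ ?_
  rw [hrow]
  exact Finset.mem_univ u

theorem run_writeLabels {G : Network (Fin n)} (hD : DistMem G J A) (h0 : env 0 = n)
    (h2 : 1 ≤ env 2) (v u : Fin n) :
    writeLabels.run env A 1 (v * n + u) ≠ 0 ↔
      ∀ x : Fin n, Between G.dist v x u → A 13 x ≤ A 13 u := by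
  set A₁ := (fill 1 (.const 1)).run env A with hA₁
  have f1 : ∀ b, b ≠ 1 → A₁ b = A b := fun b hb => Stm.run_frame _ _ _ (by
    simpa [fill, Stm.writes] using hb)
  have hD₁ : DistMem G J A₁ := hD.congr (f1 2 (by decide)) (f1 4 (by decide)) (f1 5 (by decide))
    (f1 12 (by decide))
  have hone : A₁ 1 (v * n + u) = 1 := by
    rw [hA₁, run_fill (by decide) h0]
    simpa [Exp.value] using h2
  have hmark : Marks (.loop 4 0 (.loop 5 0 (.loop 6 0 (.ite (andExp
      (onPath (.var 4) (.var 6) (.var 5)) (.bin .lt (.load 13 (.var 5)) (.load 13 (.var 6))))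
      (.store 1 (ix (.var 4) (.var 5)) (.const 0)) .skip)))) env A₁ 1 (fun _ => 0) _ :=
    Marks.loop fun _ _ => Marks.loop fun _ _ => Marks.loop fun _ _ => Marks.ite (by decide)
      (Marks.store (by decide) (by decide) (by simp [Exp.value])) Marks.skip
  have hval : ∀ v u x : Fin n, (andExp (onPath (.var 4) (.var 6) (.var 5))
      (.bin .lt (.load 13 (.var 5)) (.load 13 (.var 6)))).value
      ⟨Function.update (Function.update (Function.update env 4 (v : ℕ)) 5 (u : ℕ)) 6 (x : ℕ),
        A₁⟩ ≠ 0 ↔ Between G.dist v x u ∧ A 13 u < A 13 x := by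
    intro v u x
    have h3 := onPath_value (a := .var 4) (x := .var 6) (b := .var 5) (a' := v) (x' := x) (b' := u)
      (env := Function.update (Function.update (Function.update env 4 (v : ℕ)) 5 (u : ℕ)) 6 (x : ℕ))
      hD₁ (by simp [h0]) (by simp [Exp.value]) (by simp [Exp.value]) (by simp [Exp.value])
    rw [andExp, Exp.value, h3]
    simp [Exp.value, BinOp.apply, f1 13, and_comm]
  have hrun : writeLabels.run env A 1 (v * n + u) ≠ 0 ↔
      ¬ ∃ x : Fin n, Between G.dist v x u ∧ A 13 u < A 13 x := by
    rw [writeLabels, Stm.run, ← hA₁, hmark.run_eq]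
    simp only [setOn, true_and, and_false, or_false, hone, ne_eq, ite_eq_left_iff, one_ne_zero,
      imp_false, not_not]
    refine not_congr ⟨?_, ?_⟩
    · rintro ⟨v', hv', u', hu', x, hx, h3, h4⟩
      rw [h0] at hv'
      rw [Function.update_of_ne (by decide), h0] at hu'
      rw [Function.update_of_ne (by decide), Function.update_of_ne (by decide), h0] at hx
      have h5 : (v : ℕ) * n + u = v' * n + u' := by
        simpa [ix, Exp.value, BinOp.apply, h0] using h4
      obtain ⟨rfl, rfl⟩ := (index_inj u.2 hu').1 h5
      exact ⟨⟨x, hx⟩, (hval v u ⟨x, hx⟩).1 h3⟩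
    · rintro ⟨x, hx⟩
      exact ⟨v, by rw [h0]; exact v.2, u, by simp [h0], x, by simp [h0], (hval v u x).2 hx,
        by simp [ix, Exp.value, BinOp.apply, h0]⟩
  rw [hrun]
  push Not
  rfl

/-- The algorithm computes the canonical labels for the keys of the hitting sets. -/
theorem run_labeling {N : RationalNetwork n} (hn : 2 ≤ n) (hc : N.graph.Connected)
    (hl : ∀ e ∈ N.graph.edgeSet, 1 ≤ N.len e) (hu : N.toNetwork.UniqueShortestPaths)
    (h : InputMem N J (env 2) A) (h0 : env 0 = n) (h1 : env 1 = J) (hJ : 8 ≤ J)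
    (hnn : n * n ≤ env 2) (hJn : J * n ≤ env 2)
    (hdiam : N.toNetwork.diameter ≤ Network.radius J) :
    ∃ L : Fin n → Finset (Fin n), N.Holds ⟨env, labeling.run env A⟩ L ∧ N.toNetwork.IsHHL L ∧
      ∀ v : Fin n, ((L v).card : ℝ) ≤ 1000 * (N.toNetwork.highwayDimension *
        Real.logb 2 N.toNetwork.highwayDimension *
        (1 + Real.logb 2 N.toNetwork.diameter)) := by
  have hl' := RationalNetwork.lenGeOne_toNetwork hl
  have : Nontrivial (Fin n) := Fin.nontrivial_iff_two_le.2 hn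
  have h2 : 1 ≤ env 2 := by nlinarith
  set A₁ := prepare.run env A with hA₁
  set A₂ := (Stm.loop 3 1 level).run env A₁ with hA₂
  set A₃ := writeKeys.run env A₂ with hA₃
  have hend : labeling.run env A = writeLabels.run env A₃ := rfl
  obtain ⟨p1, p2, p3, p4⟩ := run_prepare (by omega) hc hl hu h h0 h1 hJ
  rw [← hA₁] at p1 p2 p3 p4
  have le₁ : ∀ b i, A₁ b i ≤ env 2 := Stm.run_le prepare (lo := 3) le_rfl (by
    simp [prepare, commonDenom, fill, shortestPaths, relax, writeScales, writeRows,
      Stm.WellFormed]) h.le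
  have hC : N.toNetwork.LevelSets J (rowSet n A₂ 6) :=
    run_levels (G := N.toNetwork) hc hl' hu p1 le₁ h0 h1 (by omega) hnn p2
  have f2 : ∀ b, b ∉ level.writes → A₂ b = A₁ b := fun b hb =>
    Stm.run_frame (.loop 3 1 level) env A₁ hb
  have f3 : ∀ b, b ≠ 13 → A₃ b = A₂ b := fun b hb => Stm.run_frame _ _ _ (by
    simpa [writeKeys, Stm.writes] using hb)
  have hD₃ : DistMem N.toNetwork J A₃ := p1.congr (by rw [f3 2, f2 2] <;> decide)
    (by rw [f3 4, f2 4] <;> decide) (by rw [f3 5, f2 5] <;> decide)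
    (by rw [f3 12, f2 12] <;> decide)
  have hkey := run_writeKeys (A := A₂) h0 h1 hJn (by omega) (hC.low 0 (by omega))
  rw [← hA₃] at hkey
  let key : Fin n → ℕ := fun u => A₃ 13 u
  have hinj : Function.Injective key := by
    intro u u' huu
    obtain ⟨i, -, -, e1, -⟩ := hkey u
    obtain ⟨i', -, -, e2, -⟩ := hkey u'
    have h3 : A₃ 13 u = A₃ 13 u' := huu
    rw [e1, e2] at h3
    exact Fin.ext ((index_inj u.2 u'.2).1 h3).2
  have hlevel : ∀ i < J, ∀ x u, x ∈ rowSet n A₂ 6 i → key x ≤ key u →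
      ∃ j ≥ i, j < J ∧ u ∈ rowSet n A₂ 6 j := by
    intro i hi x u hx hxu
    obtain ⟨i₁, -, -, e1, hmax⟩ := hkey x
    obtain ⟨i₂, hi₂, hu₂, e2, -⟩ := hkey u
    refine ⟨i₂, (hmax i hi hx).trans ?_, hi₂, hu₂⟩
    by_contra hcon
    have h3 : A₃ 13 x ≤ A₃ 13 u := hxu
    rw [e1, e2] at h3
    have h4 : (i₂ + 1) * n ≤ i₁ * n := Nat.mul_le_mul_right n (by omega)
    rw [Nat.succ_mul] at h4
    have := u.2
    omega
  have f4 : ∀ b, b ≠ 1 → labeling.run env A b = A₃ b := fun b hb => by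
    rw [hend]
    exact Stm.run_frame _ _ _ (by simpa [writeLabels, fill, Stm.writes] using hb)
  refine ⟨N.toNetwork.canonicalLabel key, fun v u => ⟨?_, fun _ => ?_⟩,
    Network.isHHL_canonicalLabel (N := N.toNetwork) hc hl' hinj,
    hC.card_label_le (N := N.toNetwork) hc hl' hu hdiam hlevel⟩
  · rw [Network.mem_canonicalLabel_iff_between (N := N.toNetwork) hc hl' hu]
    simp only [hend]
    exact (run_writeLabels hD₃ h0 h2 v u).symm
  · have e3 : labeling.run env A 3 (v * n + u) = A₃ 4 0 := by
      rw [f4 3 (by decide), f3 3 (by decide), f2 3 (by decide), p3, f3 4 (by decide),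
        f2 4 (by decide)]
    have e2 : labeling.run env A 2 (v * n + u) = A₃ 2 (v * n + u) := by rw [f4 2 (by decide)]
    have hpos := hD₃.pos
    simp only [e2, e3]
    refine ⟨hpos.ne', ?_⟩
    rw [hD₃.dist, mul_div_cancel_left₀ _ (by exact_mod_cast hpos.ne')]

end

end RAM

/-! ### The input -/

namespace RAM

theorem inputProd_eq (w : List ℕ) :
    inputProd w = ∏ k ∈ Finset.range w.length, (1 + w.getD k 0) := by
  rw [inputProd, Finset.prod_range, ← List.prod_ofFn]
  congr 1
  refine List.ext_getElem (by simp) fun i h1 h2 => ?_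
  simp

theorem getD_lt_inputProd (w : List ℕ) (i : ℕ) : w.getD i 0 < inputProd w := by
  rcases lt_or_ge i w.length with h | h
  · have h1 := Finset.single_le_prod' (f := fun k => 1 + w.getD k 0)
      (s := Finset.range w.length) (fun _ _ => by omega) (Finset.mem_range.2 h)
    rw [← inputProd_eq] at h1
    omega
  · rw [List.getD_eq_default _ _ h]
    exact inputProd_pos w

theorem two_pow_size_le {B : ℕ} (hB : 0 < B) : 2 ^ B.size ≤ 2 * B := by
  have h1 : 0 < B.size := Nat.size_pos.2 hB
  have h2 : 2 ^ (B.size - 1) ≤ B := Nat.lt_size.1 (by omega)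
  calc 2 ^ B.size = 2 * 2 ^ (B.size - 1) := by rw [← pow_succ']; congr 1; omega
    _ ≤ 2 * B := by omega

end RAM

namespace RationalNetwork

open RAM

variable {n : ℕ} (N : RationalNetwork n)

theorem encode_getD_zero : N.encode.getD 0 0 = n := rfl

theorem length_encode : N.encode.length = 1 + 2 * (n * n) := by
  simp [encode]
  ring

theorem divNat_modNat (u v : Fin n) (h : u * n + v < n * n) :
    (⟨u * n + v, h⟩ : Fin (n * n)).divNat = u ∧ (⟨u * n + v, h⟩ : Fin (n * n)).modNat = v := by
  have hn : 0 < n := by have := u.2; omega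
  constructor
  · ext
    simp only [Fin.coe_divNat]
    rw [mul_comm, Nat.mul_add_div hn, Nat.div_eq_of_lt v.2, add_zero]
  · ext
    simp only [Fin.coe_modNat]
    rw [Nat.mul_add_mod', Nat.mod_eq_of_lt v.2]

theorem encode_getD_num (u v : Fin n) : N.encode.getD (1 + (u * n + v)) 0 = N.num u v := by
  have h := index_lt u v
  obtain ⟨h1, h2⟩ := divNat_modNat u v h
  rw [encode, add_comm, List.getD_cons_succ, List.getD_append _ _ _ _ (by simpa using h),
    List.getD_eq_getElem _ _ (by simpa using h), List.getElem_ofFn, h1, h2, num]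

theorem encode_getD_den (u v : Fin n) :
    N.encode.getD (1 + n * n + (u * n + v)) 0 = N.den u v := by
  have h := index_lt u v
  obtain ⟨h1, h2⟩ := divNat_modNat u v h
  rw [encode, show 1 + n * n + (u * n + v) = n * n + (u * n + v) + 1 by ring,
    List.getD_cons_succ, List.getD_append_right _ _ _ _ (by simp)]
  simp only [List.length_ofFn, Nat.add_sub_cancel_left]
  rw [List.getD_eq_getElem _ _ (by simpa using h), List.getElem_ofFn, h1, h2, den]

/-- Every factor on the left is at most the corresponding factor of the product of the input. -/
theorem mul_prod_lt_inputProd :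
    n * ((∏ k ∈ Finset.range (n * n), (1 + (start N.encode).arr 0 (1 + k))) *
      ∏ k ∈ Finset.range (n * n), (start N.encode).arr 0 (1 + n * n + k)) <
      inputProd N.encode := by
  have h1 : inputProd N.encode = (1 + n) *
      ((∏ k ∈ Finset.range (n * n), (1 + N.encode.getD (1 + k) 0)) *
      ∏ k ∈ Finset.range (n * n), (1 + N.encode.getD (1 + n * n + k) 0)) := by
    rw [inputProd_eq, length_encode, show 1 + 2 * (n * n) = 1 + n * n + n * n by ring,
      Finset.prod_range_add, Finset.prod_range_add, Finset.prod_range_one, encode_getD_zero,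
      mul_assoc]
  rw [h1]
  simp only [start, if_true]
  refine Nat.mul_lt_mul_of_lt_of_le (by omega) (Nat.mul_le_mul_left _ ?_) (by positivity)
  exact Finset.prod_le_prod' fun _ _ => by omega

/-- The numbers bounded by the cap `1024 * B ^ 4` are at most `B` or, like the largest scale, a
small multiple of `4 ^ B.size ≤ (2 * B) ^ 2`. -/
theorem inputMem_start :
    InputMem N (4 * (inputProd N.encode).size + 10) (1024 * inputProd N.encode ^ 4)
      (start N.encode).arr := by
  set B := inputProd N.encode with hB
  have hpos : 0 < B := inputProd_pos _
  have hle : B ≤ 1024 * B ^ 4 := by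
    have := Nat.le_self_pow (n := 4) (by norm_num) B
    omega
  refine ⟨fun u v => ?_, fun u v => ?_, N.mul_prod_lt_inputProd.trans_le hle, fun i hi => ?_,
    fun b i => ?_⟩
  · simpa [start] using N.encode_getD_num u v
  · simpa [start] using N.encode_getD_den u v
  · have h1 := two_pow_size_le hpos
    calc Network.scale i ≤ 3 * 2 ^ (i / 2) := Network.scale_le i
      _ ≤ 3 * 2 ^ (2 * B.size + 5) := by
          gcongr
          · norm_num
          · omega
      _ = 96 * (2 ^ B.size) ^ 2 := by rw [pow_add, mul_comm 2, pow_mul]; ring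
      _ ≤ 96 * (2 * B) ^ 2 := by gcongr
      _ = 384 * B ^ 2 := by ring
      _ ≤ 1024 * B ^ 4 := Nat.mul_le_mul (by norm_num) (Nat.pow_le_pow_right hpos (by norm_num))
  · simp only [start]
    split_ifs
    · exact (getD_lt_inputProd N.encode i).le.trans hle
    · exact Nat.zero_le _

variable {N}

/-- The last scale is beyond the diameter: it is at least `4 ^ B.size`, and `B < 2 ^ B.size` exceeds
the diameter. -/
theorem diameter_le_radius (hn : 2 ≤ n) (hc : N.graph.Connected)
    (hl : ∀ e ∈ N.graph.edgeSet, 1 ≤ N.len e) (hu : N.toNetwork.UniqueShortestPaths) :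
    N.toNetwork.diameter ≤ Network.radius (4 * (inputProd N.encode).size + 10) := by
  set B := inputProd N.encode with hB
  have h := N.inputMem_start
  have hpos : (1 : ℝ) ≤ B := by exact_mod_cast inputProd_pos N.encode
  have : Nonempty (Fin n × Fin n) := ⟨⟨0, by omega⟩, ⟨0, by omega⟩⟩
  have h1 : N.toNetwork.diameter ≤ B := ciSup_le fun x => by
    have h2 := mul_dist_lt hl h.denomProd_pos h.den_dvd hc hu h.num_mul_le
      N.mul_prod_lt_inputProd x.1 x.2
    have h3 : (1 : ℝ) ≤ denomProd n (start N.encode).arr := by exact_mod_cast h.denomProd_pos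
    have h4 := Network.dist_nonneg (N := N.toNetwork) hc (lenGeOne_toNetwork hl) x.1 x.2
    exact (le_mul_of_one_le_left h4 h3).trans h2.le
  have h2 : (B : ℝ) ≤ 2 ^ B.size := by exact_mod_cast (Nat.lt_size_self B).le
  have h3 : 2 * 2 ^ (2 * B.size + 5) ≤ Network.scale (4 * B.size + 10) := by
    have := Network.two_pow_le_scale (4 * B.size + 10)
    rwa [show (4 * B.size + 10) / 2 = 2 * B.size + 5 by omega] at this
  have h4 : (2 : ℝ) * 2 ^ (2 * B.size + 5) ≤ Network.scale (4 * B.size + 10) := by exact_mod_cast h3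
  rw [pow_add, mul_comm 2 B.size, pow_mul] at h4
  unfold Network.radius
  rw [le_div_iff₀ (by norm_num)]
  nlinarith

/-- With the parameters from `setup`, the algorithm computes the labels in polynomial time. -/
theorem exec_setup_labeling (hn : 2 ≤ n) (hc : N.graph.Connected)
    (hl : ∀ e ∈ N.graph.edgeSet, 1 ≤ N.len e) (hu : N.toNetwork.UniqueShortestPaths) :
    ∃ t s L, Exec (.seq setup labeling.compile) (start N.encode) t s ∧
      t ≤ ((1 + setupBound + labeling.timeBound).comp (4 * Polynomial.X + 25)).eval
        (inputSize N.encode) ∧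
      N.Holds s L ∧ N.toNetwork.IsHHL L ∧
      ∀ v : Fin n, ((L v).card : ℝ) ≤ 1000 * (N.toNetwork.highwayDimension *
        Real.logb 2 N.toNetwork.highwayDimension *
        (1 + Real.logb 2 N.toNetwork.diameter)) := by
  set B := inputProd N.encode with hB
  set X := 4 * inputSize N.encode + 25 with hX
  set J := 4 * B.size + 10 with hJ
  set env := params n J (1024 * B ^ 4) 0 with henv
  have h := N.inputMem_start
  have hpos : 0 < B := inputProd_pos _
  have hsize : B.size ≤ inputSize N.encode := size_inputProd_le _ (by simp [encode])
  have hlen := length_le_inputSize N.encode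
  rw [length_encode] at hlen
  have hnn : n ≤ n * n := Nat.le_mul_self n
  have hnB : n ≤ B := (getD_lt_inputProd N.encode 0).le
  have hBB : B * B ≤ B ^ 4 := by
    rw [← pow_two]
    exact Nat.pow_le_pow_right hpos (by norm_num)
  have hnnW : n * n ≤ 1024 * B ^ 4 := by
    have := Nat.mul_le_mul hnB hnB
    omega
  have hJn : J * n ≤ 1024 * B ^ 4 := by
    have h1 := size_le_self B
    have h2 : J * n ≤ (14 * B) * B := Nat.mul_le_mul (by omega) hnB
    rw [mul_assoc] at h2
    omega
  have hWsize : (1024 * B ^ 4).size ≤ X := by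
    have h1 := size_mul_le 1024 (B ^ 4)
    have h2 := size_mul_le (B ^ 2) (B ^ 2)
    have h3 := size_mul_le B B
    rw [← pow_add, show 2 + 2 = 4 from rfl] at h2
    rw [← pow_two] at h3
    have h4 : (1024 : ℕ).size ≤ 11 := Nat.size_le.2 (by norm_num)
    omega
  obtain ⟨t, ht, hE⟩ := exec_setup (X := X) N.encode_getD_zero N.length_encode le_rfl
  obtain ⟨t', ht', hE'⟩ := labeling.exec_compile (env := env) (A := (start N.encode).arr) (X := X)
    (lo := 3) (by omega) le_rfl
    (by simp [labeling, prepare, commonDenom, fill, shortestPaths, relax, writeScales, writeRows,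
      level, hitFamily, markFamily, greedyRound, countHits, findBest, chooseBest, improve,
      writeKeys, writeLabels, Stm.WellFormed])
    (fun y hy => by
      match y, hy with
      | 3, _ => rfl
      | y + 4, _ => rfl)
    (size_params_le ((size_le_self n).trans (by omega)) ((size_le_self J).trans (by omega)) hWsize
      (by simp))
    (fun b hb => by
      interval_cases b
      · simp only [henv, params]; omega
      · simp only [henv, params]; omega)
    (fun a i => by
      simp only [start]
      split_ifs
      · exact (size_getD_le _ _).trans (by omega)
      · simp)
  obtain ⟨L, hL⟩ := run_labeling (env := env) hn hc hl hu h rfl rfl (by omega) hnnW hJn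
    (diameter_le_radius hn hc hl hu)
  refine ⟨_, _, L, Exec.seq hE hE', ?_, hL⟩
  simp only [Polynomial.eval_comp, Polynomial.eval_add, Polynomial.eval_mul, Polynomial.eval_X,
    Polynomial.eval_ofNat, Polynomial.eval_one, ← hX]
  omega

end RationalNetwork

end

theorem mainTheorem9 :
    (∃ C : ℝ, ∀ (V : Type*) [Fintype V] [Nontrivial V] (N : Network V),
      N.graph.Connected → (∀ e ∈ N.graph.edgeSet, 1 ≤ N.len e) →
      ∃ L : V → Finset V, N.IsHHL L ∧
        ∀ v : V, ((L v).card : ℝ) ≤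
          C * (N.highwayDimension * (1 + Real.logb 2 N.diameter))) ∧
    (∃ (C : ℝ) (prog : RAM.Cmd) (T : Polynomial ℕ), ∀ (n : ℕ) (N : RationalNetwork n),
      2 ≤ n → N.graph.Connected → (∀ e ∈ N.graph.edgeSet, 1 ≤ N.len e) →
      N.toNetwork.UniqueShortestPaths →
      ∃ (t : ℕ) (s : RAM.Store) (L : Fin n → Finset (Fin n)),
        RAM.Exec prog (RAM.start N.encode) t s ∧
        t ≤ T.eval (RAM.inputSize N.encode) ∧
        N.Holds s L ∧
        N.toNetwork.IsHHL L ∧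
        ∀ v : Fin n, ((L v).card : ℝ) ≤
          C * (N.toNetwork.highwayDimension * Real.logb 2 N.toNetwork.highwayDimension *
            (1 + Real.logb 2 N.toNetwork.diameter))) := by
  refine ⟨⟨4, fun V _ _ N hc hl => Network.exists_isHHL_card_le hc hl⟩, 1000,
    .seq RAM.setup RAM.labeling.compile, _, fun n N hn hc hl hu =>
      RationalNetwork.exec_setup_labeling hn hc hl hu⟩
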